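/- \textbf{Corollary (CLTs with deterministic gaps).} Let $\phi_1,\phi_2>0$ and let $k\ge 0$, $m\ge k+1$ be integers with $\phi_2<k+1$ (for instance $k=\lfloor\phi_2\rfloor$). Let $X=\{X(x):x\in\mathbb R^2\}$ be a Gaussian intrinsic random function of order $k$ with the power-law generalized covariance \[ K(h)=\phi_1\Gamma(-\phi_2)\|h\|^{2\phi_2}\ (\phi_2\notin\mathbb N),\qquad K(h)=\frac{2\phi_1(-1)^{\phi_2+1}}{\phi_2!}\|h\|^{2\phi_2}\log\|h\|\ (\phi_2\in\mathbb N),\qquad K(0)=0, \] that is: whenever finitely many $x_i\in\mathbb R^2$ and $w_i\in\mathbb R$ satisfy $\sum_i w_ip(x_i)=0$ for all polynomials $p$ of total degree at most $k$, the variable $\sum_i w_iX(x_i)$ is centered Gaussian with variance $\sum_{i,i'}w_iw_{i'}K(x_i-x_{i'})$. Put $\Lambda_l=\{0,\dots,l-1\}^2$ and $N=n^2$. Consider either the increasing-domain (ID) data $X_t=X(t)$ with $\rho_n=1$, or the fixed-domain (FD) data $X_t=X(t/n)$ with $\rho_n=n^{2\phi_2}$, for $t\in\Lambda_n$. For $j\in\{1,2\}$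 let \[ (D^{(m)}_{[j]}X)_t=\sum_{a\in\{0,\dots,m\}^2}(-1)^{a_1+a_2}\binom m{a_1}\binom m{a_2}X_{t+ja},\qquad Q^{(m)}_j=\frac1{|\Lambda_{n-jm}|}\sum_{t\in\Lambda_{n-jm}}\bigl(D^{(m)}_{[j]}X_t\bigr)^2 , \] and $q^{(m)}_j=\mathbb E\,Q^{(m)}_j$. Let $\mathcal M_n\subset\Lambda_n$ be deterministic sets of deleted sites, $k_n=|\mathcal M_n|$, and let $\widetilde Q^{(m)}_j$ be the average of $(D^{(m)}_{[j]}X_t)^2$ over those $t\in\Lambda_{n-jm}$ for which $t+j\{0,\dots,m\}^2$ contains no deleted site. With $\mathbf X_n=(X_t)_{t\in\Lambda_n}$ write $\alpha Q^{(m)}_1+\beta Q^{(m)}_2=\mathbf X_n^\top A^{(m)}_{\alpha,\beta}\mathbf X_n$ and $\alpha\widetilde Q^{(m)}_1+\beta\widetilde Q^{(m)}_2=\mathbf X_n^\top\widetilde A^{(m)}_{\alpha,\beta}\mathbf X_n$. (For the finitely many $n$ for which one of these averages is over an empty set, that average is taken to be $0$.) Suppose $k_n=o(\sqrt N)$ as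 $n\to\infty$. Then, under ID and under FD: (i) for all fixed $\alpha,\beta\in\mathbb R$ the two quadratic forms are integrable and \[ \sqrt N\,\rho_n\bigl\{\mathbf X_n^\top\widetilde A^{(m)}_{\alpha,\beta}\mathbf X_n-\mathbb E[\mathbf X_n^\top\widetilde A^{(m)}_{\alpha,\beta}\mathbf X_n]\bigr\} -\sqrt N\,\rho_n\bigl\{\mathbf X_n^\top A^{(m)}_{\alpha,\beta}\mathbf X_n-\mathbb E[\mathbf X_n^\top A^{(m)}_{\alpha,\beta}\mathbf X_n]\bigr\}\xrightarrow{p}0; \] (ii) the joint CLT holds for the pruned forms with the covariance matrix of the unpruned case ($\mathcal M_n=\emptyset$): \[ \sqrt N\,\rho_n\begin{pmatrix}\widetilde Q^{(m)}_1-q^{(m)}_1\\ \widetilde Q^{(m)}_2-q^{(m)}_2\end{pmatrix}\Rightarrow\mathcal N(0,\Sigma^{(m)}), \qquad \Sigma^{(m)}_{\ell r}=2\int_{(-\pi,\pi]^2}b_\ell(\lambda)b_r(\lambda)F(\lambda)^2\,\frac{d\lambda}{(2\pi)^2}, \] where $\Sigma^{(m)}$ is positive semidefinite, $b_1\equiv1$,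 $b_2(\lambda)=\prod_{i=1}^2(2\cos(\lambda_i/2))^{2m}$, and $F$ is the spectral density of $D^{(m)}_{[1]}X$ on the unit lattice, \[ F(\lambda)=|1-e^{i\lambda_1}|^{2m}|1-e^{i\lambda_2}|^{2m}\sum_{l\in\mathbb Z^2}f_0(\lambda+2\pi l),\qquad f_0(\xi)=4^{\phi_2+1}\pi\,\Gamma(\phi_2+1)\,\phi_1\,\|\xi\|^{-(2+2\phi_2)} . \] -/

import Mathlib

open MeasureTheory ProbabilityTheory Filter Topology Asymptotics Matrix

noncomputable section

namespace PowerLawGaps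

/-- The plane, with its Euclidean norm. -/
abbrev Plane : Type := EuclideanSpace ℝ (Fin 2)

/-! ### Power-law intrinsic random functions -/

/-- A finitely supported signed measure `∑ w(x) δ_x` on the plane is allowable of order `k` if it
annihilates every polynomial of total degree at most `k`. -/
def Allowable (k : ℕ) (w : Plane →₀ ℝ) : Prop :=
  ∀ p : MvPolynomial (Fin 2) ℝ, p.totalDegree ≤ k →
    (w.sum fun x c => c * MvPolynomial.eval (fun i => x i) p) = 0

/-- `X` is a Gaussian intrinsic random function of order `k` with generalized covariance `K`:
every allowable functional `∑ w(x) X(x)` is centered Gaussian with variance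
`∑ w(x) w(y) K(x - y)`. -/
structure IsGaussianIRF {Ω : Type*} [MeasurableSpace Ω] (k : ℕ) (K : Plane → ℝ)
    (X : Plane → Ω → ℝ) (P : Measure Ω) : Prop where
  aemeasurable : ∀ x, AEMeasurable (X x) P
  gaussian : ∀ w : Plane →₀ ℝ, Allowable k w →
    HasGaussianLaw (fun ω => w.sum fun x c => c * X x ω) P
  centered : ∀ w : Plane →₀ ℝ, Allowable k w →
    ∫ ω, (w.sum fun x c => c * X x ω) ∂P = 0
  variance_eq : ∀ w : Plane →₀ ℝ, Allowable k w →
    variance (fun ω => w.sum fun x c => c * X x ω) P =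
      w.sum fun x c => w.sum fun y d => c * d * K (x - y)

/-- The power-law generalized covariance: `φ₁ Γ(-φ₂) ‖h‖^(2φ₂)` when `φ₂` is not an integer,
and `2 φ₁ (-1)^(φ₂+1) / φ₂! * ‖h‖^(2φ₂) log ‖h‖` when it is (with value `0` at `h = 0`). -/
def powerLawGC (φ₁ φ₂ : ℝ) (h : Plane) : ℝ :=
  if φ₂ = (⌊φ₂⌋₊ : ℝ) then
    2 * φ₁ * (-1) ^ (⌊φ₂⌋₊ + 1) / (⌊φ₂⌋₊.factorial : ℝ) * ‖h‖ ^ (2 * φ₂) * Real.log ‖h‖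
  else
    φ₁ * Real.Gamma (-φ₂) * ‖h‖ ^ (2 * φ₂)

/-! ### Bilinear differences on the lattice and their quadratic forms -/

/-- The square lattice window `{0, …, n-1}²`. -/
def Lam (n : ℕ) : Finset (ℕ × ℕ) := Finset.range n ×ˢ Finset.range n

/-- The coefficients `(-1)^(a₁+a₂) (m choose a₁) (m choose a₂)`. -/
def stencilCoeff (m : ℕ) (a : ℕ × ℕ) : ℝ :=
  (-1) ^ (a.1 + a.2) * (m.choose a.1 : ℝ) * (m.choose a.2 : ℝ)

/-- The order-`m` bilinear difference at step `j`. -/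
def bilinearDiff (m j : ℕ) (x : ℕ × ℕ → ℝ) (t : ℕ × ℕ) : ℝ :=
  ∑ a ∈ Lam (m + 1), stencilCoeff m a * x (t + j • a)

/-- All positions `t` whose step-`j` stencil `t + j{0,…,m}²` lies in the window `Lam n`
(for `j ≥ 1`). -/
def allRows (m j n : ℕ) : Finset (ℕ × ℕ) := Lam (n - j * m)

/-- The positions whose stencil touches no site of the deleted set `D`. -/
def keptRows (m j n : ℕ) (D : Finset (ℕ × ℕ)) : Finset (ℕ × ℕ) :=
  (allRows m j n).filter fun t => ∀ a ∈ Lam (m + 1), t + j • a ∉ D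

/-- The filter matrix that stacks the bilinear differences at the positions `t ∈ R`, acting on
the data vector indexed by `Lam n`. -/
def filterMatrix (m j n : ℕ) (R : Finset (ℕ × ℕ)) : Matrix R (Lam n) ℝ :=
  Matrix.of fun t s =>
    ∑ a ∈ Lam (m + 1), if (t : ℕ × ℕ) + j • a = (s : ℕ × ℕ) then stencilCoeff m a else 0

/-- The weight matrix `|R|⁻¹ Fᵀ F` of the rows `R`. -/
def weightMatrix (m j n : ℕ) (R : Finset (ℕ × ℕ)) : Matrix (Lam n) (Lam n) ℝ :=
  (R.card : ℝ)⁻¹ • ((filterMatrix m j n R)ᵀ * filterMatrix m j n R)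

/-- The unpruned weight matrix `α A₁ + β A₂`. -/
def fullWeight (m n : ℕ) (α β : ℝ) : Matrix (Lam n) (Lam n) ℝ :=
  α • weightMatrix m 1 n (allRows m 1 n) + β • weightMatrix m 2 n (allRows m 2 n)

/-- The pruned weight matrix `α Ã₁ + β Ã₂`, each part with its own divisor. -/
def prunedWeight (m n : ℕ) (D : Finset (ℕ × ℕ)) (α β : ℝ) : Matrix (Lam n) (Lam n) ℝ :=
  α • weightMatrix m 1 n (keptRows m 1 n D) + β • weightMatrix m 2 n (keptRows m 2 n D)

/-- The quadratic form `xᵀ A x` of the data `x` on `Lam n`. -/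
def quadForm {n : ℕ} (A : Matrix (Lam n) (Lam n) ℝ) (x : ℕ × ℕ → ℝ) : ℝ :=
  (fun s : Lam n => x s) ⬝ᵥ (A *ᵥ fun s : Lam n => x s)

/-- The quadratic variation: the average of the squared bilinear differences over all
positions. -/
def Q (m j n : ℕ) (x : ℕ × ℕ → ℝ) : ℝ :=
  ((allRows m j n).card : ℝ)⁻¹ * ∑ t ∈ allRows m j n, bilinearDiff m j x t ^ 2

/-- The pruned quadratic variation: the average over the positions that touch no deleted site. -/
def prunedQ (m j n : ℕ) (D : Finset (ℕ × ℕ)) (x : ℕ × ℕ → ℝ) : ℝ :=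
  ((keptRows m j n D).card : ℝ)⁻¹ * ∑ t ∈ keptRows m j n D, bilinearDiff m j x t ^ 2

/-! ### Sampling regimes -/

/-- Increasing-domain and fixed-domain asymptotics. -/
inductive Regime where
  | increasing
  | fixed

/-- The grid spacing: `1` under increasing-domain and `1/n` under fixed-domain asymptotics. -/
def Regime.spacing : Regime → ℕ → ℝ
  | .increasing, _ => 1
  | .fixed, n => 1 / (n : ℝ)

/-- The factor by which quadratic forms are rescaled: `1` under increasing-domain and
`n^(2φ₂)` under fixed-domain asymptotics. -/
def Regime.gain (φ₂ : ℝ) : Regime → ℕ → ℝ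
  | .increasing, _ => 1
  | .fixed, n => (n : ℝ) ^ (2 * φ₂)

/-- The data `t ↦ X(spacing • t)`. -/
def sample {Ω : Type*} (X : Plane → Ω → ℝ) (r : Regime) (n : ℕ) (ω : Ω) (t : ℕ × ℕ) : ℝ :=
  X (r.spacing n • !₂[(t.1 : ℝ), (t.2 : ℝ)]) ω

/-! ### Spectral densities and the limiting covariance -/

/-- The continuum spectral density `4^(φ₂+1) π Γ(φ₂+1) φ₁ ‖ξ‖^(-(2+2φ₂))` of the power law, with
respect to `(2π)⁻² dξ`. -/
def contDensity (φ₁ φ₂ : ℝ) (ξ : Plane) : ℝ :=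
  (4 : ℝ) ^ (φ₂ + 1) * Real.pi * Real.Gamma (φ₂ + 1) * φ₁ * ‖ξ‖ ^ (-(2 + 2 * φ₂))

/-- The aliased spectral density on the torus. -/
def latDensity (φ₁ φ₂ : ℝ) (ξ : Plane) : ℝ :=
  ∑' k : ℤ × ℤ, contDensity φ₁ φ₂ (ξ + (2 * Real.pi) • !₂[(k.1 : ℝ), (k.2 : ℝ)])

/-- The symbol `(1 - e^{iξ₁})^m (1 - e^{iξ₂})^m` of the unit-step bilinear difference. -/
def diffSymbol (m : ℕ) (ξ : Plane) : ℂ :=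
  (1 - Complex.exp (Complex.I * (ξ 0 : ℂ))) ^ m * (1 - Complex.exp (Complex.I * (ξ 1 : ℂ))) ^ m

/-- The spectral density of the unit-step bilinear difference of the field. -/
def filteredDensity (φ₁ φ₂ : ℝ) (m : ℕ) (ξ : Plane) : ℝ :=
  ‖diffSymbol m ξ‖ ^ 2 * latDensity φ₁ φ₂ ξ

/-- The symbols `b₁ = 1` and `b₂ = ∏ᵢ (2 cos(ξᵢ/2))^(2m)`. -/
def stepSymbol (m : ℕ) (l : Fin 2) (ξ : Plane) : ℝ :=
  if l = 0 then 1 else ∏ i : Fin 2, (2 * Real.cos (ξ i / 2)) ^ (2 * m)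

/-- The torus `(-π, π]²`. -/
def torus : Set Plane := {ξ | ∀ i, ξ i ∈ Set.Ioc (-Real.pi) Real.pi}

/-- The limiting covariance matrix `2 ∫ b_l b_r F² dξ / (2π)²` over the torus. -/
def limitCov (φ₁ φ₂ : ℝ) (m : ℕ) : Matrix (Fin 2) (Fin 2) ℝ :=
  Matrix.of fun l r => 2 * ((2 * Real.pi) ^ 2)⁻¹ *
    ∫ ξ in torus, stepSymbol m l ξ * stepSymbol m r ξ * filteredDensity φ₁ φ₂ m ξ ^ 2

/-- The matrix quadratic forms are the averages of the squared bilinear differences. -/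
theorem quadForm_weightMatrix (m j n : ℕ) (R : Finset (ℕ × ℕ)) (hR : R ⊆ allRows m j n)
    (x : ℕ × ℕ → ℝ) :
    quadForm (weightMatrix m j n R) x
      = (R.card : ℝ)⁻¹ * ∑ t ∈ R, bilinearDiff m j x t ^ 2 := by
  have key : ∀ t : R, (filterMatrix m j n R *ᵥ fun s : Lam n => x s) t
      = bilinearDiff m j x t := by
    intro t
    simp only [Matrix.mulVec, dotProduct, filterMatrix, Matrix.of_apply, bilinearDiff,
      Finset.sum_mul]
    rw [Finset.sum_comm]
    refine Finset.sum_congr rfl fun a ha => ?_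
    have hmem : (t : ℕ × ℕ) + j • a ∈ Lam n := by
      have ht := hR t.2
      simp only [allRows, Lam, Finset.mem_product, Finset.mem_range] at ht ha ⊢
      have h1 : j * a.1 ≤ j * m := Nat.mul_le_mul_left _ (by omega)
      have h2 : j * a.2 ≤ j * m := Nat.mul_le_mul_left _ (by omega)
      simp only [Prod.fst_add, Prod.snd_add, Prod.smul_fst, Prod.smul_snd, smul_eq_mul]
      omega
    rw [Finset.sum_eq_single ⟨_, hmem⟩]
    · simp
    · intro s _ hs
      rw [if_neg, zero_mul]
      intro h
      exact hs (Subtype.ext h.symm)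
    · simp
  rw [quadForm, weightMatrix, Matrix.smul_mulVec, dotProduct_smul, ← Matrix.mulVec_mulVec,
    Matrix.dotProduct_mulVec, Matrix.vecMul_transpose, smul_eq_mul]
  congr 1
  rw [dotProduct, ← Finset.sum_coe_sort R]
  exact Finset.sum_congr rfl fun t _ => by rw [key t]; ring

end PowerLawGaps

end

noncomputable section

namespace PowerLawGaps

/-! ### Quadratic forms in Gaussian vectors -/

section GaussianQuadraticForms

/-! The coefficients of the order-`m` bilinear difference annihilate every monomial whose degree in
at least one coordinate is below `m`, hence all polynomials of total degree at most `k`. The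
differences of both steps are therefore jointly centered Gaussian, with covariances that depend only
on the two steps and the lag (`latCov`). The power law is self-similar up to polynomials, so after
multiplication by the square root of the gain the fixed-domain differences have exactly the
increasing-domain covariances (`sum_stencilCoeff_mul_powerLawGC_smul`, `gain_mul_spacing_rpow`);
both regimes become one problem.

The analytic input is spectral. Combinations of the generalized covariance with vanishing moments
are Mellin transforms of exponential sums, and mixing Gaussians turns these into integrals against
`contDensity`. Folding over `2πℤ²` makes `latCov` the Fourier coefficients of `crossDensity` on the
torus. This density is bounded, because the zero of the difference symbol at the origin outweighs
the singularity `‖ξ‖^(-(2+2φ₂))` (`exists_filteredDensity_le`). Boundedness has two consequences: by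
Parseval the squared covariances sum to `limitCov / 2` (`hasSum_latCov_sq`), and the covariance
matrices of the differences have uniformly bounded quadratic forms (`exists_diffCovMatrix_le`).

A centered, scaled combination of the averages is a `statistic` with weights `n τ_l / |R_l|`, whose
second moment is twice an `energy`. The energy is a bounded bilinear form in the `ℓ²` norm of the
weights (`energy_sq_le`). Each deleted site destroys at most `(m+1)²` positions, so pruned and full
weights differ by `o(1)` in `ℓ²`; this gives the convergence in probability and equal limits of the
energies.

For the central limit theorem, a quadratic form in a Gaussian vector has the law of `∑ μ_i z_i²`
with independent standard Gaussian `z_i` (`exists_law_weighted_sq`). Here `max |μ_i| = O(1/n)` by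
the uniform bound, while `∑ μ_i²` is the energy and converges, so the characteristic function tends
to that of a Gaussian (`norm_charFun_weighted_sq_sub_le`). Pruned and full averages have the same
mean whenever their position sets are nonempty, so centering at the unpruned mean costs nothing. -/

theorem integral_sq_gaussianReal : ∫ x, x ^ 2 ∂(gaussianReal 0 1) = 1 := by
  have h := variance_id_gaussianReal (μ := 0) (v := 1)
  rw [variance_eq_integral (by fun_prop)] at h
  simpa using h

theorem integral_pow_four_gaussianReal : ∫ x, x ^ 4 ∂(gaussianReal 0 1) = 3 := by
  rw [integral_gaussianReal_eq_integral_smul (by norm_num)]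
  simp only [gaussianPDFReal, NNReal.coe_one, mul_one, sub_zero, smul_eq_mul]
  have h1 : ∫ x in Set.Ioi (0 : ℝ), x ^ (4 : ℝ) * Real.exp (-(1 / 2) * x ^ (2 : ℝ)) =
      3 / 2 * √(2 * Real.pi) := by
    rw [integral_rpow_mul_exp_neg_mul_rpow (by norm_num) (by norm_num) (by norm_num)]
    have : Real.Gamma ((4 + 1) / 2) = 3 / 4 * √Real.pi := by
      rw [show ((4 : ℝ) + 1) / 2 = (1 / 2 + 1) + 1 by norm_num, Real.Gamma_add_one (by norm_num),
        Real.Gamma_add_one (by norm_num), Real.Gamma_one_half_eq]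
      ring
    rw [this, show -((4 : ℝ) + 1) / 2 = -2 - 1 / 2 by norm_num, Real.rpow_sub (by norm_num),
      ← Real.sqrt_eq_rpow, Real.sqrt_mul (by norm_num)]
    rw [show ((1 : ℝ) / 2) ^ (-2 : ℝ) = 4 by
      rw [Real.rpow_neg (by norm_num)]; norm_num]
    rw [Real.sqrt_div (by norm_num), Real.sqrt_one]
    field_simp
  have h2 : ∫ x : ℝ, (√(2 * Real.pi))⁻¹ * Real.exp (-x ^ 2 / 2) * x ^ 4 =
      (√(2 * Real.pi))⁻¹ * ∫ x : ℝ,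
        (fun y => y ^ (4 : ℝ) * Real.exp (-(1 / 2) * y ^ (2 : ℝ))) |x| := by
    rw [← integral_const_mul]
    refine integral_congr_ae (Eventually.of_forall fun x => ?_)
    simp only
    rw [show (4 : ℝ) = ((4 : ℕ) : ℝ) by norm_num, show (2 : ℝ) = ((2 : ℕ) : ℝ) by norm_num,
      Real.rpow_natCast, Real.rpow_natCast, sq_abs,
      show |x| ^ 4 = x ^ 4 from Even.pow_abs (by decide) x]
    push_cast
    rw [show -x ^ 2 / 2 = -(1 / 2) * x ^ 2 by ring]
    ring
  rw [h2, integral_comp_abs (f := fun y => y ^ (4 : ℝ) * Real.exp (-(1 / 2) * y ^ (2 : ℝ))), h1]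
  have : √(2 * Real.pi) ≠ 0 := by positivity
  field_simp

theorem memLp_pow_gaussianReal (n : ℕ) (p : ENNReal) (hp : p ≠ ⊤) :
    MemLp (fun x : ℝ => x ^ n) p (gaussianReal 0 1) := by
  induction n generalizing p with
  | zero => simpa using memLp_const (1 : ℝ)
  | succ n ih =>
    simp only [pow_succ]
    have h1 := ih (2 * p) (by finiteness)
    have h2 : MemLp (fun x : ℝ => x) (2 * p) (gaussianReal 0 1) :=
      IsGaussian.memLp_id (gaussianReal 0 1) (2 * p) (by finiteness)
    have : ENNReal.HolderTriple (2 * p) (2 * p) p := by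
      constructor
      rw [← two_mul, ENNReal.mul_inv (by simp) (by simp), ← mul_assoc,
        ENNReal.mul_inv_cancel (by simp) (by simp), one_mul]
    exact h2.mul h1

/-- A global bound is needed because `z² - 1` is unbounded. The Taylor remainder handles `|x| ≤ 1`;
beyond that the triangle inequality gives `2 + |x| + |x|²/2`, which the constant 4 absorbs. -/
theorem norm_exp_I_mul_sub_taylor_le (x : ℝ) :
    ‖Complex.exp (x * Complex.I) - (1 + x * Complex.I - x ^ 2 / 2)‖ ≤ 4 * |x| ^ 3 := by
  rcases le_or_gt |x| 1 with h | h
  · have := Complex.exp_bound (x := x * Complex.I) (by simpa using h) (n := 3) (by norm_num)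
    simp only [Finset.sum_range_succ, Finset.sum_range_zero] at this
    norm_num [Nat.factorial, mul_pow] at this
    calc _ = ‖Complex.exp (x * Complex.I) - (1 + x * Complex.I + -(x:ℂ) ^ 2 / 2)‖ := by
          congr 2; ring
      _ ≤ _ := this
      _ ≤ _ := by have := abs_nonneg x; nlinarith [pow_nonneg this 3]
  · calc _ ≤ ‖Complex.exp (x * Complex.I)‖ + (‖(1 : ℂ)‖ + ‖x * Complex.I‖ + ‖(x : ℂ) ^ 2 / 2‖) := by
          refine (norm_sub_le _ _).trans ?_
          gcongr
          refine (norm_sub_le _ _).trans ?_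
          gcongr
          exact norm_add_le _ _
      _ = 2 + |x| + |x| ^ 2 / 2 := by
          rw [Complex.norm_exp_ofReal_mul_I]; simp; ring
      _ ≤ _ := by
        have h1 : 0 < |x| - 1 := by linarith
        have h2 : 0 < |x| := by linarith
        nlinarith [mul_pos h1 h1, mul_pos h1 h2, pow_pos h2 3, mul_pos (mul_pos h1 h2) h2]

/-- The third absolute moment of `z² - 1` for a standard Gaussian `z`. -/
def chiThird : ℝ := ∫ z, |z ^ 2 - 1| ^ 3 ∂(gaussianReal 0 1)

theorem memLp_chi (p : ENNReal) (hp : p ≠ ⊤) :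
    MemLp (fun z : ℝ => z ^ 2 - 1) p (gaussianReal 0 1) :=
  (memLp_pow_gaussianReal 2 p hp).sub (memLp_const 1)

theorem integral_chi : ∫ z, (z ^ 2 - 1) ∂(gaussianReal 0 1) = 0 := by
  rw [integral_sub ((memLp_pow_gaussianReal 2 1 (by simp)).integrable le_rfl) (by fun_prop),
    integral_sq_gaussianReal]
  simp

theorem integral_chi_sq : ∫ z, (z ^ 2 - 1) ^ 2 ∂(gaussianReal 0 1) = 2 := by
  have h4 := (memLp_pow_gaussianReal 4 1 (by simp)).integrable le_rfl
  have h2 := (memLp_pow_gaussianReal 2 1 (by simp)).integrable le_rfl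
  have : ∀ z : ℝ, (z ^ 2 - 1) ^ 2 = z ^ 4 - 2 * z ^ 2 + 1 := fun z => by ring
  simp_rw [this]
  have h3 : Integrable (fun z : ℝ => z ^ 4 - 2 * z ^ 2) (gaussianReal 0 1) :=
    h4.sub (h2.const_mul 2)
  rw [integral_add h3 (by fun_prop), integral_sub h4 (h2.const_mul 2),
    integral_const_mul, integral_sq_gaussianReal, integral_pow_four_gaussianReal]
  norm_num

theorem integrable_abs_chi_pow (n : ℕ) :
    Integrable (fun z : ℝ => |z ^ 2 - 1| ^ n) (gaussianReal 0 1) := by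
  have := (memLp_chi n (by simp)).integrable_norm_pow'
  simpa [Real.norm_eq_abs] using this

/-- Second-order Taylor expansion under the integral: `z² - 1` has mean 0 and second moment 2, which
leaves `1 - μ²`, and the remainder is governed by the third absolute moment. -/
theorem norm_charFun_chi_sub_le (μ : ℝ) :
    ‖∫ z : ℝ, Complex.exp ((μ * (z ^ 2 - 1) : ℝ) * Complex.I) ∂(gaussianReal 0 1)
        - (1 - (μ : ℂ) ^ 2)‖ ≤ 4 * chiThird * |μ| ^ 3 := by
  have hint : Integrable (fun z : ℝ => Complex.exp ((μ * (z ^ 2 - 1) : ℝ) * Complex.I))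
      (gaussianReal 0 1) := by
    refine Integrable.of_bound (C := 1) (by fun_prop) (Eventually.of_forall fun z => ?_)
    rw [Complex.norm_exp_ofReal_mul_I]
  have i1 : Integrable (fun z : ℝ => ((μ * (z ^ 2 - 1) : ℝ) : ℂ) * Complex.I) (gaussianReal 0 1) :=
    ((((memLp_chi 1 (by simp)).integrable le_rfl).const_mul μ).ofReal).mul_const _
  have i2 : Integrable (fun z : ℝ => ((μ * (z ^ 2 - 1) : ℝ) : ℂ) ^ 2 / 2) (gaussianReal 0 1) := by
    have := (((memLp_chi 2 (by simp)).integrable_sq.const_mul (μ ^ 2)).ofReal (𝕜 := ℂ)).div_const 2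
    refine this.congr (Eventually.of_forall fun z => ?_)
    simp; ring
  have i3 : Integrable (fun z : ℝ => 1 + ((μ * (z ^ 2 - 1) : ℝ) : ℂ) * Complex.I)
      (gaussianReal 0 1) := (integrable_const _).add i1
  have i4 : Integrable (fun z : ℝ => 1 + ((μ * (z ^ 2 - 1) : ℝ) : ℂ) * Complex.I
      - ((μ * (z ^ 2 - 1) : ℝ) : ℂ) ^ 2 / 2) (gaussianReal 0 1) := i3.sub i2
  have hT : ∫ z : ℝ, (1 + ((μ * (z ^ 2 - 1) : ℝ) : ℂ) * Complex.I
      - ((μ * (z ^ 2 - 1) : ℝ) : ℂ) ^ 2 / 2) ∂(gaussianReal 0 1) = 1 - (μ : ℂ) ^ 2 := by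
    rw [integral_sub i3 i2, integral_add (integrable_const _) i1,
      integral_mul_const, integral_complex_ofReal, integral_const_mul, integral_chi, integral_div]
    simp_rw [← Complex.ofReal_pow, integral_complex_ofReal, mul_pow, integral_const_mul,
      integral_chi_sq]
    simp
  rw [← hT, ← integral_sub hint i4]
  calc _ ≤ ∫ z : ℝ, 4 * |μ| ^ 3 * |z ^ 2 - 1| ^ 3 ∂(gaussianReal 0 1) := by
        refine norm_integral_le_of_norm_le ((integrable_abs_chi_pow 3).const_mul _)
          (Eventually.of_forall fun z => ?_)
        refine (norm_exp_I_mul_sub_taylor_le _).trans (le_of_eq ?_)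
        rw [abs_mul, mul_pow]; ring
    _ = _ := by rw [integral_const_mul, chiThird]; ring

/-- Telescoping: the factors are exchanged one at a time, and all the others have norm at most 1. -/
theorem norm_prod_sub_prod_le_sum {ι : Type*} (s : Finset ι) (a b : ι → ℂ)
    (ha : ∀ i, ‖a i‖ ≤ 1) (hb : ∀ i, ‖b i‖ ≤ 1) :
    ‖∏ i ∈ s, a i - ∏ i ∈ s, b i‖ ≤ ∑ i ∈ s, ‖a i - b i‖ := by
  classical
  induction s using Finset.induction_on with
  | empty => simp
  | insert i s hi ih =>
    rw [Finset.prod_insert hi, Finset.prod_insert hi, Finset.sum_insert hi]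
    have hP : ‖∏ i ∈ s, a i‖ ≤ 1 := by
      rw [norm_prod]; exact Finset.prod_le_one (fun _ _ => norm_nonneg _) fun i _ => ha i
    calc _ = ‖(a i - b i) * ∏ i ∈ s, a i + b i * (∏ i ∈ s, a i - ∏ i ∈ s, b i)‖ := by
          congr 1; ring
      _ ≤ ‖a i - b i‖ * 1 + 1 * ∑ i ∈ s, ‖a i - b i‖ := by
          refine (norm_add_le _ _).trans ?_
          rw [norm_mul, norm_mul]
          gcongr
          exact hb i
      _ = _ := by ring

theorem abs_exp_neg_sq_sub_le (μ : ℝ) : |Real.exp (-μ ^ 2) - (1 - μ ^ 2)| ≤ |μ| ^ 3 := by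
  have h0 : 0 ≤ Real.exp (-μ ^ 2) - (1 - μ ^ 2) := by
    have := Real.add_one_le_exp (-μ ^ 2); linarith
  rw [abs_of_nonneg h0]
  rcases le_or_gt |μ| 1 with h | h
  · have h1 : |-μ ^ 2| ≤ 1 := by
      rw [abs_neg, abs_pow]; exact pow_le_one₀ (abs_nonneg _) h
    have := (abs_le.1 (Real.abs_exp_sub_one_sub_id_le h1)).2
    have h2 : (-μ ^ 2) ^ 2 = |μ| ^ 3 * |μ| := by rw [← sq_abs μ]; ring
    have h3 : |μ| ^ 3 * |μ| ≤ |μ| ^ 3 := mul_le_of_le_one_right (by positivity) h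
    linarith
  · have h1 : Real.exp (-μ ^ 2) ≤ 1 := Real.exp_le_one_iff.2 (by nlinarith)
    have h2 : μ ^ 2 ≤ |μ| ^ 3 := by
      rw [← sq_abs μ]; exact pow_le_pow_right₀ h.le (by norm_num)
    linarith

open scoped MatrixOrder in
/-- A quadratic form `∑ w_i y_i²` in a centered Gaussian vector with covariance `C` has the law of
a weighted sum of squares of independent standard Gaussians. -/
theorem exists_law_weighted_sq {ι : Type*} [Fintype ι] [DecidableEq ι] {C : Matrix ι ι ℝ}
    (hC : C.PosSemidef) (w : ι → ℝ) :
    ∃ μ : ι → ℝ, ∑ i, μ i = ∑ i, w i * C i i ∧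
      ∑ i, μ i ^ 2 = ∑ i, ∑ j, w i * w j * C i j ^ 2 ∧
      (∀ L M : ℝ, (∀ v : ι → ℝ, v ⬝ᵥ C *ᵥ v ≤ L * (v ⬝ᵥ v)) → (∀ i, |w i| ≤ M) →
        ∀ i, |μ i| ≤ M * L) ∧
      (multivariateGaussian 0 C).map (fun y => ∑ i, w i * y i ^ 2) =
        (Measure.pi fun _ : ι => gaussianReal 0 1).map fun z => ∑ i, μ i * z i ^ 2 := by
  set R : Matrix ι ι ℝ := CFC.sqrt C with hR
  have hRR : R * R = C := CFC.sqrt_mul_sqrt_self _ hC.nonneg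
  have hRT : Rᵀ = R := by
    have : IsSelfAdjoint R := (CFC.sqrt_nonneg C).isSelfAdjoint
    simpa [IsSelfAdjoint, star_eq_conjTranspose] using this
  -- With `y = R z` and `z` standard Gaussian, `∑ w_i y_i² = zᵀ M z`. The eigenvalues of `M` are the
  -- required `μ`, and cyclicity of the trace turns `tr M` and `tr M²` into expressions in `w` and
  -- `C`.
  set M := R * diagonal w * R with hMdef
  have hM : M.IsHermitian := by
    rw [Matrix.IsHermitian, conjTranspose_eq_transpose_of_trivial, hMdef, transpose_mul,
      transpose_mul, hRT, diagonal_transpose, Matrix.mul_assoc]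
  have hquad : ∀ v : ι → ℝ, v ⬝ᵥ M *ᵥ v = ∑ i, w i * (R *ᵥ v) i ^ 2 := by
    intro v
    rw [hMdef, Matrix.mul_assoc, ← Matrix.mulVec_mulVec, Matrix.dotProduct_mulVec,
      ← Matrix.mulVec_transpose, hRT, ← Matrix.mulVec_mulVec, dotProduct]
    refine Finset.sum_congr rfl fun i _ => ?_
    rw [mulVec_diagonal]; ring
  have hRq : ∀ v : ι → ℝ, (R *ᵥ v) ⬝ᵥ (R *ᵥ v) = v ⬝ᵥ C *ᵥ v := by
    intro v
    rw [← hRR, ← Matrix.mulVec_mulVec, Matrix.dotProduct_mulVec v, ← Matrix.mulVec_transpose, hRT]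
  have hb : ∀ k l, (hM.eigenvectorBasis k).ofLp ⬝ᵥ (hM.eigenvectorBasis l).ofLp =
      if k = l then 1 else 0 := by
    intro k l
    have := (orthonormal_iff_ite.1 hM.eigenvectorBasis.orthonormal) k l
    rw [EuclideanSpace.inner_eq_star_dotProduct] at this
    rw [dotProduct_comm]
    simpa using this
  refine ⟨hM.eigenvalues, ?_, ?_, ?_, ?_⟩
  · have := hM.trace_eq_sum_eigenvalues
    simp only [RCLike.ofReal_real_eq_id, id] at this
    rw [← this, hMdef, Matrix.trace_mul_comm, ← Matrix.mul_assoc, hRR, Matrix.trace]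
    simp [mul_comm]
  · have h1 : trace (M * M) = ∑ i, hM.eigenvalues i ^ 2 := by
      conv_lhs => rw [hM.spectral_theorem, ← map_mul]
      rw [Unitary.conjStarAlgAut_apply, Matrix.trace_mul_comm, ← Matrix.mul_assoc]
      simp [diagonal_mul_diagonal, Matrix.trace, sq]
    have h2 : trace (M * M) = trace ((diagonal w * C) * (diagonal w * C)) := by
      rw [hMdef, ← hRR, Matrix.trace_mul_comm]
      simp only [Matrix.mul_assoc]
      rw [Matrix.trace_mul_comm]
      simp only [Matrix.mul_assoc]
    rw [← h1, h2, Matrix.trace]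
    refine Finset.sum_congr rfl fun i _ => ?_
    rw [Matrix.diag_apply, Matrix.mul_apply]
    refine Finset.sum_congr rfl fun j _ => ?_
    have : C j i = C i j := by simpa using hC.1.apply i j
    rw [diagonal_mul, diagonal_mul, this]
    ring
  -- Rayleigh quotient at a unit eigenvector `v`: `|μ| ≤ K ‖R v‖² = K (v ⬝ᵥ C *ᵥ v) ≤ K L`.
  · intro L K hL hw k
    set v := (hM.eigenvectorBasis k).ofLp with hv
    have hvv : v ⬝ᵥ v = 1 := by simpa using hb k k
    have h1 : hM.eigenvalues k = ∑ i, w i * (R *ᵥ v) i ^ 2 := by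
      rw [← hquad, hv, hM.mulVec_eigenvectorBasis, dotProduct_smul, ← hv, hvv]; simp
    have hK : 0 ≤ K := (abs_nonneg _).trans (hw k)
    calc |hM.eigenvalues k| ≤ ∑ i, |w i * (R *ᵥ v) i ^ 2| := by
          rw [h1]; exact Finset.abs_sum_le_sum_abs _ _
      _ ≤ ∑ i, K * ((R *ᵥ v) i * (R *ᵥ v) i) := by
          refine Finset.sum_le_sum fun i _ => ?_
          rw [abs_mul, abs_of_nonneg (sq_nonneg ((R *ᵥ v) i)), sq]
          exact mul_le_mul_of_nonneg_right (hw i) (mul_self_nonneg _)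
      _ = K * (v ⬝ᵥ C *ᵥ v) := by rw [← Finset.mul_sum, ← hRq]; rfl
      _ ≤ K * L := by
          have := hL v
          rw [hvv, mul_one] at this
          gcongr
  -- Rotation invariance: the standard Gaussian is built with independent coordinates in the
  -- eigenbasis of `M`, where the quadratic form is diagonal.
  · rw [multivariateGaussian, stdGaussian_eq_map_pi_orthonormalBasis hM.eigenvectorBasis,
      Measure.map_map (by fun_prop) (by fun_prop), Measure.map_map (by fun_prop) (by fun_prop)]
    congr 1
    ext z
    simp only [Function.comp_apply, zero_add]
    have h1 : ∀ x : EuclideanSpace ℝ ι, ∑ i, w i * (toEuclideanCLM (𝕜 := ℝ) R x) i ^ 2 =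
        x.ofLp ⬝ᵥ M *ᵥ x.ofLp := fun x => by
      rw [hquad, ofLp_toEuclideanCLM]
    rw [← hR, h1]
    simp only [WithLp.ofLp_sum, WithLp.ofLp_smul, Matrix.mulVec_sum, Matrix.mulVec_smul,
      hM.mulVec_eigenvectorBasis, sum_dotProduct, dotProduct_sum, smul_dotProduct, dotProduct_smul,
      hb]
    simp only [smul_eq_mul, mul_ite, mul_one, mul_zero]
    refine Finset.sum_congr rfl fun i _ => ?_
    rw [Finset.sum_ite_eq' Finset.univ i, if_pos (Finset.mem_univ i)]
    ring

theorem measurable_weighted_chi {ι : Type*} [Fintype ι] (μ : ι → ℝ) :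
    Measurable fun z : ι → ℝ => ∑ i, μ i * (z i ^ 2 - 1) :=
  Finset.measurable_sum _ fun i _ => by fun_prop

/-- The trace identity `∑ μ_i = ∑ w_i C_ii` makes the centering of the form agree with the centering
of each `z_i²`. -/
theorem exists_law_centered_weighted_sq {Ω ι : Type*} [MeasurableSpace Ω] {P : Measure Ω}
    [Fintype ι] [DecidableEq ι] {C : Matrix ι ι ℝ} (hC : C.PosSemidef) {Z : ι → Ω → ℝ}
    (hZ : HasLaw (fun ω => WithLp.toLp 2 fun i => Z i ω) (multivariateGaussian 0 C) P)
    (w : ι → ℝ) :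
    ∃ μ : ι → ℝ, ∑ i, μ i ^ 2 = ∑ i, ∑ j, w i * w j * C i j ^ 2 ∧
      (∀ L M : ℝ, (∀ v : ι → ℝ, v ⬝ᵥ C *ᵥ v ≤ L * (v ⬝ᵥ v)) → (∀ i, |w i| ≤ M) →
        ∀ i, |μ i| ≤ M * L) ∧
      HasLaw (fun ω => ∑ i, w i * (Z i ω ^ 2 - C i i))
        ((Measure.pi fun _ : ι => gaussianReal 0 1).map fun z => ∑ i, μ i * (z i ^ 2 - 1)) P := by
  obtain ⟨μ, h1, h2, h3, h4⟩ := exists_law_weighted_sq hC w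
  refine ⟨μ, h2, h3, ?_⟩
  have h5 : HasLaw (fun y : EuclideanSpace ℝ ι => ∑ i, w i * y i ^ 2)
      ((multivariateGaussian 0 C).map fun y => ∑ i, w i * y i ^ 2) (multivariateGaussian 0 C) :=
    ⟨by fun_prop, rfl⟩
  have h6 := h5.comp hZ
  rw [h4] at h6
  have h7 : HasLaw (fun x : ℝ => x - ∑ i, μ i)
      ((Measure.pi fun _ : ι => gaussianReal 0 1).map fun z => ∑ i, μ i * (z i ^ 2 - 1))
      ((Measure.pi fun _ : ι => gaussianReal 0 1).map fun z => ∑ i, μ i * z i ^ 2) := by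
    refine ⟨by fun_prop, ?_⟩
    rw [Measure.map_map (by fun_prop) (by fun_prop)]
    congr 1
    ext z
    simp [mul_sub]
  have h8 := h7.comp h6
  convert h8 using 1
  ext ω
  simp [mul_sub, h1]

theorem memLp_weighted_chi {ι : Type*} [Fintype ι] (μ : ι → ℝ) :
    MemLp (fun z : ι → ℝ => ∑ i, μ i * (z i ^ 2 - 1)) 2
      (Measure.pi fun _ : ι => gaussianReal 0 1) := by
  refine memLp_finsetSum _ fun i _ => ?_
  exact ((memLp_chi 2 (by simp)).comp_measurePreserving
    (measurePreserving_eval (fun _ : ι => gaussianReal 0 1) i)).const_mul (μ i)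

theorem integral_weighted_chi_sq {ι : Type*} [Fintype ι] (μ : ι → ℝ) :
    ∫ z : ι → ℝ, (∑ i, μ i * (z i ^ 2 - 1)) ^ 2 ∂(Measure.pi fun _ : ι => gaussianReal 0 1) =
      2 * ∑ i, μ i ^ 2 := by
  have hm : ∫ z : ι → ℝ, (∑ i, μ i * (z i ^ 2 - 1))
      ∂(Measure.pi fun _ : ι => gaussianReal 0 1) = 0 := by
    rw [integral_finsetSum]
    · refine Finset.sum_eq_zero fun i _ => ?_
      rw [integral_const_mul, integral_comp_eval (μ := fun _ : ι => gaussianReal 0 1)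
        (f := fun x : ℝ => x ^ 2 - 1) (by fun_prop), integral_chi, mul_zero]
    · intro i _
      exact (((memLp_chi 1 (by simp)).comp_measurePreserving
        (measurePreserving_eval (fun _ : ι => gaussianReal 0 1) i)).integrable le_rfl).const_mul _
  have hv := variance_sum_pi (μ := fun _ : ι => gaussianReal 0 1)
    (X := fun i (x : ℝ) => μ i * (x ^ 2 - 1))
    fun i => (memLp_chi 2 (by simp)).const_mul (μ i)
  have h1 : ∀ i, Var[fun x : ℝ => μ i * (x ^ 2 - 1); gaussianReal 0 1] = 2 * μ i ^ 2 := by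
    intro i
    rw [variance_const_mul, variance_of_integral_eq_zero (by fun_prop) integral_chi,
      integral_chi_sq, mul_comm]
  simp_rw [h1, ← Finset.mul_sum] at hv
  rw [← hv]
  have h2 : (∑ i, fun ω : ι → ℝ => μ i * (ω i ^ 2 - 1)) =
      fun ω => ∑ i, μ i * (ω i ^ 2 - 1) := by
    ext; simp
  rw [h2, variance_of_integral_eq_zero (measurable_weighted_chi μ).aemeasurable hm]

section

variable {Ω ι : Type*} [MeasurableSpace Ω] {P : Measure Ω} [Fintype ι] [DecidableEq ι]
  {C : Matrix ι ι ℝ} {Z : ι → Ω → ℝ}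

theorem memLp_centered_weighted_sq (hC : C.PosSemidef)
    (hZ : HasLaw (fun ω => WithLp.toLp 2 fun i => Z i ω) (multivariateGaussian 0 C) P)
    (w : ι → ℝ) : MemLp (fun ω => ∑ i, w i * (Z i ω ^ 2 - C i i)) 2 P := by
  obtain ⟨μ, -, -, h⟩ := exists_law_centered_weighted_sq hC hZ w
  have h1 : MemLp id 2 ((Measure.pi fun _ : ι => gaussianReal 0 1).map
      fun z => ∑ i, μ i * (z i ^ 2 - 1)) :=
    (memLp_map_measure_iff (by fun_prop) (measurable_weighted_chi μ).aemeasurable).2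
      (memLp_weighted_chi μ)
  rw [← h.map_eq, memLp_map_measure_iff (by fun_prop) h.aemeasurable] at h1
  exact h1

theorem integral_centered_weighted_sq_sq (hC : C.PosSemidef)
    (hZ : HasLaw (fun ω => WithLp.toLp 2 fun i => Z i ω) (multivariateGaussian 0 C) P)
    (w : ι → ℝ) :
    ∫ ω, (∑ i, w i * (Z i ω ^ 2 - C i i)) ^ 2 ∂P = 2 * ∑ i, ∑ j, w i * w j * C i j ^ 2 := by
  obtain ⟨μ, h2, -, h⟩ := exists_law_centered_weighted_sq hC hZ w
  rw [← h2, ← integral_weighted_chi_sq,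
    ← integral_map (φ := fun z : ι → ℝ => ∑ i, μ i * (z i ^ 2 - 1)) (f := fun x => x ^ 2)
      (measurable_weighted_chi μ).aemeasurable (by fun_prop), ← h.map_eq,
    integral_map h.aemeasurable (by fun_prop)]

/-- A quantitative central limit theorem. By independence the characteristic function is a product
whose factors lie within `O(|μ_i|³)` of `exp (-μ_i²)`, and `|μ_i|³ ≤ M L μ_i²`. The error is thus
negligible once the largest coefficient tends to 0 with `∑ μ_i²` bounded. -/
theorem norm_charFun_weighted_sq_sub_le (hC : C.PosSemidef)
    (hZ : HasLaw (fun ω => WithLp.toLp 2 fun i => Z i ω) (multivariateGaussian 0 C) P)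
    (w : ι → ℝ) {L M : ℝ} (hL : ∀ v : ι → ℝ, v ⬝ᵥ C *ᵥ v ≤ L * (v ⬝ᵥ v)) (hM : ∀ i, |w i| ≤ M) :
    ‖∫ ω, Complex.exp ((∑ i, w i * (Z i ω ^ 2 - C i i) : ℝ) * Complex.I) ∂P
        - Real.exp (-∑ i, ∑ j, w i * w j * C i j ^ 2)‖ ≤
      (4 * chiThird + 1) * (M * L) * ∑ i, ∑ j, w i * w j * C i j ^ 2 := by
  obtain ⟨μ, h2, h3, h⟩ := exists_law_centered_weighted_sq hC hZ w
  have hχ : 0 ≤ chiThird := integral_nonneg fun z => by positivity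
  rw [← h2, ← integral_map (φ := fun ω => ∑ i, w i * (Z i ω ^ 2 - C i i))
    (f := fun x : ℝ => Complex.exp (x * Complex.I)) h.aemeasurable (by fun_prop), h.map_eq,
    integral_map (measurable_weighted_chi μ).aemeasurable (by fun_prop)]
  have h4 : ∀ z : ι → ℝ, Complex.exp ((∑ i, μ i * (z i ^ 2 - 1) : ℝ) * Complex.I) =
      ∏ i, Complex.exp ((μ i * (z i ^ 2 - 1) : ℝ) * Complex.I) := by
    intro z
    rw [Complex.ofReal_sum, Finset.sum_mul, Complex.exp_sum]
  have h5 : ((Real.exp (-∑ i, μ i ^ 2) : ℝ) : ℂ) = ∏ i, ((Real.exp (-μ i ^ 2) : ℝ) : ℂ) := by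
    rw [← Finset.sum_neg_distrib, Real.exp_sum, Complex.ofReal_prod]
  simp_rw [h4]
  rw [h5, integral_fintype_prod_eq_prod (μ := fun _ : ι => gaussianReal 0 1)
    (fun i (x : ℝ) => Complex.exp ((μ i * (x ^ 2 - 1) : ℝ) * Complex.I))]
  refine (norm_prod_sub_prod_le_sum _ _ _ (fun i => ?_) fun i => ?_).trans ?_
  · refine (norm_integral_le_of_norm_le_const (C := 1) (Eventually.of_forall fun z => ?_)).trans
      (by simp)
    rw [Complex.norm_exp_ofReal_mul_I]
  · rw [Complex.norm_real, Real.norm_eq_abs, Real.abs_exp]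
    exact Real.exp_le_one_iff.2 (by nlinarith [sq_nonneg (μ i)])
  · rw [Finset.mul_sum]
    refine Finset.sum_le_sum fun i _ => ?_
    calc _ ≤ ‖∫ z : ℝ, Complex.exp ((μ i * (z ^ 2 - 1) : ℝ) * Complex.I) ∂(gaussianReal 0 1)
          - (1 - (μ i : ℂ) ^ 2)‖ + ‖((Real.exp (-μ i ^ 2) - (1 - μ i ^ 2) : ℝ) : ℂ)‖ := by
          refine le_trans (le_of_eq ?_) (norm_sub_le _ _)
          congr 1; push_cast; ring
      _ ≤ 4 * chiThird * |μ i| ^ 3 + |μ i| ^ 3 := by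
          gcongr
          · exact norm_charFun_chi_sub_le _
          · rw [Complex.norm_real]; exact abs_exp_neg_sq_sub_le _
      _ = (4 * chiThird + 1) * |μ i| * μ i ^ 2 := by rw [← sq_abs (μ i)]; ring
      _ ≤ _ := by
          gcongr
          exact h3 L M hL hM i

end

end GaussianQuadraticForms

/-! ### Mellin transforms of exponential sums with vanishing moments -/

section ExpSum

variable {ι : Type*} (J : Finset ι)

/-- The exponential sum `∑ c_i e^{-a_i u}`. -/
def expSum (c a : ι → ℝ) (u : ℝ) : ℝ := ∑ i ∈ J, c i * Real.exp (-(a i * u))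

theorem continuous_expSum (c a : ι → ℝ) : Continuous (expSum J c a) := by
  unfold expSum; fun_prop

theorem hasDerivAt_expSum (c a : ι → ℝ) (u : ℝ) :
    HasDerivAt (expSum J c a) (expSum J (fun i => -(a i * c i)) a u) u := by
  unfold expSum
  refine HasDerivAt.fun_sum fun i _ => ?_
  have := (((hasDerivAt_id u).const_mul (a i)).neg.exp).const_mul (c i)
  simp only [id, mul_one] at this
  have e : -(a i * c i) * Real.exp (-(a i * u)) = c i * (Real.exp (-(a i * u)) * -a i) := by ring
  change HasDerivAt (fun u => c i * Real.exp (-(a i * u))) (-(a i * c i) * Real.exp (-(a i * u))) u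
  rw [e]
  exact this

theorem expSum_zero (c a : ι → ℝ) : expSum J c a 0 = ∑ i ∈ J, c i := by simp [expSum]

theorem abs_expSum_le {c a : ι → ℝ} (ha : ∀ i ∈ J, 0 ≤ a i) {u : ℝ} (hu : 0 ≤ u) :
    |expSum J c a u| ≤ ∑ i ∈ J, |c i| := by
  refine (Finset.abs_sum_le_sum_abs _ _).trans (Finset.sum_le_sum fun i hi => ?_)
  rw [abs_mul, Real.abs_exp]
  exact mul_le_of_le_one_right (abs_nonneg _)
    (Real.exp_le_one_iff.2 (neg_nonpos.2 (mul_nonneg (ha i hi) hu)))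

/-- Vanishing of the moments `∑ c_i a_i^p` for `p < K` means vanishing of the first `K` Taylor
coefficients at 0. In the induction the derivative is again an exponential sum, with coefficients
`-(a_i c_i)` and one vanishing moment fewer, and the mean value inequality integrates the bound. -/
theorem exists_abs_expSum_le_pow (K : ℕ) {c a : ι → ℝ} (ha : ∀ i ∈ J, 0 ≤ a i)
    (hK : ∀ p < K, ∑ i ∈ J, c i * a i ^ p = 0) :
    ∃ B, 0 ≤ B ∧ ∀ u, 0 ≤ u → |expSum J c a u| ≤ B * u ^ K := by
  induction K generalizing c with
  | zero =>
    exact ⟨∑ i ∈ J, |c i|, Finset.sum_nonneg fun _ _ => abs_nonneg _,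
      fun u hu => by simpa using abs_expSum_le J ha hu⟩
  | succ K ih =>
    obtain ⟨B, hB, h⟩ := ih (c := fun i => -(a i * c i)) fun p hp => by
      have := hK (p + 1) (by omega)
      rw [← neg_eq_zero, ← Finset.sum_neg_distrib] at this
      rw [← this]
      exact Finset.sum_congr rfl fun i _ => by ring
    refine ⟨B, hB, fun u hu => ?_⟩
    have h0 : expSum J c a 0 = 0 := by
      rw [expSum_zero]; simpa using hK 0 (by omega)
    have := Convex.norm_image_sub_le_of_norm_hasDerivWithin_le (𝕜 := ℝ) (f := expSum J c a)
      (s := Set.Icc 0 u) (C := B * u ^ K)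
      (fun x _ => (hasDerivAt_expSum J c a x).hasDerivWithinAt)
      (fun x hx => (h x hx.1).trans (by gcongr; exacts [hx.1, hx.2]))
      (convex_Icc 0 u) (Set.left_mem_Icc.2 hu) (Set.right_mem_Icc.2 hu)
    rw [h0, sub_zero, sub_zero, Real.norm_eq_abs, Real.norm_eq_abs, abs_of_nonneg hu] at this
    rw [pow_succ, ← mul_assoc]
    exact this

theorem integrableOn_Ioc_expSum (K : ℕ) {c a : ι → ℝ} (ha : ∀ i ∈ J, 0 ≤ a i)
    (hK : ∀ p < K, ∑ i ∈ J, c i * a i ^ p = 0) {s : ℝ} (hs : 0 < s + K) :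
    IntegrableOn (fun u => u ^ (s - 1) * expSum J c a u) (Set.Ioc 0 1) := by
  obtain ⟨B, hB, h⟩ := exists_abs_expSum_le_pow J K ha hK
  have h1 : IntegrableOn (fun u : ℝ => B * u ^ (s + K - 1)) (Set.Ioc 0 1) := by
    rw [integrableOn_Ioc_iff_integrableOn_Ioo]
    exact ((intervalIntegral.integrableOn_Ioo_rpow_iff one_pos).2 (by linarith)).const_mul B
  refine h1.mono' ?_ ?_
  · exact (Measurable.mul (by fun_prop) (continuous_expSum J c a).measurable).aestronglyMeasurable
  · refine (ae_restrict_iff' measurableSet_Ioc).2 (Eventually.of_forall fun u hu => ?_)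
    rw [norm_mul, Real.norm_eq_abs, Real.norm_eq_abs, abs_of_nonneg (Real.rpow_nonneg hu.1.le _)]
    calc _ ≤ u ^ (s - 1) * (B * u ^ K) := by
          gcongr
          · exact Real.rpow_nonneg hu.1.le _
          · exact h u hu.1.le
      _ = B * u ^ (s + K - 1) := by
          rw [← Real.rpow_natCast u K, mul_left_comm, ← Real.rpow_add hu.1]
          congr 2; ring

/-- The vanishing moments give convergence at 0. At infinity boundedness of the sum suffices because
`s < 0`, so a term with `a_i = 0` does no harm. -/
theorem integrableOn_expSum_of_neg (K : ℕ) {c a : ι → ℝ} (ha : ∀ i ∈ J, 0 ≤ a i)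
    (hK : ∀ p < K, ∑ i ∈ J, c i * a i ^ p = 0) {s : ℝ} (hs : 0 < s + K) (hs0 : s < 0) :
    IntegrableOn (fun u => u ^ (s - 1) * expSum J c a u) (Set.Ioi 0) := by
  rw [← Set.Ioc_union_Ioi_eq_Ioi (zero_le_one' ℝ)]
  refine (integrableOn_Ioc_expSum J K ha hK hs).union ?_
  have h1 : IntegrableOn (fun u : ℝ => u ^ (s - 1) * ∑ i ∈ J, |c i|) (Set.Ioi 1) :=
    (integrableOn_Ioi_rpow_of_lt (by linarith) one_pos).mul_const _
  refine h1.mono' ?_ ?_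
  · exact (Measurable.mul (by fun_prop) (continuous_expSum J c a).measurable).aestronglyMeasurable
  · refine (ae_restrict_iff' measurableSet_Ioi).2 (Eventually.of_forall fun u hu => ?_)
    have hu0 : (0 : ℝ) ≤ u := zero_le_one.trans (le_of_lt hu)
    rw [norm_mul, Real.norm_eq_abs, Real.norm_eq_abs, abs_of_nonneg (Real.rpow_nonneg hu0 _)]
    gcongr
    exact abs_expSum_le J ha hu0

theorem integrableOn_expSum_of_pos {c a : ι → ℝ} (ha : ∀ i ∈ J, 0 ≤ a i)
    (hc : ∀ i ∈ J, a i = 0 → c i = 0) {s : ℝ} (hs : 0 < s) :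
    IntegrableOn (fun u => u ^ (s - 1) * expSum J c a u) (Set.Ioi 0) ∧
    ∫ u in Set.Ioi 0, u ^ (s - 1) * expSum J c a u =
      ∑ i ∈ J, c i * (Real.Gamma s * a i ^ (-s)) := by
  have hi : ∀ i ∈ J, IntegrableOn (fun u : ℝ => c i * (u ^ (s - 1) * Real.exp (-(a i * u))))
      (Set.Ioi 0) := fun i hi => by
    rcases (ha i hi).eq_or_lt with h | h
    · simp [hc i hi h.symm]
    · have := integrableOn_rpow_mul_exp_neg_mul_rpow (p := 1) (s := s - 1) (b := a i)
        (by linarith) one_pos h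
      simp only [Real.rpow_one, neg_mul] at this
      exact this.const_mul _
  have he : (fun u : ℝ => u ^ (s - 1) * expSum J c a u) =
      fun u => ∑ i ∈ J, c i * (u ^ (s - 1) * Real.exp (-(a i * u))) := by
    ext u
    rw [expSum, Finset.mul_sum]
    exact Finset.sum_congr rfl fun i _ => by ring
  rw [he]
  refine ⟨integrable_finsetSum _ hi, ?_⟩
  rw [integral_finsetSum _ hi]
  refine Finset.sum_congr rfl fun i hi => ?_
  rw [integral_const_mul]
  rcases (ha i hi).eq_or_lt with h | h
  · simp [hc i hi h.symm]
  · rw [Real.integral_rpow_mul_exp_neg_mul_Ioi hs h, one_div, Real.inv_rpow h.le,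
      ← Real.rpow_neg h.le]
    ring

/-- The borderline exponent. Since the coefficients sum to 0, `exp (-u)` may be subtracted from
every exponential, and each difference is a Frullani integral with value `-log (a_i)`. -/
theorem integral_expSum_of_zero {c a : ι → ℝ} (ha : ∀ i ∈ J, 0 ≤ a i)
    (hc : ∀ i ∈ J, a i = 0 → c i = 0) (hsum : ∑ i ∈ J, c i = 0) :
    IntegrableOn (fun u => u ^ (-1 : ℝ) * expSum J c a u) (Set.Ioi 0) ∧
    ∫ u in Set.Ioi 0, u ^ (-1 : ℝ) * expSum J c a u = ∑ i ∈ J, -(c i * Real.log (a i)) := by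
  have hint : ∀ x : ℝ, 0 < x → IntegrableOn
      (fun u : ℝ => u⁻¹ • (Real.exp (-(x * u)) - Real.exp (-(1 * u)))) (Set.Ioi 0) := by
    intro x hx
    have h01 := integrableOn_Ioc_expSum (Finset.univ : Finset (Fin 2)) 1 (c := ![1, -1])
      (a := ![x, 1]) (by simp [Fin.forall_fin_two, hx.le]) (by simp [Fin.sum_univ_two])
      (s := 0) (by simp)
    simp only [expSum, Fin.sum_univ_two, zero_sub, Real.rpow_neg_one] at h01
    rw [← Set.Ioc_union_Ioi_eq_Ioi (zero_le_one' ℝ)]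
    refine IntegrableOn.union (h01.congr_fun (fun u _ => by simp [sub_eq_add_neg])
      measurableSet_Ioc) ?_
    have h1 := (exp_neg_integrableOn_Ioi 1 hx).add (exp_neg_integrableOn_Ioi 1 one_pos)
    refine Integrable.mono' h1 (by fun_prop) ?_
    refine (ae_restrict_iff' measurableSet_Ioi).2 (Eventually.of_forall fun u hu => ?_)
    have hu' : (1 : ℝ) ≤ u := le_of_lt hu
    rw [norm_smul, Real.norm_eq_abs, Real.norm_eq_abs, abs_of_nonneg (by positivity)]
    calc _ ≤ 1 * |Real.exp (-(x * u)) - Real.exp (-(1 * u))| := by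
          gcongr; exact inv_le_one_of_one_le₀ hu'
      _ ≤ |Real.exp (-(x * u))| + |Real.exp (-(1 * u))| := by rw [one_mul]; exact abs_sub _ _
      _ = _ := by simp
  have hval : ∀ x : ℝ, 0 < x →
      ∫ u in Set.Ioi (0 : ℝ), u⁻¹ • (Real.exp (-(x * u)) - Real.exp (-(1 * u))) = -Real.log x := by
    intro x hx
    have hcont : Continuous fun u : ℝ => Real.exp (-u) := by fun_prop
    have := Frullani.integral_Ioi_eq (f := fun u : ℝ => Real.exp (-u)) (L := 1) (R := 0)
      (hcont.locallyIntegrable.locallyIntegrableOn _) hx one_pos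
      (by simpa using (hcont.tendsto 0).mono_left nhdsWithin_le_nhds)
      Real.tendsto_exp_neg_atTop_nhds_zero (hint x hx)
    rw [this]; simp
  have he : (fun u : ℝ => u ^ (-1 : ℝ) * expSum J c a u) =
      fun u => ∑ i ∈ J, c i * (u⁻¹ • (Real.exp (-(a i * u)) - Real.exp (-(1 * u)))) := by
    ext u
    simp only [smul_eq_mul, mul_sub, Finset.sum_sub_distrib]
    rw [← Finset.sum_mul, hsum, zero_mul, sub_zero, expSum, Finset.mul_sum, Real.rpow_neg_one]
    exact Finset.sum_congr rfl fun i _ => by ring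
  have hi : ∀ i ∈ J, IntegrableOn
      (fun u : ℝ => c i * (u⁻¹ • (Real.exp (-(a i * u)) - Real.exp (-(1 * u))))) (Set.Ioi 0) := by
    intro i hi
    rcases (ha i hi).eq_or_lt with h | h
    · simp [hc i hi h.symm]
    · exact (hint _ h).const_mul _
  rw [he]
  refine ⟨integrable_finsetSum _ hi, ?_⟩
  rw [integral_finsetSum _ hi]
  refine Finset.sum_congr rfl fun i hi => ?_
  rw [integral_const_mul]
  rcases (ha i hi).eq_or_lt with h | h
  · simp [hc i hi h.symm]
  · rw [hval _ h]; ring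

/-- Integration by parts against `u^s / s`. The boundary term vanishes at 0 by the order of the
zero, `s + K + 1 > 0`, and at infinity because `s < 0` and the sum is bounded. -/
theorem integral_expSum_step (K : ℕ) {c a : ι → ℝ} (ha : ∀ i ∈ J, 0 ≤ a i)
    (hK : ∀ p < K + 1, ∑ i ∈ J, c i * a i ^ p = 0) {s : ℝ} (hs : 0 < s + (K + 1)) (hs0 : s < 0)
    (hint : IntegrableOn (fun u => u ^ (s + 1 - 1) * expSum J (fun i => -(a i * c i)) a u)
      (Set.Ioi 0)) :
    ∫ u in Set.Ioi 0, u ^ (s - 1) * expSum J c a u =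
      -(1 / s) * ∫ u in Set.Ioi 0, u ^ (s + 1 - 1) * expSum J (fun i => -(a i * c i)) a u := by
  have h0 := integrableOn_expSum_of_neg J (K + 1) ha hK (by push_cast; exact hs) hs0
  obtain ⟨B, hB, hbd⟩ := exists_abs_expSum_le_pow J (K + 1) ha hK
  rw [show s + 1 - 1 = s by ring] at hint ⊢
  have hlim0 : Tendsto ((fun u : ℝ => u ^ s / s) * expSum J c a) (𝓝[>] 0) (𝓝 0) := by
    have h1 : Tendsto (fun u : ℝ => B / |s| * u ^ (s + (K + 1))) (𝓝[>] 0) (𝓝 0) := by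
      have := ((Real.continuousAt_rpow_const 0 (s + (K + 1)) (Or.inr hs.le)).tendsto.mono_left
        (nhdsWithin_le_nhds (s := Set.Ioi 0))).const_mul (B / |s|)
      simpa [Real.zero_rpow hs.ne'] using this
    refine squeeze_zero_norm' ?_ h1
    filter_upwards [self_mem_nhdsWithin] with u hu
    have hu : (0 : ℝ) < u := hu
    rw [Pi.mul_apply, norm_mul, norm_div, Real.norm_eq_abs, Real.norm_eq_abs, Real.norm_eq_abs,
      abs_of_nonneg (Real.rpow_nonneg hu.le _)]
    calc _ ≤ u ^ s / |s| * (B * u ^ (K + 1)) := by gcongr; exact hbd u hu.le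
      _ = B / |s| * (u ^ s * u ^ ((K + 1 : ℕ) : ℝ)) := by rw [Real.rpow_natCast]; ring
      _ = _ := by rw [← Real.rpow_add hu]; push_cast; rfl
  have hlim1 : Tendsto ((fun u : ℝ => u ^ s / s) * expSum J c a) atTop (𝓝 0) := by
    have h1 : Tendsto (fun u : ℝ => u ^ s * ((∑ i ∈ J, |c i|) / |s|)) atTop (𝓝 0) := by
      have := (tendsto_rpow_neg_atTop (y := -s) (by linarith)).mul_const ((∑ i ∈ J, |c i|) / |s|)
      simpa using this
    refine squeeze_zero_norm' ?_ h1
    filter_upwards [eventually_gt_atTop 0] with u hu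
    rw [Pi.mul_apply, norm_mul, norm_div, Real.norm_eq_abs, Real.norm_eq_abs, Real.norm_eq_abs,
      abs_of_nonneg (Real.rpow_nonneg hu.le _)]
    calc _ ≤ u ^ s / |s| * ∑ i ∈ J, |c i| := by gcongr; exact abs_expSum_le J ha hu.le
      _ = _ := by ring
  have key := integral_Ioi_mul_deriv_eq_deriv_mul (a := (0 : ℝ)) (u := fun u : ℝ => u ^ s / s)
    (v := expSum J c a) (u' := fun u => u ^ (s - 1)) (v' := expSum J (fun i => -(a i * c i)) a)
    (fun u hu => by
      have := (Real.hasDerivAt_rpow_const (p := s) (Or.inl (ne_of_gt hu))).div_const s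
      have hne := hs0.ne
      rwa [show s * u ^ (s - 1) / s = u ^ (s - 1) by field_simp] at this)
    (fun u _ => hasDerivAt_expSum J c a u)
    (by
      refine (hint.const_mul (1 / s)).congr (Eventually.of_forall fun u => ?_)
      simp only [Pi.mul_apply]; ring)
    (by simpa only [Pi.mul_def] using h0) hlim0 hlim1
  have h2 : ∫ u in Set.Ioi (0 : ℝ), u ^ s / s * expSum J (fun i => -(a i * c i)) a u =
      1 / s * ∫ u in Set.Ioi (0 : ℝ), u ^ s * expSum J (fun i => -(a i * c i)) a u := by
    rw [← integral_const_mul]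
    congr 1; ext u; ring
  rw [h2] at key
  linarith

/-- Analytic continuation of the Gamma integral: integration by parts raises `s` by 1, matching
`Γ(s+1) = s Γ(s)`, until `s` is positive. After one step the coefficients `-(a_i c_i)` vanish
wherever `a_i = 0`, so the side condition `hc` takes care of itself. -/
theorem integrableOn_expSum (K : ℕ) {c a : ι → ℝ} (ha : ∀ i ∈ J, 0 ≤ a i)
    (hK : ∀ p < K, ∑ i ∈ J, c i * a i ^ p = 0) {s : ℝ} (hs : 0 < s + K) (hs1 : ∀ n : ℕ, s ≠ -n)
    (hc : 0 < s → ∀ i ∈ J, a i = 0 → c i = 0) :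
    IntegrableOn (fun u => u ^ (s - 1) * expSum J c a u) (Set.Ioi 0) ∧
    ∫ u in Set.Ioi 0, u ^ (s - 1) * expSum J c a u =
      ∑ i ∈ J, c i * (Real.Gamma s * a i ^ (-s)) := by
  have hne : s ≠ 0 := by simpa using hs1 0
  induction K generalizing c s with
  | zero =>
    have hs' : 0 < s := by simpa using hs
    exact integrableOn_expSum_of_pos J ha (hc hs') hs'
  | succ K ih =>
    rcases hne.lt_or_gt with h | h
    · refine ⟨integrableOn_expSum_of_neg J _ ha hK hs h, ?_⟩
      obtain ⟨h1, h2⟩ := ih (c := fun i => -(a i * c i)) (s := s + 1)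
        (fun p hp => by
          have := hK (p + 1) (by omega)
          rw [← neg_eq_zero, ← Finset.sum_neg_distrib] at this
          rw [← this]
          exact Finset.sum_congr rfl fun i _ => by ring)
        (by push_cast at hs; linarith) (fun n hn => hs1 (n + 1) (by push_cast; linarith))
        (fun _ i _ hi => by simp [hi])
        (fun h0 => hs1 1 (by push_cast; linarith))
      rw [integral_expSum_step J K ha hK (by push_cast at hs; linarith) h h1, h2, Finset.mul_sum]
      refine Finset.sum_congr rfl fun i hi => ?_
      rw [Real.Gamma_add_one hne]
      rcases (ha i hi).eq_or_lt with h0 | h0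
      · simp [← h0, Real.zero_rpow (neg_ne_zero.2 hne)]
      · have : a i ^ (-s) = a i * a i ^ (-(s + 1)) := by
          rw [mul_comm, ← Real.rpow_add_one h0.ne']; congr 1; ring
        rw [this]
        field_simp
    · exact integrableOn_expSum_of_pos J ha (hc h) h

/-- At `s = -n` the Gamma function has a pole and the previous formula is void. The same recursion
now ends at the Frullani integral, which produces the logarithm, and its divisions accumulate to
`n!`. -/
theorem integral_expSum_of_nat (n K : ℕ) (hn : n < K) {c a : ι → ℝ} (ha : ∀ i ∈ J, 0 ≤ a i)
    (hK : ∀ p < K, ∑ i ∈ J, c i * a i ^ p = 0) (hc : n = 0 → ∀ i ∈ J, a i = 0 → c i = 0) :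
    IntegrableOn (fun u => u ^ (-(n : ℝ) - 1) * expSum J c a u) (Set.Ioi 0) ∧
    ∫ u in Set.Ioi 0, u ^ (-(n : ℝ) - 1) * expSum J c a u =
      ∑ i ∈ J, c i * ((-1) ^ (n + 1) / (n.factorial : ℝ) * (a i ^ n * Real.log (a i))) := by
  induction n generalizing c K with
  | zero =>
    have := integral_expSum_of_zero J ha (hc rfl) (by simpa using hK 0 hn)
    simpa using this
  | succ n ih =>
    obtain ⟨K, rfl⟩ : ∃ K', K = K' + 1 := ⟨K - 1, by omega⟩
    have hneg : -((n + 1 : ℕ) : ℝ) < 0 := by push_cast; linarith [(Nat.cast_nonneg n : (0 : ℝ) ≤ n)]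
    have hnK : (n : ℝ) + 1 < K + 1 := by exact_mod_cast hn
    refine ⟨integrableOn_expSum_of_neg J (K + 1) ha hK (by push_cast; linarith) hneg, ?_⟩
    obtain ⟨h1, h2⟩ := ih K (by omega) (c := fun i => -(a i * c i))
      (fun p hp => by
        have := hK (p + 1) (by omega)
        rw [← neg_eq_zero, ← Finset.sum_neg_distrib] at this
        rw [← this]
        exact Finset.sum_congr rfl fun i _ => by ring)
      (fun _ i _ hi => by simp [hi])
    have he : -(n : ℝ) - 1 = -((n + 1 : ℕ) : ℝ) + 1 - 1 := by push_cast; ring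
    rw [he] at h1 h2
    rw [integral_expSum_step J K ha hK (by push_cast; linarith) hneg h1, h2, Finset.mul_sum]
    refine Finset.sum_congr rfl fun i _ => ?_
    rw [Nat.factorial_succ]
    push_cast
    have : (n : ℝ) + 1 ≠ 0 := by positivity
    field_simp
    ring

end ExpSum

/-- The power-law generalized covariance as a Mellin transform. -/
theorem sum_powerLawGC_eq_integral {ι : Type*} (J : Finset ι) {φ₁ φ₂ : ℝ} (hφ₂ : 0 < φ₂) (k : ℕ)
    (hk : φ₂ < k + 1) (c : ι → ℝ) (x : ι → Plane)
    (hc : ∀ p ≤ k, ∑ i ∈ J, c i * (‖x i‖ ^ 2) ^ p = 0) :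
    ∑ i ∈ J, c i * powerLawGC φ₁ φ₂ (x i) =
      φ₁ * ∫ u in Set.Ioi 0, u ^ (-φ₂ - 1) * expSum J c (fun i => ‖x i‖ ^ 2) u := by
  have ha : ∀ i ∈ J, 0 ≤ ‖x i‖ ^ 2 := fun i _ => by positivity
  have hrpow : ∀ i, (‖x i‖ ^ 2) ^ φ₂ = ‖x i‖ ^ (2 * φ₂) := fun i => by
    rw [Real.rpow_mul (norm_nonneg _)]; norm_num
  by_cases h : φ₂ = (⌊φ₂⌋₊ : ℝ)
  · set n := ⌊φ₂⌋₊ with hn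
    have hnk : n < k + 1 := by rw [h] at hk; exact_mod_cast hk
    have hn0 : n ≠ 0 := by rintro h0; rw [h0] at h; simp at h; linarith
    obtain ⟨-, h2⟩ := integral_expSum_of_nat J n (k + 1) hnk ha (c := c)
      (fun p hp => hc p (by omega)) (fun h0 => absurd h0 hn0)
    rw [h, h2, Finset.mul_sum]
    refine Finset.sum_congr rfl fun i _ => ?_
    rw [powerLawGC, if_pos (by simp)]
    have : ⌊(n : ℝ)⌋₊ = n := by simp
    have h3 : ‖x i‖ ^ (2 * (n : ℝ)) = (‖x i‖ ^ 2) ^ n := by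
      rw [Real.rpow_mul (norm_nonneg _), Real.rpow_natCast]; norm_num
    -- The factor 2 in the logarithmic covariance is that of `log (‖x‖ ^ 2) = 2 * log ‖x‖`.
    rw [this, h3, Real.log_pow]
    push_cast; ring
  · obtain ⟨-, h2⟩ := integrableOn_expSum J (k + 1) ha (c := c) (s := -φ₂)
      (fun p hp => hc p (by omega)) (by push_cast; linarith)
      (fun n hn => h (by
        have : φ₂ = n := by linarith
        rw [this]; simp))
      (fun h0 => by linarith)
    rw [h2, Finset.mul_sum]
    refine Finset.sum_congr rfl fun i _ => ?_
    rw [powerLawGC, if_neg h, neg_neg, hrpow]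
    ring

/-! ### The spectral representation -/

section Spectral

variable {ι : Type*} (J : Finset ι)

/-- The Fourier transform `∑ c_i e^{i⟨x_i, ξ⟩}` of a finitely supported measure. -/
def trigSum (c : ι → ℝ) (x : ι → Plane) (ξ : Plane) : ℂ :=
  ∑ i ∈ J, (c i : ℂ) * Complex.exp (Complex.I * (inner ℝ (x i) ξ : ℝ))

theorem continuous_trigSum (c : ι → ℝ) (x : ι → Plane) : Continuous (trigSum J c x) := by
  unfold trigSum; fun_prop

/-- The Fourier transform of a planar Gaussian is `π/s * exp (-‖x‖²/(4s))`. It links trigonometric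
sums in frequency to exponential sums in `‖x_i‖²`. -/
theorem integral_trigSum_mul_gaussian (c : ι → ℝ) (x : ι → Plane) {s : ℝ} (hs : 0 < s) :
    ∫ ξ : Plane, (Real.exp (-(‖ξ‖ ^ 2 * s)) : ℂ) * trigSum J c x ξ =
      (Real.pi / s * expSum J c (fun i => ‖x i‖ ^ 2) (1 / (4 * s)) : ℝ) := by
  have h1 : ∀ i, ∫ ξ : Plane, Complex.exp (-(s : ℂ) * ‖ξ‖ ^ 2 + Complex.I * (inner ℝ (x i) ξ : ℝ)) =
      (Real.pi / s * Real.exp (-(‖x i‖ ^ 2 * (1 / (4 * s)))) : ℝ) := by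
    intro i
    rw [GaussianFourier.integral_cexp_neg_mul_sq_norm_add (by simpa using hs)]
    have : ((Module.finrank ℝ Plane : ℕ) : ℂ) / 2 = 1 := by simp
    rw [this, Complex.cpow_one, Complex.I_sq]
    push_cast
    congr 2
    ring
  have h2 : ∀ i, Integrable fun ξ : Plane =>
      Complex.exp (-(s : ℂ) * ‖ξ‖ ^ 2 + Complex.I * (inner ℝ (x i) ξ : ℝ)) := fun i =>
    GaussianFourier.integrable_cexp_neg_mul_sq_norm_add (by simpa using hs) _ _
  have h3 : ∀ ξ : Plane, (Real.exp (-(‖ξ‖ ^ 2 * s)) : ℂ) * trigSum J c x ξ =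
      ∑ i ∈ J, (c i : ℂ) *
        Complex.exp (-(s : ℂ) * ‖ξ‖ ^ 2 + Complex.I * (inner ℝ (x i) ξ : ℝ)) := by
    intro ξ
    rw [trigSum, Finset.mul_sum]
    refine Finset.sum_congr rfl fun i _ => ?_
    rw [Complex.exp_add, Complex.ofReal_exp]
    push_cast
    rw [show -((‖ξ‖ : ℂ) ^ 2 * s) = -(s : ℂ) * (‖ξ‖ : ℂ) ^ 2 by ring]
    ring
  simp_rw [h3]
  rw [integral_finsetSum _ fun i _ => (h2 i).const_mul _]
  simp_rw [integral_const_mul, h1, expSum, Finset.mul_sum]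
  push_cast
  exact Finset.sum_congr rfl fun i _ => by ring

/-- The substitution `u = 1/(4s)`, carried out as an inversion followed by a dilation. -/
theorem integral_expSum_inv (c a : ι → ℝ) (φ : ℝ) :
    ∫ s in Set.Ioi (0 : ℝ), s ^ (φ - 1) * expSum J c a (1 / (4 * s)) =
      4 ^ (-φ) * ∫ u in Set.Ioi (0 : ℝ), u ^ (-φ - 1) * expSum J c a u := by
  rw [← integral_comp_rpow_Ioi (fun s : ℝ => s ^ (φ - 1) * expSum J c a (1 / (4 * s)))
    (p := -1) (by norm_num)]
  have h1 : ∫ u in Set.Ioi (0 : ℝ), u ^ (-φ - 1) * expSum J c a u =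
      4⁻¹ * ∫ u in Set.Ioi (0 : ℝ), (4⁻¹ * u) ^ (-φ - 1) * expSum J c a (4⁻¹ * u) := by
    rw [integral_comp_mul_left_Ioi (fun u : ℝ => u ^ (-φ - 1) * expSum J c a u) 0
      (b := 4⁻¹) (by norm_num)]
    simp
  rw [h1, ← mul_assoc, ← integral_const_mul]
  refine setIntegral_congr_fun measurableSet_Ioi fun u hu => ?_
  have hu : (0 : ℝ) < u := hu
  have h4 : (4 : ℝ) ^ (-φ) * 4⁻¹ * (4⁻¹) ^ (-φ - 1) = 1 := by
    rw [Real.inv_rpow (by norm_num), ← Real.rpow_neg (by norm_num), ← Real.rpow_neg_one 4,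
      ← Real.rpow_add (by norm_num), ← Real.rpow_add (by norm_num)]
    rw [show -φ + -1 + -(-φ - 1) = 0 by ring, Real.rpow_zero]
  have h5 : u ^ (-1 - 1 : ℝ) * (u ^ (-1 : ℝ)) ^ (φ - 1) = u ^ (-φ - 1) := by
    rw [← Real.rpow_mul hu.le, ← Real.rpow_add hu]; congr 1; ring
  have h6 : 1 / (4 * u ^ (-1 : ℝ)) = 4⁻¹ * u := by rw [Real.rpow_neg_one]; field_simp
  simp only [abs_neg, abs_one, one_mul, smul_eq_mul]
  rw [h6, ← mul_assoc, h5, Real.mul_rpow (by norm_num) hu.le]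
  linear_combination (-(u ^ (-φ - 1) * expSum J c a (4⁻¹ * u))) * h4

theorem ae_ne_zero_plane : ∀ᵐ ξ : Plane, ξ ≠ 0 := by
  rw [ae_iff]
  simp

theorem measurable_contDensity (φ₁ φ₂ : ℝ) : Measurable (contDensity φ₁ φ₂) := by
  unfold contDensity; fun_prop

/-- The Mellin transform as a spectral integral. -/
theorem integral_trigSum_mul_contDensity {φ₁ φ₂ : ℝ} (hφ₁ : 0 < φ₁) (hφ₂ : 0 < φ₂) (c : ι → ℝ)
    (x : ι → Plane)
    (hint : Integrable fun ξ : Plane => trigSum J c x ξ * (contDensity φ₁ φ₂ ξ : ℂ)) :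
    ∫ ξ : Plane, trigSum J c x ξ * (contDensity φ₁ φ₂ ξ : ℂ) =
      ((2 * Real.pi) ^ 2 * (φ₁ * ∫ u in Set.Ioi 0,
        u ^ (-φ₂ - 1) * expSum J c (fun i => ‖x i‖ ^ 2) u) : ℝ) := by
  -- `A` is the constant of `contDensity` without `Γ(φ₂+1)`. That factor, together with the power of
  -- `‖ξ‖`, arises in `hs` by writing the density as a mixture over `s` of the Gaussians `exp
  -- (-s‖ξ‖²)` with weight `s^φ₂`.
  set A : ℝ := (4 : ℝ) ^ (φ₂ + 1) * Real.pi * φ₁ with hA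
  have hA0 : A ≠ 0 := by positivity
  have hΓ : 0 < Real.Gamma (φ₂ + 1) := Real.Gamma_pos_of_pos (by linarith)
  have hs : ∀ ξ : Plane, ξ ≠ 0 →
      ∫ s in Set.Ioi (0 : ℝ), s ^ φ₂ * Real.exp (-(‖ξ‖ ^ 2 * s)) = A⁻¹ * contDensity φ₁ φ₂ ξ := by
    intro ξ hξ
    have h := Real.integral_rpow_mul_exp_neg_mul_Ioi (a := φ₂ + 1) (r := ‖ξ‖ ^ 2) (by linarith)
      (by positivity)
    rw [add_sub_cancel_right] at h
    have hn : 0 < ‖ξ‖ := norm_pos_iff.2 hξ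
    have h1 : (1 / ‖ξ‖ ^ 2) ^ (φ₂ + 1) = ‖ξ‖ ^ (-(2 + 2 * φ₂)) := by
      rw [one_div, ← Real.rpow_natCast, ← Real.rpow_neg hn.le, ← Real.rpow_mul hn.le]
      congr 1; push_cast; ring
    rw [h, contDensity, h1, hA]
    field_simp
  have hsi : ∀ ξ : Plane, ξ ≠ 0 →
      IntegrableOn (fun s : ℝ => s ^ φ₂ * Real.exp (-(‖ξ‖ ^ 2 * s))) (Set.Ioi 0) := by
    intro ξ hξ
    have := integrableOn_rpow_mul_exp_neg_mul_rpow (p := 1) (s := φ₂) (b := ‖ξ‖ ^ 2)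
      (by linarith) one_pos (by positivity)
    simpa only [Real.rpow_one, neg_mul] using this
  -- Fubini for `H`: integrating `s` first gives the spectral integral, integrating `ξ` first gives
  -- the Mellin integral. The inner integral of `‖H‖` over `s` is a multiple of `‖trigSum‖ *
  -- contDensity`, so `hint` is exactly the integrability required.
  set H : Plane → ℝ → ℂ := fun ξ s =>
    ((s ^ φ₂ * Real.exp (-(‖ξ‖ ^ 2 * s)) : ℝ) : ℂ) * trigSum J c x ξ with hH
  have hcont := continuous_trigSum J c x
  have hHm : Measurable (Function.uncurry H) := by
    simp only [hH, Function.uncurry_def]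
    refine Measurable.mul (by fun_prop) (hcont.measurable.comp measurable_fst)
  have hHint : Integrable (Function.uncurry H)
      (volume.prod (volume.restrict (Set.Ioi (0 : ℝ)))) := by
    rw [integrable_prod_iff hHm.aestronglyMeasurable]
    constructor
    · filter_upwards [ae_ne_zero_plane] with ξ hξ
      have h1 : Integrable (fun s : ℝ => ((s ^ φ₂ * Real.exp (-(‖ξ‖ ^ 2 * s)) : ℝ) : ℂ))
          (volume.restrict (Set.Ioi (0 : ℝ))) := (hsi ξ hξ).ofReal
      exact h1.mul_const (trigSum J c x ξ)
    · refine (hint.norm.const_mul A⁻¹).congr ?_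
      filter_upwards [ae_ne_zero_plane] with ξ hξ
      have h1 : ∀ s ∈ Set.Ioi (0 : ℝ), ‖Function.uncurry H (ξ, s)‖ =
          s ^ φ₂ * Real.exp (-(‖ξ‖ ^ 2 * s)) * ‖trigSum J c x ξ‖ := by
        intro s hs
        have hs : (0 : ℝ) < s := hs
        simp only [hH, Function.uncurry_apply_pair]
        rw [norm_mul, Complex.norm_real, Real.norm_of_nonneg (by positivity)]
      rw [setIntegral_congr_fun measurableSet_Ioi h1, integral_mul_const, hs ξ hξ, norm_mul,
        Complex.norm_real, Real.norm_of_nonneg (by unfold contDensity; positivity)]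
      ring
  have hswap := integral_integral_swap hHint
  have hL : ∫ ξ : Plane, ∫ s in Set.Ioi (0 : ℝ), H ξ s =
      (A : ℂ)⁻¹ * ∫ ξ : Plane, trigSum J c x ξ * (contDensity φ₁ φ₂ ξ : ℂ) := by
    rw [← integral_const_mul]
    refine integral_congr_ae ?_
    filter_upwards [ae_ne_zero_plane] with ξ hξ
    simp only [hH]
    rw [integral_mul_const, integral_complex_ofReal, hs ξ hξ]
    push_cast; ring
  have hR : ∫ s in Set.Ioi (0 : ℝ), ∫ ξ : Plane, H ξ s =
      (Real.pi * (4 ^ (-φ₂) * ∫ u in Set.Ioi (0 : ℝ),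
        u ^ (-φ₂ - 1) * expSum J c (fun i => ‖x i‖ ^ 2) u) : ℝ) := by
    rw [← integral_expSum_inv, ← integral_const_mul, ← integral_complex_ofReal]
    refine setIntegral_congr_fun measurableSet_Ioi fun s hs => ?_
    have hs : (0 : ℝ) < s := hs
    have h1 : ∀ ξ, H ξ s = ((s ^ φ₂ : ℝ) : ℂ) *
        ((Real.exp (-(‖ξ‖ ^ 2 * s)) : ℂ) * trigSum J c x ξ) := by
      intro ξ; simp only [hH]; push_cast; ring
    simp_rw [h1]
    rw [integral_const_mul, integral_trigSum_mul_gaussian J c x hs, Real.rpow_sub_one hs.ne']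
    push_cast
    field_simp
  rw [hL, hR] at hswap
  rw [inv_mul_eq_iff_eq_mul₀ (by exact_mod_cast hA0)] at hswap
  rw [hswap, ← Complex.ofReal_mul]
  congr 1
  have h4 : (4 : ℝ) ^ (φ₂ + 1) * 4 ^ (-φ₂) = 4 := by
    rw [← Real.rpow_add (by norm_num)]; simp
  rw [hA]
  calc _ = ((4 : ℝ) ^ (φ₂ + 1) * 4 ^ (-φ₂)) * Real.pi ^ 2 * (φ₁ * ∫ u in Set.Ioi (0 : ℝ),
        u ^ (-φ₂ - 1) * expSum J c (fun i => ‖x i‖ ^ 2) u) := by ring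
    _ = _ := by rw [h4]; ring

end Spectral

/-! ### Periodization over the dual lattice -/

section Periodization

/-- The dual lattice vector `2πk`. -/
def dualShift (k : ℤ × ℤ) : Plane := (2 * Real.pi) • !₂[(k.1 : ℝ), (k.2 : ℝ)]

theorem dualShift_zero_apply (k : ℤ × ℤ) : dualShift k 0 = 2 * Real.pi * k.1 := by
  simp [dualShift]

theorem dualShift_one_apply (k : ℤ × ℤ) : dualShift k 1 = 2 * Real.pi * k.2 := by
  simp [dualShift]

theorem mem_torus {ξ : Plane} :
    ξ ∈ torus ↔ ξ 0 ∈ Set.Ioc (-Real.pi) Real.pi ∧ ξ 1 ∈ Set.Ioc (-Real.pi) Real.pi := by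
  simp [torus, Fin.forall_fin_two]

theorem measurableSet_torus : MeasurableSet torus := by
  have : torus = (fun ξ : Plane => ξ 0) ⁻¹' Set.Ioc (-Real.pi) Real.pi ∩
      (fun ξ : Plane => ξ 1) ⁻¹' Set.Ioc (-Real.pi) Real.pi := by
    ext ξ; exact mem_torus
  rw [this]
  exact (measurableSet_Ioc.preimage (by fun_prop)).inter (measurableSet_Ioc.preimage (by fun_prop))

theorem norm_le_of_mem_torus {ξ : Plane} (h : ξ ∈ torus) : ‖ξ‖ ≤ 2 * Real.pi := by
  rw [mem_torus] at h
  obtain ⟨⟨h1, h2⟩, h3, h4⟩ := h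
  have hπ := Real.pi_pos
  rw [EuclideanSpace.norm_eq, Real.sqrt_le_left (by positivity), Fin.sum_univ_two,
    Real.norm_eq_abs, Real.norm_eq_abs, sq_abs, sq_abs]
  have a1 : ξ 0 ^ 2 ≤ Real.pi ^ 2 := sq_le_sq' h1.le h2
  have a2 : ξ 1 ^ 2 ≤ Real.pi ^ 2 := sq_le_sq' h3.le h4
  nlinarith

theorem volume_torus_lt_top : volume torus < ⊤ := by
  have : torus ⊆ Metric.closedBall (0 : Plane) (2 * Real.pi) := fun ξ h => by
    simpa using norm_le_of_mem_torus h
  exact (measure_mono this).trans_lt measure_closedBall_lt_top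

instance : IsFiniteMeasure (volume.restrict torus : Measure Plane) :=
  ⟨by simpa using volume_torus_lt_top⟩

theorem existsUnique_sub_dualShift_mem_torus (ξ : Plane) :
    ∃! k : ℤ × ℤ, ξ - dualShift k ∈ torus := by
  have key : ∀ x : ℝ, ∃! n : ℤ, x - 2 * Real.pi * n ∈ Set.Ioc (-Real.pi) Real.pi := by
    intro x
    obtain ⟨n, hn, hu⟩ := existsUnique_sub_zsmul_mem_Ioc Real.two_pi_pos x (-Real.pi)
    have e : -Real.pi + 2 * Real.pi = Real.pi := by ring
    simp only [e, zsmul_eq_mul] at hn hu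
    exact ⟨n, by simpa only [mul_comm] using hn,
      fun y hy => hu y (by simpa only [mul_comm] using hy)⟩
  obtain ⟨n, hn, hn'⟩ := key (ξ 0)
  obtain ⟨l, hl, hl'⟩ := key (ξ 1)
  refine ⟨(n, l), ?_, ?_⟩
  · simp only [mem_torus, PiLp.sub_apply, dualShift_zero_apply, dualShift_one_apply]
    exact ⟨hn, hl⟩
  · rintro ⟨n', l'⟩ h
    simp only [mem_torus, PiLp.sub_apply, dualShift_zero_apply, dualShift_one_apply] at h
    rw [hn' n' h.1, hl' l' h.2]

/-- The translate of the torus by `2πk`. -/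
def tile (k : ℤ × ℤ) : Set Plane := (fun ξ => ξ - dualShift k) ⁻¹' torus

theorem measurableSet_tile (k : ℤ × ℤ) : MeasurableSet (tile k) :=
  measurableSet_torus.preimage (by fun_prop)

theorem iUnion_tile : ⋃ k, tile k = Set.univ :=
  Set.eq_univ_of_forall fun ξ => Set.mem_iUnion.2 (existsUnique_sub_dualShift_mem_torus ξ).exists

theorem pairwise_disjoint_tile : Pairwise (Function.onFun Disjoint tile) := fun _ _ hkl =>
  Set.disjoint_left.2 fun ξ h1 h2 =>
    hkl ((existsUnique_sub_dualShift_mem_torus ξ).unique h1 h2)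

theorem lintegral_eq_tsum_torus (f : Plane → ENNReal) :
    ∫⁻ ξ, f ξ = ∑' k, ∫⁻ ξ in torus, f (ξ + dualShift k) := by
  rw [← setLIntegral_univ, ← iUnion_tile,
    lintegral_iUnion measurableSet_tile pairwise_disjoint_tile]
  refine tsum_congr fun k => ?_
  rw [← (measurePreserving_sub_right volume (dualShift k)).setLIntegral_comp_preimage_emb
    (MeasurableEquiv.subRight (dualShift k)).measurableEmbedding (fun ξ => f (ξ + dualShift k))]
  simp [tile]

theorem integral_eq_tsum_torus {f : Plane → ℂ} (hf : Integrable f) :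
    ∫ ξ, f ξ = ∑' k, ∫ ξ in torus, f (ξ + dualShift k) := by
  rw [← setIntegral_univ, ← iUnion_tile,
    integral_iUnion measurableSet_tile pairwise_disjoint_tile hf.integrableOn]
  refine tsum_congr fun k => ?_
  rw [← (measurePreserving_sub_right volume (dualShift k)).setIntegral_preimage_emb
    (MeasurableEquiv.subRight (dualShift k)).measurableEmbedding (fun ξ => f (ξ + dualShift k))]
  simp [tile]

variable {φ₁ φ₂ : ℝ}

theorem contDensity_nonneg (hφ₁ : 0 < φ₁) (hφ₂ : 0 < φ₂) (ξ : Plane) :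
    0 ≤ contDensity φ₁ φ₂ ξ := by
  have := Real.Gamma_pos_of_pos (show 0 < φ₂ + 1 by linarith)
  unfold contDensity; positivity

/-- Coordinatewise, `|x + 2πn| ≥ 2π|n| - π ≥ π|n|` for `n ≠ 0` and `|x| ≤ π`. The norm on the left
is the sup norm, for which the lattice sum of powers is known to converge. -/
theorem pi_mul_norm_le {ξ : Plane} (hξ : ξ ∈ torus) (k : ℤ × ℤ) :
    Real.pi * ‖(![k.1, k.2] : Fin 2 → ℤ)‖ ≤ ‖ξ + dualShift k‖ := by
  have hπ := Real.pi_pos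
  have key : ∀ (x : ℝ) (n : ℤ), x ∈ Set.Ioc (-Real.pi) Real.pi →
      Real.pi * |(n : ℝ)| ≤ |x + 2 * Real.pi * n| := by
    intro x n hx
    have h1 : |x| ≤ Real.pi := abs_le.2 ⟨hx.1.le, hx.2⟩
    rcases eq_or_ne n 0 with rfl | hn
    · simp
    · have h2 : (1 : ℝ) ≤ |(n : ℝ)| := by exact_mod_cast Int.one_le_abs hn
      have h3 : |2 * Real.pi * (n : ℝ)| = 2 * Real.pi * |(n : ℝ)| := by
        rw [abs_mul, abs_of_pos (by positivity)]
      have h4 := abs_sub_abs_le_abs_sub (2 * Real.pi * (n : ℝ)) (-x)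
      rw [sub_neg_eq_add, abs_neg, h3, add_comm _ x] at h4
      nlinarith
  rw [mem_torus] at hξ
  rw [mul_comm, ← le_div_iff₀ hπ, pi_norm_le_iff_of_nonneg (by positivity), Fin.forall_fin_two]
  have hc : ∀ i, |(ξ + dualShift k) i| ≤ ‖ξ + dualShift k‖ := fun i => by
    simpa using PiLp.norm_apply_le (ξ + dualShift k) i
  refine ⟨?_, ?_⟩
  · rw [le_div_iff₀ hπ, mul_comm]
    refine le_trans ?_ (hc 0)
    rw [PiLp.add_apply, dualShift_zero_apply]
    simpa [Int.norm_eq_abs] using key _ k.1 hξ.1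
  · rw [le_div_iff₀ hπ, mul_comm]
    refine le_trans ?_ (hc 1)
    rw [PiLp.add_apply, dualShift_one_apply]
    simpa [Int.norm_eq_abs] using key _ k.2 hξ.2

theorem dualShift_zero : dualShift 0 = 0 := by
  ext i; fin_cases i <;> simp [dualShift]

/-- On the torus only the unshifted term is singular. All the others are dominated by a lattice sum
with exponent `2 + 2φ₂ > 2`, uniformly in `ξ`. -/
theorem exists_contDensity_add_le (hφ₁ : 0 < φ₁) (hφ₂ : 0 < φ₂) :
    ∃ b : ℤ × ℤ → ℝ, Summable b ∧ (∀ k, 0 ≤ b k) ∧ ∀ ξ ∈ torus, ∀ k,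
      contDensity φ₁ φ₂ (ξ + dualShift k) ≤ (if k = 0 then contDensity φ₁ φ₂ ξ else 0) + b k := by
  have hΓ := Real.Gamma_pos_of_pos (show 0 < φ₂ + 1 by linarith)
  have hπ := Real.pi_pos
  set A := (4 : ℝ) ^ (φ₂ + 1) * Real.pi * Real.Gamma (φ₂ + 1) * φ₁ with hA
  have hA0 : 0 < A := by positivity
  refine ⟨fun k => A * Real.pi ^ (-(2 + 2 * φ₂)) * ‖(![k.1, k.2] : Fin 2 → ℤ)‖ ^ (-(2 + 2 * φ₂)),
    ?_, fun k => by positivity, ?_⟩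
  · refine Summable.mul_left _ ?_
    have := EisensteinSeries.summable_one_div_norm_rpow (k := 2 + 2 * φ₂) (by linarith)
    rw [← (finTwoArrowEquiv ℤ).symm.summable_iff] at this
    exact this
  · intro ξ hξ k
    by_cases hk : k = 0
    · subst hk
      rw [if_pos rfl, dualShift_zero, add_zero]
      have : 0 ≤ A * Real.pi ^ (-(2 + 2 * φ₂)) *
        ‖(![(0 : ℤ × ℤ).1, (0 : ℤ × ℤ).2] : Fin 2 → ℤ)‖ ^ (-(2 + 2 * φ₂)) := by positivity
      linarith
    · rw [if_neg hk, zero_add, contDensity, ← hA]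
      simp only []
      rw [mul_assoc A, ← Real.mul_rpow hπ.le (norm_nonneg _)]
      refine mul_le_mul_of_nonneg_left ?_ hA0.le
      refine Real.rpow_le_rpow_of_nonpos ?_ (pi_mul_norm_le hξ k) (by linarith)
      refine mul_pos hπ (norm_pos_iff.2 fun h => hk ?_)
      have h0 := congrFun h 0
      have h1 := congrFun h 1
      exact Prod.ext (by simpa using h0) (by simpa using h1)

theorem summable_contDensity (hφ₁ : 0 < φ₁) (hφ₂ : 0 < φ₂) {ξ : Plane} (hξ : ξ ∈ torus) :
    Summable fun k => contDensity φ₁ φ₂ (ξ + dualShift k) := by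
  obtain ⟨b, hb, -, h⟩ := exists_contDensity_add_le hφ₁ hφ₂
  refine Summable.of_nonneg_of_le (fun k => contDensity_nonneg hφ₁ hφ₂ _) (h ξ hξ)
    (Summable.add ?_ hb)
  exact (hasSum_ite_eq 0 (contDensity φ₁ φ₂ ξ)).summable

theorem latDensity_nonneg (hφ₁ : 0 < φ₁) (hφ₂ : 0 < φ₂) (ξ : Plane) :
    0 ≤ latDensity φ₁ φ₂ ξ := tsum_nonneg fun _ => contDensity_nonneg hφ₁ hφ₂ _

theorem exists_latDensity_le (hφ₁ : 0 < φ₁) (hφ₂ : 0 < φ₂) :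
    ∃ S, 0 ≤ S ∧ ∀ ξ ∈ torus, latDensity φ₁ φ₂ ξ ≤ contDensity φ₁ φ₂ ξ + S := by
  obtain ⟨b, hb, hb0, h⟩ := exists_contDensity_add_le hφ₁ hφ₂
  refine ⟨∑' k, b k, tsum_nonneg hb0, fun ξ hξ => ?_⟩
  have h1 := (hasSum_ite_eq (0 : ℤ × ℤ) (contDensity φ₁ φ₂ ξ)).add hb.hasSum
  rw [← h1.tsum_eq]
  exact (summable_contDensity hφ₁ hφ₂ hξ).tsum_le_tsum (h ξ hξ) h1.summable

/-- In `ENNReal` a countable sum of measurable functions is measurable without any summability.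
Where the sum diverges, `toReal` and the real `tsum` both return 0. -/
theorem measurable_latDensity (hφ₁ : 0 < φ₁) (hφ₂ : 0 < φ₂) : Measurable (latDensity φ₁ φ₂) := by
  have h : latDensity φ₁ φ₂ = fun ξ =>
      (∑' k, ENNReal.ofReal (contDensity φ₁ φ₂ (ξ + dualShift k))).toReal := by
    ext ξ
    rw [ENNReal.tsum_toReal_eq fun _ => ENNReal.ofReal_ne_top]
    exact tsum_congr fun k => (ENNReal.toReal_ofReal (contDensity_nonneg hφ₁ hφ₂ _)).symm
  rw [h]
  refine (Measurable.tsum fun k => ?_).ennreal_toReal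
  exact ((measurable_contDensity φ₁ φ₂).comp (measurable_id.add_const _)).ennreal_ofReal

theorem norm_one_sub_exp_le (x : ℝ) : ‖1 - Complex.exp (Complex.I * x)‖ ≤ |x| := by
  rw [norm_sub_rev]; simpa using Real.norm_exp_I_mul_ofReal_sub_one_le (x := x)

theorem norm_one_sub_exp_le_two (x : ℝ) : ‖1 - Complex.exp (Complex.I * x)‖ ≤ 2 := by
  refine (norm_sub_le _ _).trans (le_of_eq ?_)
  rw [mul_comm, Complex.norm_exp_ofReal_mul_I]; norm_num

theorem norm_diffSymbol_le (m : ℕ) (ξ : Plane) : ‖diffSymbol m ξ‖ ≤ ‖ξ‖ ^ (2 * m) := by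
  have hc : ∀ i, |ξ i| ≤ ‖ξ‖ := fun i => by simpa using PiLp.norm_apply_le ξ i
  rw [diffSymbol, norm_mul, norm_pow, norm_pow, two_mul, pow_add]
  gcongr
  · exact (norm_one_sub_exp_le _).trans (hc 0)
  · exact (norm_one_sub_exp_le _).trans (hc 1)

theorem norm_diffSymbol_le_four (m : ℕ) (ξ : Plane) : ‖diffSymbol m ξ‖ ≤ 4 ^ m := by
  rw [diffSymbol, norm_mul, norm_pow, norm_pow, show (4 : ℝ) = 2 * 2 by norm_num, mul_pow]
  gcongr <;> exact norm_one_sub_exp_le_two _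

/-- The squared symbol is at most `‖ξ‖^(4m)`, and `4m ≥ 2 + 2φ₂` since `m ≥ 1` and `m > φ₂`; so the
singularity of the unshifted term is cancelled. The remaining terms and the symbol are bounded on
the torus. -/
theorem exists_filteredDensity_le (hφ₁ : 0 < φ₁) (hφ₂ : 0 < φ₂) {m : ℕ} (hm : φ₂ < m)
    (hm1 : 1 ≤ m) : ∃ M, 0 ≤ M ∧ ∀ ξ ∈ torus, filteredDensity φ₁ φ₂ m ξ ≤ M := by
  obtain ⟨S, hS, h⟩ := exists_latDensity_le hφ₁ hφ₂
  have hΓ := Real.Gamma_pos_of_pos (show 0 < φ₂ + 1 by linarith)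
  have hπ := Real.pi_pos
  set A := (4 : ℝ) ^ (φ₂ + 1) * Real.pi * Real.Gamma (φ₂ + 1) * φ₁ with hA
  have hA0 : 0 < A := by positivity
  have hm1' : (1 : ℝ) ≤ m := by exact_mod_cast hm1
  refine ⟨A * (2 * Real.pi) ^ (4 * m - (2 + 2 * φ₂)) + (4 ^ m) ^ 2 * S, by positivity,
    fun ξ hξ => ?_⟩
  have h1 : ‖diffSymbol m ξ‖ ^ 2 * contDensity φ₁ φ₂ ξ ≤
      A * (2 * Real.pi) ^ (4 * m - (2 + 2 * φ₂)) := by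
    rcases eq_or_ne ξ 0 with rfl | h0
    · have : contDensity φ₁ φ₂ 0 = 0 := by
        rw [contDensity, norm_zero, Real.zero_rpow (by linarith), mul_zero]
      rw [this, mul_zero]; positivity
    · have hn : 0 < ‖ξ‖ := norm_pos_iff.2 h0
      calc _ ≤ (‖ξ‖ ^ (2 * m)) ^ 2 * (A * ‖ξ‖ ^ (-(2 + 2 * φ₂))) := by
            rw [contDensity, ← hA]
            gcongr
            exact norm_diffSymbol_le m ξ
        _ = A * ‖ξ‖ ^ (4 * m - (2 + 2 * φ₂)) := by
            rw [← pow_mul, ← Real.rpow_natCast, mul_left_comm, ← Real.rpow_add hn]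
            push_cast
            congr 2; ring
        _ ≤ _ := by
            gcongr
            · linarith
            · exact norm_le_of_mem_torus hξ
  calc filteredDensity φ₁ φ₂ m ξ ≤ ‖diffSymbol m ξ‖ ^ 2 * (contDensity φ₁ φ₂ ξ + S) := by
        rw [filteredDensity]; gcongr; exact h ξ hξ
    _ = ‖diffSymbol m ξ‖ ^ 2 * contDensity φ₁ φ₂ ξ + ‖diffSymbol m ξ‖ ^ 2 * S := by ring
    _ ≤ _ := by gcongr; exact norm_diffSymbol_le_four m ξ

/-- Integrals of a periodic function against the spectral density of the field fold to integrals
against the aliased density. -/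
theorem integral_mul_contDensity_eq (hφ₁ : 0 < φ₁) (hφ₂ : 0 < φ₂) {g : Plane → ℂ}
    (hg : Measurable g) (hper : ∀ ξ k, g (ξ + dualShift k) = g ξ) {M : ℝ}
    (hM : ∀ ξ ∈ torus, ‖g ξ‖ * latDensity φ₁ φ₂ ξ ≤ M) :
    Integrable (fun ξ => g ξ * (contDensity φ₁ φ₂ ξ : ℂ)) ∧
    ∫ ξ, g ξ * (contDensity φ₁ φ₂ ξ : ℂ) = ∫ ξ in torus, g ξ * (latDensity φ₁ φ₂ ξ : ℂ) := by
  have hcm := measurable_contDensity φ₁ φ₂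
  have hnorm : ∀ ξ k, ‖g (ξ + dualShift k) * (contDensity φ₁ φ₂ (ξ + dualShift k) : ℂ)‖ₑ =
      ‖g ξ‖ₑ * ENNReal.ofReal (contDensity φ₁ φ₂ (ξ + dualShift k)) := by
    intro ξ k
    rw [enorm_mul, hper]
    congr 1
    rw [← ofReal_norm, Complex.norm_real,
      Real.norm_of_nonneg (contDensity_nonneg hφ₁ hφ₂ _)]
  have hfin : ∑' k, ∫⁻ ξ in torus,
      ‖g (ξ + dualShift k) * (contDensity φ₁ φ₂ (ξ + dualShift k) : ℂ)‖ₑ < ⊤ := by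
    simp_rw [hnorm]
    rw [← lintegral_tsum]
    · calc _ ≤ ∫⁻ ξ in torus, ENNReal.ofReal M := by
            refine setLIntegral_mono' measurableSet_torus fun ξ hξ => ?_
            rw [ENNReal.tsum_mul_left,
              ← ENNReal.ofReal_tsum_of_nonneg (fun k => contDensity_nonneg hφ₁ hφ₂ _)
                (summable_contDensity hφ₁ hφ₂ hξ), ← ofReal_norm,
              ← ENNReal.ofReal_mul (norm_nonneg _)]
            exact ENNReal.ofReal_le_ofReal (hM ξ hξ)
        _ < ⊤ := by
            rw [setLIntegral_const]
            exact ENNReal.mul_lt_top ENNReal.ofReal_lt_top volume_torus_lt_top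
    · intro k
      exact (hg.enorm.mul (hcm.comp (measurable_id.add_const _)).ennreal_ofReal).aemeasurable
  have hmeas : Measurable fun ξ => g ξ * (contDensity φ₁ φ₂ ξ : ℂ) :=
    hg.mul (Complex.measurable_ofReal.comp hcm)
  have hI : Integrable (fun ξ => g ξ * (contDensity φ₁ φ₂ ξ : ℂ)) := by
    refine ⟨hmeas.aestronglyMeasurable, ?_⟩
    rw [HasFiniteIntegral, lintegral_eq_tsum_torus]
    exact hfin
  refine ⟨hI, ?_⟩
  rw [integral_eq_tsum_torus hI, ← integral_tsum]
  · refine setIntegral_congr_fun measurableSet_torus fun ξ hξ => ?_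
    simp only [hper]
    rw [tsum_mul_left, latDensity, Complex.ofReal_tsum]
    rfl
  · intro k
    exact (hmeas.comp (measurable_id.add_const (dualShift k))).aestronglyMeasurable
  · exact hfin.ne

end Periodization

/-! ### Fourier series on the torus -/

section TorusFourier

local instance : MeasureSpace UnitAddCircle := ⟨AddCircle.haarAddCircle⟩

local instance : IsProbabilityMeasure (volume : Measure UnitAddCircle) :=
  inferInstanceAs (IsProbabilityMeasure AddCircle.haarAddCircle)

/-- The representative in `(-π, π]²` of a point of the unit torus. -/
def torusRep (x : UnitAddTorus (Fin 2)) : Plane :=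
  (2 * Real.pi) • WithLp.toLp 2 (UnitAddTorus.measurableEquivPiIoc (fun _ => -(1 / 2)) x).1

theorem measurable_torusRep : Measurable torusRep := by
  unfold torusRep
  have h : Measurable fun x : UnitAddTorus (Fin 2) =>
      WithLp.toLp 2 (UnitAddTorus.measurableEquivPiIoc (fun _ => -(1 / 2 : ℝ)) x).1 :=
    (WithLp.measurable_toLp 2 _).comp (measurable_subtype_coe.comp (MeasurableEquiv.measurable _))
  exact Measurable.const_smul h (2 * Real.pi)

theorem torusRep_mem (x : UnitAddTorus (Fin 2)) : torusRep x ∈ torus := by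
  intro i
  have h := (UnitAddTorus.measurableEquivPiIoc (fun _ : Fin 2 => -(1 / 2 : ℝ)) x).2 i
  have hπ := Real.pi_pos
  simp only [torusRep, PiLp.smul_apply, smul_eq_mul]
  constructor <;> nlinarith [h.1, h.2]

-- Dilation by `2π` of the fundamental domain `(-1/2, 1/2]²`. It carries Fourier analysis on the
-- unit torus with its probability measure over to `(-π, π]²`.
open scoped Pointwise in
theorem integral_torusRep {E : Type*} [NormedAddCommGroup E] [NormedSpace ℝ E] (G : Plane → E) :
    ∫ x : UnitAddTorus (Fin 2), G (torusRep x) =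
      ((2 * Real.pi) ^ 2)⁻¹ • ∫ ξ in torus, G ξ := by
  have hπ := Real.pi_pos
  set S : Set (Fin 2 → ℝ) := {x | ∀ i, x i ∈ Set.Ioc (-(1 / 2 : ℝ)) (-(1 / 2) + 1)} with hS
  have hSm : MeasurableSet S := MeasurableSet.univ_pi' fun _ => measurableSet_Ioc
  have h1 : ∫ x : UnitAddTorus (Fin 2), G (torusRep x) =
      ∫ x in S, G ((2 * Real.pi) • WithLp.toLp 2 x) := by
    rw [UnitAddTorus.integral_preimage _ fun _ => -(1 / 2)]
    refine setIntegral_congr_fun hSm fun x hx => ?_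
    simp only [torusRep]
    congr 3
    have := (UnitAddTorus.measurableEquivPiIoc (fun _ : Fin 2 => -(1 / 2 : ℝ))).apply_symm_apply
      ⟨x, hx⟩
    rw [UnitAddTorus.coe_symm_measurableEquivPiIoc_apply] at this
    exact congrArg Subtype.val this
  have h2 : ∫ x in S, G ((2 * Real.pi) • WithLp.toLp 2 x) =
      ∫ y in WithLp.ofLp ⁻¹' S, G ((2 * Real.pi) • y) := by
    rw [← (PiLp.volume_preserving_ofLp (Fin 2)).setIntegral_preimage_emb
      (MeasurableEquiv.toLp 2 (Fin 2 → ℝ)).symm.measurableEmbedding]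
  have h3 : (2 * Real.pi) • (WithLp.ofLp ⁻¹' S : Set Plane) = torus := by
    ext ξ
    rw [Set.mem_smul_set_iff_inv_smul_mem₀ (by positivity)]
    simp only [hS, Set.mem_preimage, Set.mem_ofPred_eq, torus, WithLp.ofLp_smul, Pi.smul_apply,
      smul_eq_mul, Set.mem_Ioc]
    refine forall_congr' fun i => and_congr ?_ ?_
    · rw [inv_mul_eq_div, lt_div_iff₀ (by positivity)]
      constructor <;> intro h <;> linarith
    · rw [inv_mul_eq_div, div_le_iff₀ (by positivity)]
      constructor <;> intro h <;> linarith
  rw [h1, h2, Measure.setIntegral_comp_smul_of_pos volume G _ (by positivity), h3]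
  simp

/-- The character `ξ ↦ e^{i⟨h, ξ⟩}` of the lattice vector `h`. -/
def latChar (h : ℤ × ℤ) (ξ : Plane) : ℂ := Complex.exp (Complex.I * (h.1 * ξ 0 + h.2 * ξ 1 : ℝ))

theorem measurable_latChar (h : ℤ × ℤ) : Measurable (latChar h) := by
  unfold latChar; fun_prop

theorem norm_latChar (h : ℤ × ℤ) (ξ : Plane) : ‖latChar h ξ‖ = 1 := by
  rw [latChar, mul_comm, Complex.norm_exp_ofReal_mul_I]

theorem latChar_add (h h' : ℤ × ℤ) (ξ : Plane) :
    latChar (h + h') ξ = latChar h ξ * latChar h' ξ := by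
  rw [latChar, latChar, latChar, ← Complex.exp_add]
  congr 1
  push_cast [Prod.fst_add, Prod.snd_add]; ring

theorem conj_latChar (h : ℤ × ℤ) (ξ : Plane) :
    (starRingEnd ℂ) (latChar h ξ) = latChar (-h) ξ := by
  rw [latChar, latChar, ← Complex.exp_conj]
  congr 1
  simp
  ring

theorem mFourier_eq_latChar_torusRep (h : ℤ × ℤ) (x : UnitAddTorus (Fin 2)) :
    UnitAddTorus.mFourier ![h.1, h.2] x = latChar h (torusRep x) := by
  have hx : ∀ i, x i = (((UnitAddTorus.measurableEquivPiIoc (fun _ => -(1 / 2)) x).1 i : ℝ) :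
      UnitAddCircle) := fun i => by
    have := (UnitAddTorus.measurableEquivPiIoc (fun _ : Fin 2 => -(1 / 2 : ℝ))).symm_apply_apply x
    rw [UnitAddTorus.coe_symm_measurableEquivPiIoc] at this
    exact (congrFun this i).symm
  simp only [UnitAddTorus.mFourier, ContinuousMap.coe_mk, Fin.prod_univ_two]
  rw [hx 0, hx 1, fourier_coe_apply, fourier_coe_apply, latChar, ← Complex.exp_add]
  congr 1
  simp only [torusRep, PiLp.smul_apply, smul_eq_mul]
  push_cast
  simp
  ring

theorem integral_latChar (h : ℤ × ℤ) :
    ∫ ξ in torus, latChar h ξ = if h = 0 then ((2 * Real.pi) ^ 2 : ℂ) else 0 := by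
  have h1 := integral_torusRep (latChar h)
  simp_rw [← mFourier_eq_latChar_torusRep] at h1
  have h2 := (orthonormal_iff_ite.1 (UnitAddTorus.orthonormal_mFourier (d := Fin 2)))
    0 ![h.1, h.2]
  rw [ContinuousMap.inner_toLp] at h2
  have h3 : (0 = (![h.1, h.2] : Fin 2 → ℤ)) ↔ h = 0 := by
    constructor
    · intro e
      exact Prod.ext (by simpa using (congrFun e 0).symm) (by simpa using (congrFun e 1).symm)
    · rintro rfl; ext i; fin_cases i <;> rfl
  simp only [UnitAddTorus.mFourier_zero, ContinuousMap.one_apply, map_one, mul_one, h3] at h2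
  rw [h2] at h1
  have hπ : ((2 * Real.pi) ^ 2 : ℝ) ≠ 0 := by positivity
  rw [eq_inv_smul_iff₀ hπ] at h1
  rw [← h1]
  split_ifs <;> simp

/-- **Parseval's identity** on `(-π, π]²`. -/
theorem hasSum_sq_norm_fourier {G : Plane → ℂ} (hG : Measurable G) {M : ℝ}
    (hM : ∀ ξ ∈ torus, ‖G ξ‖ ≤ M) :
    HasSum (fun h : ℤ × ℤ => ‖((2 * Real.pi) ^ 2)⁻¹ • ∫ ξ in torus, latChar h ξ * G ξ‖ ^ 2)
      (((2 * Real.pi) ^ 2)⁻¹ * ∫ ξ in torus, ‖G ξ‖ ^ 2) := by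
  have hmem : MemLp (fun x => G (torusRep x)) 2 (volume : Measure (UnitAddTorus (Fin 2))) :=
    MemLp.of_bound (hG.comp measurable_torusRep).aestronglyMeasurable M
      (Eventually.of_forall fun x => hM _ (torusRep_mem x))
  have h1 := UnitAddTorus.hasSum_sq_mFourierCoeff hmem.toLp
  have h2 : ∫ t, ‖(hmem.toLp : UnitAddTorus (Fin 2) → ℂ) t‖ ^ 2 =
      ((2 * Real.pi) ^ 2)⁻¹ * ∫ ξ in torus, ‖G ξ‖ ^ 2 := by
    rw [← smul_eq_mul, ← integral_torusRep fun ξ => ‖G ξ‖ ^ 2]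
    refine integral_congr_ae ?_
    filter_upwards [hmem.coeFn_toLp] with x hx
    rw [hx]
  rw [h2] at h1
  -- The negation is there because `mFourierCoeff` at `n` integrates against the character of index
  -- `-n`.
  let e : ℤ × ℤ ≃ (Fin 2 → ℤ) := (Equiv.neg _).trans (finTwoArrowEquiv ℤ).symm
  rw [← e.hasSum_iff] at h1
  convert h1 using 2 with h
  simp only [Function.comp_apply]
  congr 1
  have he : -(e h) = ![h.1, h.2] := by
    ext i; fin_cases i <;> simp [e]
  rw [UnitAddTorus.mFourierCoeff, he, ← integral_torusRep fun ξ => latChar h ξ * G ξ]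
  congr 1
  refine integral_congr_ae ?_
  filter_upwards [hmem.coeFn_toLp] with x hx
  rw [hx, mFourier_eq_latChar_torusRep, smul_eq_mul]

end TorusFourier

/-! ### Bilinear difference stencils -/

section Stencils

/-- The `m`-th forward difference of a polynomial of degree below `m` is 0. Its signs are
`(-1)^(m-a)`, hence the overall factor `(-1)^m` in the proof. -/
theorem sum_neg_one_pow_choose_mul_pow {m q : ℕ} (hq : q < m) (x y : ℝ) :
    ∑ a ∈ Finset.range (m + 1), (-1 : ℝ) ^ a * (m.choose a : ℝ) * (x + y * a) ^ q = 0 := by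
  set P : Polynomial ℝ := (Polynomial.C x + Polynomial.C y * Polynomial.X) ^ q with hP
  have hdeg : P.natDegree < m := by
    refine lt_of_le_of_lt ?_ hq
    refine (Polynomial.natDegree_pow_le).trans ?_
    have : (Polynomial.C x + Polynomial.C y * Polynomial.X).natDegree ≤ 1 := by
      compute_degree
    nlinarith
  have h := congrFun (Polynomial.fwdDiff_iter_eq_zero_of_degree_lt hdeg) 0
  rw [fwdDiff_iter_eq_sum_shift, Pi.zero_apply] at h
  have h2 := congrArg (fun z => (-1 : ℝ) ^ m * z) h
  simp only [mul_zero, Finset.mul_sum] at h2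
  rw [← h2]
  refine Finset.sum_congr rfl fun a ha => ?_
  have ha : a ≤ m := Nat.lt_succ_iff.1 (Finset.mem_range.1 ha)
  have hsign : (-1 : ℝ) ^ m * (-1) ^ (m - a) = (-1) ^ a := by
    rw [← pow_add, show m + (m - a) = 2 * (m - a) + a by omega, pow_add, pow_mul]
    norm_num
  simp only [hP, zsmul_eq_mul, zero_add, nsmul_eq_mul, mul_one, Polynomial.eval_pow,
    Polynomial.eval_add, Polynomial.eval_C, Polynomial.eval_mul, Polynomial.eval_X]
  push_cast
  rw [← hsign]
  ring

/-- The bilinear stencil is a tensor product. The algebra `R` is `ℝ` for the polynomial identities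
and `ℂ` for the transfer functions. -/
theorem sum_Lam_stencilCoeff_mul (m : ℕ) {R : Type*} [CommRing R] [Algebra ℝ R] (f g : ℕ → R) :
    ∑ a ∈ Lam (m + 1), algebraMap ℝ R (stencilCoeff m a) * (f a.1 * g a.2) =
      (∑ a ∈ Finset.range (m + 1), algebraMap ℝ R ((-1) ^ a * (m.choose a : ℝ)) * f a) *
        ∑ a ∈ Finset.range (m + 1), algebraMap ℝ R ((-1) ^ a * (m.choose a : ℝ)) * g a := by
  rw [Lam, Finset.sum_mul_sum, ← Finset.sum_product']
  refine Finset.sum_congr rfl fun a _ => ?_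
  rw [stencilCoeff, pow_add, show (-1 : ℝ) ^ a.1 * (-1) ^ a.2 * (m.choose a.1 : ℝ) *
    (m.choose a.2 : ℝ) = ((-1) ^ a.1 * (m.choose a.1 : ℝ)) * ((-1) ^ a.2 * (m.choose a.2 : ℝ)) by
    ring, map_mul]
  ring

theorem sum_stencilCoeff_mul_pow_mul_pow {m p q : ℕ} (h : p < m ∨ q < m) (x₁ x₂ y₁ y₂ : ℝ) :
    ∑ a ∈ Lam (m + 1), stencilCoeff m a * ((x₁ + y₁ * a.1) ^ p * (x₂ + y₂ * a.2) ^ q) = 0 := by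
  have := sum_Lam_stencilCoeff_mul m (fun a => (x₁ + y₁ * (a : ℝ)) ^ p)
    (fun a => (x₂ + y₂ * (a : ℝ)) ^ q)
  simp only [Algebra.algebraMap_self, RingHom.id_apply] at this
  rw [this]
  rcases h with h | h
  · rw [sum_neg_one_pow_choose_mul_pow h, zero_mul]
  · rw [sum_neg_one_pow_choose_mul_pow h, mul_zero]

/-- The plane point of a lattice vector. -/
def latVec (h : ℤ × ℤ) : Plane := !₂[(h.1 : ℝ), (h.2 : ℝ)]

/-- A position of the window as a lattice vector. -/
def toLat (t : ℕ × ℕ) : ℤ × ℤ := (t.1, t.2)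

theorem latVec_sub (h h' : ℤ × ℤ) : latVec (h - h') = latVec h - latVec h' := by
  ext i; fin_cases i <;> simp [latVec]

/-- The lag between two stencil sites. -/
def siteLag (l l' : Fin 2) (h : ℤ × ℤ) (p : (ℕ × ℕ) × (ℕ × ℕ)) : ℤ × ℤ :=
  h + ((l : ℕ) + 1) • toLat p.1 - ((l' : ℕ) + 1) • toLat p.2

theorem norm_sq_latVec (h : ℤ × ℤ) : ‖latVec h‖ ^ 2 = (h.1 : ℝ) ^ 2 + (h.2 : ℝ) ^ 2 := by
  rw [EuclideanSpace.norm_sq_eq]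
  simp [latVec]

/-- The binomial expansion of `‖·‖^(2p)` yields monomials of degrees `2i` and `2(p-i)`. Both cannot
reach `m`, since `2p ≤ 2k < 2m`, so the sum over a single stencil already kills each monomial. -/
theorem sum_stencilCoeff_mul_norm_pow {m k p : ℕ} (hp : p ≤ k) (hm : k + 1 ≤ m) (l l' : Fin 2)
    (h : ℤ × ℤ) (δ : ℝ) :
    ∑ q ∈ Lam (m + 1) ×ˢ Lam (m + 1), stencilCoeff m q.1 * stencilCoeff m q.2 *
      (‖δ • latVec (siteLag l l' h q)‖ ^ 2) ^ p = 0 := by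
  rw [Finset.sum_product_right]
  refine Finset.sum_eq_zero fun b _ => ?_
  have h1 : ∀ a : ℕ × ℕ, stencilCoeff m a * stencilCoeff m b *
      (‖δ • latVec (siteLag l l' h (a, b))‖ ^ 2) ^ p =
      ∑ i ∈ Finset.range (p + 1), (stencilCoeff m b * (δ ^ 2) ^ p * (p.choose i : ℝ)) *
        (stencilCoeff m a *
        ((((h.1 : ℝ) - ((l' : ℕ) + 1) * b.1) + ((l : ℕ) + 1) * a.1) ^ (2 * i) *
         (((h.2 : ℝ) - ((l' : ℕ) + 1) * b.2) + ((l : ℕ) + 1) * a.2) ^ (2 * (p - i)))) := by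
    intro a
    rw [norm_smul, mul_pow, mul_pow, norm_sq_latVec, Real.norm_eq_abs, sq_abs, add_pow,
      Finset.mul_sum, Finset.mul_sum]
    refine Finset.sum_congr rfl fun i _ => ?_
    have e1 : ((siteLag l l' h (a, b)).1 : ℝ) =
        ((h.1 : ℝ) - ((l' : ℕ) + 1) * b.1) + ((l : ℕ) + 1) * a.1 := by
      simp [siteLag, toLat]; ring
    have e2 : ((siteLag l l' h (a, b)).2 : ℝ) =
        ((h.2 : ℝ) - ((l' : ℕ) + 1) * b.2) + ((l : ℕ) + 1) * a.2 := by
      simp [siteLag, toLat]; ring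
    rw [e1, e2]
    generalize ((h.1 : ℝ) - ((l' : ℕ) + 1) * b.1) + ((l : ℕ) + 1) * a.1 = U
    generalize ((h.2 : ℝ) - ((l' : ℕ) + 1) * b.2) + ((l : ℕ) + 1) * a.2 = V
    ring
  simp_rw [h1]
  rw [Finset.sum_comm]
  refine Finset.sum_eq_zero fun i hi => ?_
  rw [← Finset.mul_sum, sum_stencilCoeff_mul_pow_mul_pow (by
    have := Finset.mem_range.1 hi
    omega), mul_zero]

/-- The covariance at lag `h` of the step-`(l+1)` and step-`(l'+1)` differences. -/
def latCov (φ₁ φ₂ : ℝ) (m : ℕ) (l l' : Fin 2) (h : ℤ × ℤ) : ℝ :=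
  ∑ q ∈ Lam (m + 1) ×ˢ Lam (m + 1), stencilCoeff m q.1 * stencilCoeff m q.2 *
    powerLawGC φ₁ φ₂ (latVec (siteLag l l' h q))

variable {φ₁ φ₂ : ℝ} {m k : ℕ}

/-- Exact self-similarity, from the substitution `u ↦ δ² u` in the Mellin integral. It holds for
integer `φ₂` too: the extra term `log δ * ‖h‖^(2φ₂)` is then a polynomial, which the stencils
annihilate. -/
theorem sum_stencilCoeff_mul_powerLawGC_smul (hφ₂ : 0 < φ₂) (hk : φ₂ < k + 1)
    (hm : k + 1 ≤ m) (l l' : Fin 2) (h : ℤ × ℤ) {δ : ℝ} (hδ : 0 < δ) :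
    ∑ q ∈ Lam (m + 1) ×ˢ Lam (m + 1), stencilCoeff m q.1 * stencilCoeff m q.2 *
      powerLawGC φ₁ φ₂ (δ • latVec (siteLag l l' h q)) = δ ^ (2 * φ₂) * latCov φ₁ φ₂ m l l' h := by
  have h1 := fun δ : ℝ => sum_powerLawGC_eq_integral (φ₁ := φ₁) (Lam (m + 1) ×ˢ Lam (m + 1))
    hφ₂ k hk
    (fun q => stencilCoeff m q.1 * stencilCoeff m q.2)
    (fun q => δ • latVec (siteLag l l' h q))
    (fun p hp => sum_stencilCoeff_mul_norm_pow hp hm l l' h δ)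
  have h2 := h1 1
  simp only [one_smul] at h2
  rw [latCov, h1 δ, h2]
  have h3 : ∀ u, expSum (Lam (m + 1) ×ˢ Lam (m + 1))
      (fun q => stencilCoeff m q.1 * stencilCoeff m q.2)
      (fun q => ‖δ • latVec (siteLag l l' h q)‖ ^ 2) u =
      expSum (Lam (m + 1) ×ˢ Lam (m + 1))
      (fun q => stencilCoeff m q.1 * stencilCoeff m q.2)
      (fun q => ‖latVec (siteLag l l' h q)‖ ^ 2) (δ ^ 2 * u) := by
    intro u
    refine Finset.sum_congr rfl fun q _ => ?_
    simp only [norm_smul, mul_pow, Real.norm_eq_abs, sq_abs]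
    congr 3; ring
  simp_rw [h3]
  set E := expSum (Lam (m + 1) ×ˢ Lam (m + 1))
      (fun q => stencilCoeff m q.1 * stencilCoeff m q.2)
      (fun q => ‖latVec (siteLag l l' h q)‖ ^ 2)
  have h4 := integral_comp_mul_left_Ioi (fun u : ℝ => u ^ (-φ₂ - 1) * E u) 0 (b := δ ^ 2)
    (by positivity)
  have h5 : ∫ u in Set.Ioi (0 : ℝ), (δ ^ 2 * u) ^ (-φ₂ - 1) * E (δ ^ 2 * u) =
      (δ ^ 2) ^ (-φ₂ - 1) * ∫ u in Set.Ioi (0 : ℝ), u ^ (-φ₂ - 1) * E (δ ^ 2 * u) := by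
    rw [← integral_const_mul]
    refine setIntegral_congr_fun measurableSet_Ioi fun u hu => ?_
    have hu : (0 : ℝ) < u := hu
    rw [Real.mul_rpow (by positivity) hu.le, mul_assoc]
  rw [h5, mul_zero, smul_eq_mul] at h4
  have h6 : (δ ^ 2) ^ (-φ₂ - 1) = (δ ^ (2 * φ₂))⁻¹ * (δ ^ 2)⁻¹ := by
    rw [Real.rpow_sub_one (by positivity), Real.rpow_neg (by positivity), Real.rpow_mul hδ.le,
      Real.rpow_two, div_eq_mul_inv]
  rw [h6] at h4
  have h7 : 0 < δ ^ (2 * φ₂) := Real.rpow_pos_of_pos hδ _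
  field_simp at h4
  rw [h4]
  ring

theorem latCov_neg (l l' : Fin 2) (h : ℤ × ℤ) :
    latCov φ₁ φ₂ m l l' h = latCov φ₁ φ₂ m l' l (-h) := by
  rw [latCov, latCov, Finset.sum_product, Finset.sum_product_right]
  refine Finset.sum_congr rfl fun a _ => Finset.sum_congr rfl fun b _ => ?_
  have h1 : siteLag l' l (-h) (b, a) = -siteLag l l' h (a, b) := by
    simp only [siteLag]; abel
  have h2 : ‖latVec (siteLag l' l (-h) (b, a))‖ = ‖latVec (siteLag l l' h (a, b))‖ := by
    rw [h1]
    have : latVec (-siteLag l l' h (a, b)) = -latVec (siteLag l l' h (a, b)) := by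
      ext i; fin_cases i <;> simp [latVec]
    rw [this, norm_neg]
  simp only [powerLawGC, h2]
  ring

/-- The transfer function of the step-`(l+1)` difference. -/
def stepFilter (m : ℕ) (l : Fin 2) (ξ : Plane) : ℂ :=
  ∑ a ∈ Lam (m + 1), (stencilCoeff m a : ℂ) * latChar (((l : ℕ) + 1) • toLat a) ξ

theorem stepFilter_eq (m : ℕ) (l : Fin 2) (ξ : Plane) :
    stepFilter m l ξ = (1 - Complex.exp (Complex.I * (ξ 0 : ℂ)) ^ ((l : ℕ) + 1)) ^ m *
      (1 - Complex.exp (Complex.I * (ξ 1 : ℂ)) ^ ((l : ℕ) + 1)) ^ m := by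
  have hb : ∀ z : ℂ, ∑ a ∈ Finset.range (m + 1),
      algebraMap ℝ ℂ ((-1) ^ a * (m.choose a : ℝ)) * z ^ a = (1 - z) ^ m := by
    intro z
    rw [sub_eq_neg_add, add_pow]
    refine Finset.sum_congr rfl fun a _ => ?_
    simp only [Complex.coe_algebraMap]
    push_cast
    rw [neg_pow z, one_pow]; ring
  rw [← hb, ← hb, ← sum_Lam_stencilCoeff_mul m
    (fun a => (Complex.exp (Complex.I * (ξ 0 : ℂ)) ^ ((l : ℕ) + 1)) ^ a)
    (fun a => (Complex.exp (Complex.I * (ξ 1 : ℂ)) ^ ((l : ℕ) + 1)) ^ a), stepFilter]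
  refine Finset.sum_congr rfl fun a _ => ?_
  rw [latChar, ← pow_mul, ← pow_mul, ← Complex.exp_nat_mul, ← Complex.exp_nat_mul,
    ← Complex.exp_add, Complex.coe_algebraMap]
  congr 2
  simp [toLat]
  ring

theorem stepFilter_zero (m : ℕ) (ξ : Plane) : stepFilter m 0 ξ = diffSymbol m ξ := by
  rw [stepFilter_eq, diffSymbol]; simp

theorem measurable_stepFilter (m : ℕ) (l : Fin 2) : Measurable (stepFilter m l) := by
  unfold stepFilter
  exact Finset.measurable_sum _ fun a _ => (measurable_latChar _).const_mul _

theorem norm_one_add_exp_sq (x : ℝ) :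
    ‖1 + Complex.exp (Complex.I * x)‖ ^ 2 = (2 * Real.cos (x / 2)) ^ 2 := by
  rw [mul_comm, Complex.exp_mul_I, ← Complex.ofReal_cos, ← Complex.ofReal_sin, Complex.sq_norm,
    Complex.normSq_apply]
  simp [Complex.cos_ofReal_re, Complex.sin_ofReal_re]
  have h1 := Real.cos_sq_add_sin_sq x
  have h2 : Real.cos x = 2 * Real.cos (x / 2) ^ 2 - 1 := by
    rw [← Real.cos_two_mul]; congr 1; ring
  nlinarith

/-- Step 2 replaces `1 - z` by `1 - z² = (1 + z)(1 - z)`, and `|1 + e^{ix}| = |2 cos(x/2)|` accounts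
for `b₂`. -/
theorem norm_stepFilter_sq (m : ℕ) (l : Fin 2) (ξ : Plane) :
    ‖stepFilter m l ξ‖ ^ 2 = stepSymbol m l ξ * ‖diffSymbol m ξ‖ ^ 2 := by
  fin_cases l
  · simp [stepFilter_zero, stepSymbol]
  · have h1 : ∀ z : ℂ, 1 - z ^ 2 = (1 + z) * (1 - z) := fun z => by ring
    have h2 : ∀ x : ℝ, (2 * Real.cos (x / 2)) ^ (2 * m) =
        (‖1 + Complex.exp (Complex.I * x)‖ ^ m) ^ 2 := fun x => by
      rw [pow_mul, ← norm_one_add_exp_sq, ← pow_mul, ← pow_mul, mul_comm m 2]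
    rw [stepFilter_eq, diffSymbol, stepSymbol]
    simp only [Fin.prod_univ_two, Fin.mk_one, Fin.isValue, one_ne_zero, if_false, h2]
    simp only [Nat.reduceAdd, h1, norm_mul, norm_pow]
    ring

theorem stepSymbol_nonneg (m : ℕ) (l : Fin 2) (ξ : Plane) : 0 ≤ stepSymbol m l ξ := by
  rw [stepSymbol]
  split_ifs
  · exact zero_le_one
  · exact Finset.prod_nonneg fun i _ => by rw [pow_mul]; positivity

theorem stepSymbol_le (m : ℕ) (l : Fin 2) (ξ : Plane) : stepSymbol m l ξ ≤ 16 ^ m := by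
  rw [stepSymbol]
  split_ifs
  · exact one_le_pow₀ (by norm_num)
  · have : ∀ i, (2 * Real.cos (ξ i / 2)) ^ (2 * m) ≤ 4 ^ m := fun i => by
      rw [pow_mul]
      have := Real.cos_sq_le_one (ξ i / 2)
      exact pow_le_pow_left₀ (sq_nonneg _) (by nlinarith) m
    rw [Fin.prod_univ_two, show (16 : ℝ) ^ m = 4 ^ m * 4 ^ m by rw [← mul_pow]; norm_num]
    exact mul_le_mul (this 0) (this 1) (by rw [pow_mul]; positivity) (by positivity)

theorem latChar_add_dualShift (h : ℤ × ℤ) (ξ : Plane) (n : ℤ × ℤ) :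
    latChar h (ξ + dualShift n) = latChar h ξ := by
  rw [latChar, latChar, Complex.exp_eq_exp_iff_exists_int]
  refine ⟨h.1 * n.1 + h.2 * n.2, ?_⟩
  rw [PiLp.add_apply, PiLp.add_apply, dualShift_zero_apply, dualShift_one_apply]
  push_cast
  ring

theorem stepFilter_add_dualShift (m : ℕ) (l : Fin 2) (ξ : Plane) (n : ℤ × ℤ) :
    stepFilter m l (ξ + dualShift n) = stepFilter m l ξ := by
  simp only [stepFilter, latChar_add_dualShift]

/-- The cross spectral density of the step-`(l+1)` and step-`(l'+1)` differences. -/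
def crossDensity (φ₁ φ₂ : ℝ) (m : ℕ) (l l' : Fin 2) (ξ : Plane) : ℂ :=
  stepFilter m l ξ * (starRingEnd ℂ) (stepFilter m l' ξ) * (latDensity φ₁ φ₂ ξ : ℂ)

theorem measurable_crossDensity (hφ₁ : 0 < φ₁) (hφ₂ : 0 < φ₂) (m : ℕ) (l l' : Fin 2) :
    Measurable (crossDensity φ₁ φ₂ m l l') := by
  unfold crossDensity
  exact ((measurable_stepFilter m l).mul
    (Complex.continuous_conj.measurable.comp (measurable_stepFilter m l'))).mul
    (Complex.measurable_ofReal.comp (measurable_latDensity hφ₁ hφ₂))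

theorem norm_crossDensity_sq (hφ₁ : 0 < φ₁) (hφ₂ : 0 < φ₂) (m : ℕ) (l l' : Fin 2) (ξ : Plane) :
    ‖crossDensity φ₁ φ₂ m l l' ξ‖ ^ 2 =
      stepSymbol m l ξ * stepSymbol m l' ξ * filteredDensity φ₁ φ₂ m ξ ^ 2 := by
  rw [crossDensity, norm_mul, norm_mul, RCLike.norm_conj, mul_pow, mul_pow, norm_stepFilter_sq,
    norm_stepFilter_sq, Complex.norm_real, Real.norm_of_nonneg (latDensity_nonneg hφ₁ hφ₂ ξ),
    filteredDensity]
  ring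

theorem filteredDensity_nonneg (hφ₁ : 0 < φ₁) (hφ₂ : 0 < φ₂) (m : ℕ) (ξ : Plane) :
    0 ≤ filteredDensity φ₁ φ₂ m ξ :=
  mul_nonneg (sq_nonneg _) (latDensity_nonneg hφ₁ hφ₂ ξ)

theorem norm_crossDensity_le (hφ₁ : 0 < φ₁) (hφ₂ : 0 < φ₂) (m : ℕ) (l l' : Fin 2) (ξ : Plane) :
    ‖crossDensity φ₁ φ₂ m l l' ξ‖ ≤ 16 ^ m * filteredDensity φ₁ φ₂ m ξ := by
  have h0 := filteredDensity_nonneg hφ₁ hφ₂ m ξ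
  refine le_of_sq_le_sq ?_ (by positivity)
  rw [norm_crossDensity_sq hφ₁ hφ₂, mul_pow, sq ((16 : ℝ) ^ m)]
  gcongr
  · exact stepSymbol_nonneg _ _ _
  · exact stepSymbol_le _ _ _
  · exact stepSymbol_le _ _ _

/-- The spectral representation of the lattice covariances. -/
theorem latCov_eq_integral (hφ₁ : 0 < φ₁) (hφ₂ : 0 < φ₂) (hk : φ₂ < k + 1)
    (hm : k + 1 ≤ m) (l l' : Fin 2) (h : ℤ × ℤ) :
    (latCov φ₁ φ₂ m l l' h : ℂ) =
      ((2 * Real.pi) ^ 2)⁻¹ • ∫ ξ in torus, latChar h ξ * crossDensity φ₁ φ₂ m l l' ξ := by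
  have hkm : (k : ℝ) + 1 ≤ m := by exact_mod_cast hm
  obtain ⟨M, hM0, hM⟩ := exists_filteredDensity_le hφ₁ hφ₂ (m := m) (by linarith) (by omega)
  set g : Plane → ℂ := fun ξ =>
    latChar h ξ * (stepFilter m l ξ * (starRingEnd ℂ) (stepFilter m l' ξ)) with hg
  have hgm : Measurable g := (measurable_latChar h).mul ((measurable_stepFilter m l).mul
    (Complex.continuous_conj.measurable.comp (measurable_stepFilter m l')))
  have hgb : ∀ ξ ∈ torus, ‖g ξ‖ * latDensity φ₁ φ₂ ξ ≤ 16 ^ m * M := by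
    intro ξ hξ
    have h1 : ‖g ξ‖ * latDensity φ₁ φ₂ ξ = ‖crossDensity φ₁ φ₂ m l l' ξ‖ := by
      rw [hg, crossDensity, norm_mul, norm_latChar, one_mul, norm_mul _ (latDensity φ₁ φ₂ ξ : ℂ),
        Complex.norm_real, Real.norm_of_nonneg (latDensity_nonneg hφ₁ hφ₂ ξ)]
    rw [h1]
    refine (norm_crossDensity_le hφ₁ hφ₂ m l l' ξ).trans ?_
    gcongr
    exact hM ξ hξ
  obtain ⟨hI, hE⟩ := integral_mul_contDensity_eq hφ₁ hφ₂ hgm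
    (fun ξ n => by simp only [hg, latChar_add_dualShift, stepFilter_add_dualShift]) hgb
  -- The sum over pairs of stencil sites factors into one transfer function times the conjugate of
  -- the other.
  have htrig : trigSum (Lam (m + 1) ×ˢ Lam (m + 1))
      (fun q => stencilCoeff m q.1 * stencilCoeff m q.2)
      (fun q => latVec (siteLag l l' h q)) = g := by
    ext ξ
    have hc : ∀ n : ℤ × ℤ, Complex.exp (Complex.I * (inner ℝ (latVec n) ξ : ℝ)) = latChar n ξ := by
      intro n
      rw [latChar, PiLp.inner_apply]
      simp [latVec, mul_comm]
    simp only [trigSum, hg, hc]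
    rw [stepFilter, stepFilter, map_sum, Finset.sum_mul_sum, Finset.mul_sum, Finset.sum_product]
    refine Finset.sum_congr rfl fun a _ => ?_
    rw [Finset.mul_sum]
    refine Finset.sum_congr rfl fun b _ => ?_
    rw [map_mul, conj_latChar, Complex.conj_ofReal]
    rw [siteLag, sub_eq_add_neg, latChar_add, latChar_add]
    push_cast
    ring
  rw [← htrig] at hI
  have h1 := sum_powerLawGC_eq_integral (φ₁ := φ₁) (Lam (m + 1) ×ˢ Lam (m + 1)) hφ₂ k hk
    (fun q => stencilCoeff m q.1 * stencilCoeff m q.2)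
    (fun q => latVec (siteLag l l' h q))
    (fun p hp => by simpa using sum_stencilCoeff_mul_norm_pow hp hm l l' h 1)
  have h2 := integral_trigSum_mul_contDensity _ hφ₁ hφ₂ _ _ hI
  rw [← h1, htrig, hE] at h2
  have h3 : ∫ ξ in torus, latChar h ξ * crossDensity φ₁ φ₂ m l l' ξ =
      ∫ ξ in torus, g ξ * (latDensity φ₁ φ₂ ξ : ℂ) := by
    refine setIntegral_congr_fun measurableSet_torus fun ξ _ => ?_
    simp only [hg, crossDensity]; ring
  have hπ : ((2 * Real.pi) ^ 2 : ℝ) ≠ 0 := by positivity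
  rw [h3, h2, Complex.ofReal_mul, ← Complex.real_smul, inv_smul_smul₀ hπ, latCov]

/-- The squared lattice covariances sum to half the limiting covariance. -/
theorem hasSum_latCov_sq (hφ₁ : 0 < φ₁) (hφ₂ : 0 < φ₂) (hk : φ₂ < k + 1)
    (hm : k + 1 ≤ m) (l l' : Fin 2) :
    HasSum (fun h => latCov φ₁ φ₂ m l l' h ^ 2) (limitCov φ₁ φ₂ m l l' / 2) := by
  have hkm : (k : ℝ) + 1 ≤ m := by exact_mod_cast hm
  obtain ⟨M, hM0, hM⟩ := exists_filteredDensity_le hφ₁ hφ₂ (m := m) (by linarith) (by omega)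
  have h1 := hasSum_sq_norm_fourier (measurable_crossDensity hφ₁ hφ₂ m l l') (M := 16 ^ m * M)
    (fun ξ hξ => (norm_crossDensity_le hφ₁ hφ₂ m l l' ξ).trans (by gcongr; exact hM ξ hξ))
  simp_rw [← latCov_eq_integral hφ₁ hφ₂ hk hm, Complex.norm_real, Real.norm_eq_abs, sq_abs,
    norm_crossDensity_sq hφ₁ hφ₂] at h1
  convert h1 using 1
  rw [limitCov, Matrix.of_apply]
  ring

end Stencils

/-! ### The Gaussian vectors of bilinear differences -/

section Differences

variable {φ₁ φ₂ : ℝ} {m k : ℕ} {ι : Type*} [Fintype ι]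

/-- Different stencils share sites, so the point masses at one site merge. Additivity of `F` in the
mass makes this harmless. -/
theorem sum_finsetSum_single {κ : Type*} (S : Finset κ) (x : κ → Plane) (c : κ → ℝ)
    (F : Plane → ℝ → ℝ) (h0 : ∀ y, F y 0 = 0) (hadd : ∀ y a b, F y (a + b) = F y a + F y b) :
    (∑ p ∈ S, Finsupp.single (x p) (c p)).sum F = ∑ p ∈ S, F (x p) (c p) := by
  classical
  rw [← Finsupp.sum_finsetSum_index h0 hadd]
  exact Finset.sum_congr rfl fun p _ => Finsupp.sum_single_index (h0 _)

/-- The signed measure of the linear combination `∑ v_i D_i` of the bilinear differences at the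
indices `e i = (l, t)`, sampled with spacing `δ`. -/
def diffMeasure (m : ℕ) (e : ι → Fin 2 × (ℕ × ℕ)) (δ : ℝ) (v : ι → ℝ) : Plane →₀ ℝ :=
  ∑ p ∈ (Finset.univ : Finset ι) ×ˢ Lam (m + 1),
    Finsupp.single (δ • latVec (toLat ((e p.1).2 + ((e p.1).1.val + 1) • p.2)))
      (v p.1 * stencilCoeff m p.2)

theorem allowable_diffMeasure (hm : k + 1 ≤ m) (e : ι → Fin 2 × (ℕ × ℕ)) (δ : ℝ) (v : ι → ℝ) :
    Allowable k (diffMeasure m e δ v) := by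
  intro p hp
  rw [diffMeasure, sum_finsetSum_single _ _ _ _ (by simp) (fun y a b => by ring),
    Finset.sum_product]
  refine Finset.sum_eq_zero fun i _ => ?_
  simp_rw [mul_assoc]
  rw [← Finset.mul_sum]
  refine mul_eq_zero_of_right _ ?_
  simp_rw [MvPolynomial.eval_eq', Finset.mul_sum]
  rw [Finset.sum_comm]
  refine Finset.sum_eq_zero fun d hd => ?_
  -- A monomial of total degree at most `k < m` has degree below `m` in the first coordinate, and
  -- that coordinate alone suffices.
  have hd' : d 0 < m := by
    have h1 := MvPolynomial.le_totalDegree hd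
    have h2 : d 0 ≤ d.sum fun _ e => e := by
      rw [Finsupp.sum_fintype _ _ (by simp), Fin.sum_univ_two]; omega
    omega
  have h3 := sum_stencilCoeff_mul_pow_mul_pow (q := d 1) (Or.inl hd') (δ * (e i).2.1)
    (δ * (e i).2.2) (δ * ((e i).1.val + 1)) (δ * ((e i).1.val + 1))
  rw [← mul_zero (p.coeff d), ← h3, Finset.mul_sum]
  refine Finset.sum_congr rfl fun a _ => ?_
  rw [Fin.prod_univ_two]
  have e1 : (δ • latVec (toLat ((e i).2 + ((e i).1.val + 1) • a))) 0 =
      δ * (e i).2.1 + δ * ((e i).1.val + 1) * a.1 := by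
    simp [latVec, toLat]; ring
  have e2 : (δ • latVec (toLat ((e i).2 + ((e i).1.val + 1) • a))) 1 =
      δ * (e i).2.2 + δ * ((e i).1.val + 1) * a.2 := by
    simp [latVec, toLat]; ring
  rw [e1, e2]
  ring

theorem sum_mul_bilinearDiff_eq {Ω : Type*} (X : Plane → Ω → ℝ) (r : Regime) (n : ℕ)
    (e : ι → Fin 2 × (ℕ × ℕ)) (v : ι → ℝ) (ω : Ω) :
    ((diffMeasure m e (r.spacing n) v).sum fun x c => c * X x ω) =
      ∑ i, v i * bilinearDiff m ((e i).1.val + 1) (sample X r n ω) (e i).2 := by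
  rw [diffMeasure, sum_finsetSum_single _ _ _ _ (by simp) (fun y a b => by ring),
    Finset.sum_product]
  refine Finset.sum_congr rfl fun i _ => ?_
  rw [bilinearDiff, Finset.mul_sum]
  refine Finset.sum_congr rfl fun a _ => ?_
  rw [sample, mul_assoc]
  simp [latVec, toLat]

variable {Ω : Type*} [MeasurableSpace Ω] {P : Measure Ω} {X : Plane → Ω → ℝ}

theorem hasGaussianLaw_sum_bilinearDiff {K : Plane → ℝ} (hm : k + 1 ≤ m)
    (hX : IsGaussianIRF k K X P) (r : Regime) (n : ℕ) (e : ι → Fin 2 × (ℕ × ℕ)) (v : ι → ℝ) :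
    HasGaussianLaw (fun ω => ∑ i, v i * bilinearDiff m ((e i).1.val + 1) (sample X r n ω) (e i).2)
      P ∧
    ∫ ω, ∑ i, v i * bilinearDiff m ((e i).1.val + 1) (sample X r n ω) (e i).2 ∂P = 0 := by
  have h := allowable_diffMeasure hm e (r.spacing n) v
  have h1 := hX.gaussian _ h
  have h2 := hX.centered _ h
  simp_rw [sum_mul_bilinearDiff_eq] at h1 h2
  exact ⟨h1, h2⟩

/-- The covariance of two normalized bilinear differences. -/
def diffCov (φ₁ φ₂ : ℝ) (m : ℕ) (i j : Fin 2 × (ℕ × ℕ)) : ℝ :=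
  latCov φ₁ φ₂ m i.1 j.1 (toLat i.2 - toLat j.2)

theorem variance_sum_bilinearDiff (hφ₂ : 0 < φ₂) (hk : φ₂ < k + 1) (hm : k + 1 ≤ m)
    (hX : IsGaussianIRF k (powerLawGC φ₁ φ₂) X P) (r : Regime) (n : ℕ) (hδ : 0 < r.spacing n)
    (e : ι → Fin 2 × (ℕ × ℕ)) (v : ι → ℝ) :
    variance (fun ω => ∑ i, v i * bilinearDiff m ((e i).1.val + 1) (sample X r n ω) (e i).2) P =
      r.spacing n ^ (2 * φ₂) * ∑ i, ∑ j, v i * v j * diffCov φ₁ φ₂ m (e i) (e j) := by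
  have h1 := hX.variance_eq _ (allowable_diffMeasure hm e (r.spacing n) v)
  simp_rw [sum_mul_bilinearDiff_eq] at h1
  rw [h1]
  set δ := r.spacing n
  have h2 : ∀ (x : Plane) (c : ℝ), ((diffMeasure m e δ v).sum fun y d =>
      c * d * powerLawGC φ₁ φ₂ (x - y)) =
      ∑ q ∈ (Finset.univ : Finset ι) ×ˢ Lam (m + 1), c * (v q.1 * stencilCoeff m q.2) *
        powerLawGC φ₁ φ₂ (x - δ • latVec (toLat ((e q.1).2 + ((e q.1).1.val + 1) • q.2))) := by
    intro x c
    rw [diffMeasure, sum_finsetSum_single _ _ _ _ (by simp) (fun y a b => by ring)]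
  simp_rw [h2]
  rw [diffMeasure, sum_finsetSum_single _ _ _ _ (by simp) (fun y a b => by
    rw [← Finset.sum_add_distrib]; exact Finset.sum_congr rfl fun _ _ => by ring)]
  simp_rw [Finset.sum_product, Finset.mul_sum]
  refine Finset.sum_congr rfl fun i _ => ?_
  rw [Finset.sum_comm]
  refine Finset.sum_congr rfl fun j _ => ?_
  rw [mul_left_comm, diffCov, ← sum_stencilCoeff_mul_powerLawGC_smul hφ₂ hk hm _ _ _ hδ,
    Finset.sum_product, Finset.mul_sum]
  refine Finset.sum_congr rfl fun a _ => ?_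
  rw [Finset.mul_sum]
  refine Finset.sum_congr rfl fun b _ => ?_
  have h3 : δ • latVec (toLat ((e i).2 + ((e i).1.val + 1) • a)) -
      δ • latVec (toLat ((e j).2 + ((e j).1.val + 1) • b)) =
      δ • latVec (siteLag (e i).1 (e j).1 (toLat (e i).2 - toLat (e j).2) (a, b)) := by
    rw [← smul_sub, ← latVec_sub]
    congr 2
    ext <;> simp [siteLag, toLat] <;> ring
  rw [h3]
  ring

/-- The covariance matrix of the normalized bilinear differences at the indices `e i`. -/
def diffCovMatrix (φ₁ φ₂ : ℝ) (m : ℕ) (e : ι → Fin 2 × (ℕ × ℕ)) : Matrix ι ι ℝ :=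
  Matrix.of fun i j => diffCov φ₁ φ₂ m (e i) (e j)

theorem diffCov_symm (i j : Fin 2 × (ℕ × ℕ)) :
    diffCov φ₁ φ₂ m i j = diffCov φ₁ φ₂ m j i := by
  rw [diffCov, latCov_neg, neg_sub, diffCov]

theorem dotProduct_diffCovMatrix_mulVec (e : ι → Fin 2 × (ℕ × ℕ)) (v : ι → ℝ) :
    v ⬝ᵥ diffCovMatrix φ₁ φ₂ m e *ᵥ v =
      ∑ i, ∑ j, v i * v j * diffCov φ₁ φ₂ m (e i) (e j) := by
  simp only [dotProduct, mulVec, diffCovMatrix, Matrix.of_apply, Finset.mul_sum]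
  exact Finset.sum_congr rfl fun i _ => Finset.sum_congr rfl fun j _ => by ring

/-- The normalized bilinear difference at the index `(l, t)`. -/
def normDiff (φ₂ : ℝ) (m : ℕ) (X : Plane → Ω → ℝ) (r : Regime) (n : ℕ) (i : Fin 2 × (ℕ × ℕ))
    (ω : Ω) : ℝ :=
  √(r.gain φ₂ n) * bilinearDiff m (i.1.val + 1) (sample X r n ω) i.2

/-- The gain exactly undoes the scaling of the covariances, which is why the two regimes are
indistinguishable from here on. Positivity of `n` excludes the degenerate spacing `1 / 0 = 0`. -/
theorem gain_mul_spacing_rpow (r : Regime) {n : ℕ} (hn : 0 < n) :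
    0 < r.spacing n ∧ 0 < r.gain φ₂ n ∧ r.gain φ₂ n * r.spacing n ^ (2 * φ₂) = 1 := by
  have hn' : (0 : ℝ) < n := by exact_mod_cast hn
  cases r with
  | increasing => simp [Regime.spacing, Regime.gain]
  | fixed =>
    simp only [Regime.spacing, Regime.gain]
    refine ⟨by positivity, Real.rpow_pos_of_pos hn' _, ?_⟩
    rw [← Real.mul_rpow hn'.le (by positivity), mul_one_div_cancel hn'.ne', Real.one_rpow]

theorem hasGaussianLaw_sum_normDiff (hφ₂ : 0 < φ₂) (hk : φ₂ < k + 1) (hm : k + 1 ≤ m)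
    (hX : IsGaussianIRF k (powerLawGC φ₁ φ₂) X P) (r : Regime) {n : ℕ} (hn : 0 < n)
    (e : ι → Fin 2 × (ℕ × ℕ)) (v : ι → ℝ) :
    HasGaussianLaw (fun ω => ∑ i, v i * normDiff φ₂ m X r n (e i) ω) P ∧
    ∫ ω, ∑ i, v i * normDiff φ₂ m X r n (e i) ω ∂P = 0 ∧
    variance (fun ω => ∑ i, v i * normDiff φ₂ m X r n (e i) ω) P =
      v ⬝ᵥ diffCovMatrix φ₁ φ₂ m e *ᵥ v := by
  obtain ⟨hδ, hg, hgδ⟩ := gain_mul_spacing_rpow (φ₂ := φ₂) r hn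
  obtain ⟨h1, h2⟩ := hasGaussianLaw_sum_bilinearDiff hm hX r n e v
  have h3 := variance_sum_bilinearDiff hφ₂ hk hm hX r n hδ e v
  have he : (fun ω => ∑ i, v i * normDiff φ₂ m X r n (e i) ω) = fun ω => √(r.gain φ₂ n) *
      ∑ i, v i * bilinearDiff m ((e i).1.val + 1) (sample X r n ω) (e i).2 := by
    ext ω
    rw [Finset.mul_sum]
    exact Finset.sum_congr rfl fun i _ => by rw [normDiff]; ring
  rw [he]
  refine ⟨h1.fun_smul (√(r.gain φ₂ n)), ?_, ?_⟩
  · rw [integral_const_mul, h2, mul_zero]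
  · rw [variance_const_mul, h3, Real.sq_sqrt hg.le, ← mul_assoc, hgδ, one_mul,
      dotProduct_diffCovMatrix_mulVec]

/-- The quadratic form is a variance. The matrix involves neither regime nor `n`, so the increasing
regime with `n = 1` serves as witness. -/
theorem posSemidef_diffCovMatrix (hφ₂ : 0 < φ₂) (hk : φ₂ < k + 1) (hm : k + 1 ≤ m)
    (hX : IsGaussianIRF k (powerLawGC φ₁ φ₂) X P) (e : ι → Fin 2 × (ℕ × ℕ)) :
    (diffCovMatrix φ₁ φ₂ m e).PosSemidef := by
  refine Matrix.PosSemidef.of_dotProduct_mulVec_nonneg ?_ fun v => ?_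
  · ext i j
    simp only [diffCovMatrix, Matrix.conjTranspose_apply, Matrix.of_apply, star_trivial]
    exact diffCov_symm _ _
  · rw [star_trivial,
      ← (hasGaussianLaw_sum_normDiff hφ₂ hk hm hX .increasing one_pos e v).2.2]
    exact variance_nonneg _ _

theorem aemeasurable_normDiff {K : Plane → ℝ} (hX : IsGaussianIRF k K X P) (r : Regime) (n : ℕ)
    (i : Fin 2 × (ℕ × ℕ)) : AEMeasurable (normDiff φ₂ m X r n i) P := by
  unfold normDiff bilinearDiff sample
  exact (Finset.aemeasurable_fun_sum _ fun a _ => (hX.aemeasurable _).const_mul _).const_mul _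

/-- Cramér–Wold: the characteristic function of the vector at `v` is that of the scalar combination
at 1, which is Gaussian with known mean and variance. -/
theorem hasLaw_normDiff [DecidableEq ι] [IsProbabilityMeasure P] (hφ₂ : 0 < φ₂)
    (hk : φ₂ < k + 1) (hm : k + 1 ≤ m)
    (hX : IsGaussianIRF k (powerLawGC φ₁ φ₂) X P) (r : Regime) {n : ℕ} (hn : 0 < n)
    (e : ι → Fin 2 × (ℕ × ℕ)) :
    HasLaw (fun ω => WithLp.toLp 2 fun i => normDiff φ₂ m X r n (e i) ω)
      (multivariateGaussian 0 (diffCovMatrix φ₁ φ₂ m e)) P := by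
  have hmeas : AEMeasurable (fun ω => WithLp.toLp 2 fun i => normDiff φ₂ m X r n (e i) ω) P :=
    (WithLp.measurable_toLp 2 _).comp_aemeasurable
      (aemeasurable_pi_lambda _ fun i => aemeasurable_normDiff hX r n (e i))
  refine ⟨hmeas, ?_⟩
  have := Measure.isProbabilityMeasure_map hmeas
  refine Measure.ext_of_charFun ?_
  ext v
  obtain ⟨h1, h2, h3⟩ := hasGaussianLaw_sum_normDiff hφ₂ hk hm hX r hn e v.ofLp
  rw [charFun_multivariateGaussian (posSemidef_diffCovMatrix hφ₂ hk hm hX e), charFun_apply,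
    integral_map hmeas (by fun_prop)]
  have h4 : ∀ ω, inner ℝ (WithLp.toLp 2 fun i => normDiff φ₂ m X r n (e i) ω) v =
      ∑ i, v i * normDiff φ₂ m X r n (e i) ω := by
    intro ω
    simp [PiLp.inner_apply]
  simp_rw [h4]
  have h5 : charFun (P.map fun ω => ∑ i, v i * normDiff φ₂ m X r n (e i) ω) 1 =
      ∫ ω, Complex.exp ((∑ i, v i * normDiff φ₂ m X r n (e i) ω : ℝ) * Complex.I) ∂P := by
    rw [charFun_apply_real, integral_map h1.aemeasurable (by fun_prop)]
    simp
  rw [← h5, h1.map_eq_gaussianReal, charFun_gaussianReal, h2, h3]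
  have h6 : 0 ≤ v.ofLp ⬝ᵥ diffCovMatrix φ₁ φ₂ m e *ᵥ v.ofLp := by
    rw [← h3]; exact variance_nonneg _ _
  simp [h6]

theorem integral_sq_norm_sum_latChar {h : ι → ℤ × ℤ} (hh : Function.Injective h) (v : ι → ℝ) :
    ∫ ξ in torus, ‖∑ i, (v i : ℂ) * latChar (h i) ξ‖ ^ 2 = (2 * Real.pi) ^ 2 * ∑ i, v i ^ 2 := by
  have hint : ∀ g : ℤ × ℤ, Integrable (latChar g) (volume.restrict torus) := fun g =>
    Integrable.of_bound (measurable_latChar g).aestronglyMeasurable 1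
      (Eventually.of_forall fun ξ => (norm_latChar g ξ).le)
  have h1 : ∀ ξ, ((‖∑ i, (v i : ℂ) * latChar (h i) ξ‖ ^ 2 : ℝ) : ℂ) =
      ∑ i, ∑ j, ((v i * v j : ℝ) : ℂ) * latChar (h i - h j) ξ := by
    intro ξ
    rw [Complex.ofReal_pow, ← Complex.mul_conj', map_sum, Finset.sum_mul_sum]
    refine Finset.sum_congr rfl fun i _ => Finset.sum_congr rfl fun j _ => ?_
    rw [map_mul, Complex.conj_ofReal, conj_latChar, sub_eq_add_neg, latChar_add]
    push_cast; ring
  have h2 : ((∫ ξ in torus, ‖∑ i, (v i : ℂ) * latChar (h i) ξ‖ ^ 2 : ℝ) : ℂ) =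
      (((2 * Real.pi) ^ 2 * ∑ i, v i ^ 2 : ℝ) : ℂ) := by
    rw [← integral_complex_ofReal]
    simp_rw [h1]
    rw [integral_finsetSum _ fun i _ => integrable_finsetSum _ fun j _ => (hint _).const_mul _]
    simp_rw [integral_finsetSum _ fun j _ => (hint _).const_mul _, integral_const_mul]
    push_cast
    rw [Finset.mul_sum]
    refine Finset.sum_congr rfl fun i _ => ?_
    rw [Finset.sum_eq_single i (fun j _ hj => ?_) (by simp), sub_self, integral_latChar,
      if_pos rfl]
    · ring
    · rw [integral_latChar, if_neg (by simpa [sub_eq_zero] using hh.ne hj.symm), mul_zero]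
  exact_mod_cast h2

/-- The covariance matrices of the differences are uniformly bounded, because the filtered
spectral density is. -/
theorem exists_diffCovMatrix_le (hφ₁ : 0 < φ₁) (hφ₂ : 0 < φ₂) (hk : φ₂ < k + 1)
    (hm : k + 1 ≤ m) :
    ∃ L, 0 ≤ L ∧ ∀ {ι : Type} [Fintype ι] (e : ι → Fin 2 × (ℕ × ℕ)), Function.Injective e →
      ∀ v : ι → ℝ, v ⬝ᵥ diffCovMatrix φ₁ φ₂ m e *ᵥ v ≤ L * (v ⬝ᵥ v) := by
  have hkm : (k : ℝ) + 1 ≤ m := by exact_mod_cast hm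
  obtain ⟨M, hM0, hM⟩ := exists_filteredDensity_le hφ₁ hφ₂ (m := m) (by linarith) (by omega)
  refine ⟨2 * (16 ^ m * M), by positivity, ?_⟩
  intro ι _ e he v
  classical
  have hlat := measurable_latDensity hφ₁ hφ₂
  have hcint : ∀ (g : ℤ × ℤ) (l l' : Fin 2), Integrable
      (fun ξ => latChar g ξ * crossDensity φ₁ φ₂ m l l' ξ) (volume.restrict torus) := by
    intro g l l'
    refine Integrable.of_bound (C := 16 ^ m * M) ((measurable_latChar g).mul
      (measurable_crossDensity hφ₁ hφ₂ m l l')).aestronglyMeasurable ?_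
    refine (ae_restrict_iff' measurableSet_torus).2 (Eventually.of_forall fun ξ hξ => ?_)
    rw [norm_mul, norm_latChar, one_mul]
    exact (norm_crossDensity_le hφ₁ hφ₂ m l l' ξ).trans (by gcongr; exact hM ξ hξ)
  -- The combination is split by step. Within one step the positions are distinct, so the characters
  -- are orthogonal and `∫ ‖p l‖²` is a sum of squares. Across steps positions may coincide; `‖x +
  -- y‖² ≤ 2‖x‖² + 2‖y‖²` separates them and is the origin of the factor 2 in the bound.
  set p : Fin 2 → Plane → ℂ := fun l ξ =>
    ∑ i : {i // (e i).1 = l}, (v i : ℂ) * latChar (toLat (e i).2) ξ with hp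
  set q : Plane → ℂ := fun ξ => ∑ l, p l ξ * stepFilter m l ξ with hq
  have hq' : ∀ ξ, q ξ = ∑ i, (v i : ℂ) * latChar (toLat (e i).2) ξ * stepFilter m (e i).1 ξ := by
    intro ξ
    rw [hq, ← Fintype.sum_fiberwise (fun i => (e i).1)]
    refine Finset.sum_congr rfl fun l _ => ?_
    rw [hp, Finset.sum_mul]
    refine Finset.sum_congr rfl fun i _ => ?_
    rw [i.2]
  have h1 : ((v ⬝ᵥ diffCovMatrix φ₁ φ₂ m e *ᵥ v : ℝ) : ℂ) =
      ((((2 * Real.pi) ^ 2)⁻¹ * ∫ ξ in torus, ‖q ξ‖ ^ 2 * latDensity φ₁ φ₂ ξ : ℝ) : ℂ) := by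
    have h2 : ∀ ξ, ((‖q ξ‖ ^ 2 * latDensity φ₁ φ₂ ξ : ℝ) : ℂ) = ∑ i, ∑ j, ((v i * v j : ℝ) : ℂ) *
        (latChar (toLat (e i).2 - toLat (e j).2) ξ *
          crossDensity φ₁ φ₂ m (e i).1 (e j).1 ξ) := by
      intro ξ
      rw [Complex.ofReal_mul, Complex.ofReal_pow, ← Complex.mul_conj', hq', map_sum,
        Finset.sum_mul_sum, Finset.sum_mul]
      refine Finset.sum_congr rfl fun i _ => ?_
      rw [Finset.sum_mul]
      refine Finset.sum_congr rfl fun j _ => ?_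
      rw [map_mul, map_mul, Complex.conj_ofReal, conj_latChar, sub_eq_add_neg, latChar_add,
        crossDensity]
      push_cast; ring
    rw [Complex.ofReal_mul, ← integral_complex_ofReal]
    simp_rw [h2]
    rw [integral_finsetSum _ fun i _ => integrable_finsetSum _ fun j _ => (hcint _ _ _).const_mul _]
    simp_rw [integral_finsetSum _ fun j _ => (hcint _ _ _).const_mul _, integral_const_mul,
      dotProduct_diffCovMatrix_mulVec, diffCov]
    push_cast
    rw [Finset.mul_sum]
    refine Finset.sum_congr rfl fun i _ => ?_
    rw [Finset.mul_sum]
    refine Finset.sum_congr rfl fun j _ => ?_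
    rw [latCov_eq_integral hφ₁ hφ₂ hk hm, Complex.real_smul]
    push_cast; ring
  have hpm : ∀ l, Measurable (p l) := fun l =>
    Finset.measurable_sum _ fun i _ => (measurable_latChar _).const_mul _
  have hpb : ∀ l ξ, ‖p l ξ‖ ≤ ∑ i : {i // (e i).1 = l}, |v i| := by
    intro l ξ
    refine (norm_sum_le _ _).trans (Finset.sum_le_sum fun i _ => ?_)
    rw [norm_mul, norm_latChar, mul_one, Complex.norm_real, Real.norm_eq_abs]
  have hpint : ∀ l, Integrable (fun ξ => ‖p l ξ‖ ^ 2) (volume.restrict torus) := by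
    intro l
    refine Integrable.of_bound (C := (∑ i : {i // (e i).1 = l}, |v i|) ^ 2)
      ((hpm l).norm.pow_const 2).aestronglyMeasurable (Eventually.of_forall fun ξ => ?_)
    rw [norm_pow, norm_norm]
    gcongr
    exact hpb l ξ
  have hbound : ∀ ξ ∈ torus, ‖q ξ‖ ^ 2 * latDensity φ₁ φ₂ ξ ≤
      ∑ l, 2 * (16 ^ m * M) * ‖p l ξ‖ ^ 2 := by
    intro ξ hξ
    have h0 := latDensity_nonneg hφ₁ hφ₂ ξ
    have h3 : ∀ l, ‖stepFilter m l ξ‖ ^ 2 * latDensity φ₁ φ₂ ξ ≤ 16 ^ m * M := by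
      intro l
      rw [norm_stepFilter_sq, mul_assoc]
      exact mul_le_mul (stepSymbol_le _ _ _) (hM ξ hξ) (filteredDensity_nonneg hφ₁ hφ₂ m ξ)
        (by positivity)
    have h4 : ‖q ξ‖ ^ 2 ≤ ∑ l, 2 * (‖p l ξ‖ ^ 2 * ‖stepFilter m l ξ‖ ^ 2) := by
      rw [hq]
      simp only [Fin.sum_univ_two]
      have := norm_add_le (p 0 ξ * stepFilter m 0 ξ) (p 1 ξ * stepFilter m 1 ξ)
      rw [norm_mul, norm_mul] at this
      have h5 := pow_le_pow_left₀ (norm_nonneg _) this 2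
      nlinarith [sq_nonneg (‖p 0 ξ‖ * ‖stepFilter m 0 ξ‖ - ‖p 1 ξ‖ * ‖stepFilter m 1 ξ‖)]
    calc _ ≤ (∑ l, 2 * (‖p l ξ‖ ^ 2 * ‖stepFilter m l ξ‖ ^ 2)) * latDensity φ₁ φ₂ ξ := by gcongr
      _ = ∑ l, 2 * (‖stepFilter m l ξ‖ ^ 2 * latDensity φ₁ φ₂ ξ) * ‖p l ξ‖ ^ 2 := by
          rw [Finset.sum_mul]; exact Finset.sum_congr rfl fun l _ => by ring
      _ ≤ _ := Finset.sum_le_sum fun l _ => mul_le_mul_of_nonneg_right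
          (mul_le_mul_of_nonneg_left (h3 l) zero_le_two) (sq_nonneg _)
  have h1' := Complex.ofReal_injective h1
  have hpval : ∀ l, ∫ ξ in torus, ‖p l ξ‖ ^ 2 =
      (2 * Real.pi) ^ 2 * ∑ i : {i // (e i).1 = l}, v i ^ 2 := by
    intro l
    refine integral_sq_norm_sum_latChar (h := fun i : {i // (e i).1 = l} => toLat (e i).2)
      (fun i j hij => ?_) (fun i => v i)
    have h6 : (e i).2 = (e j).2 := by
      simpa [toLat, Prod.ext_iff] using hij
    exact Subtype.ext (he (Prod.ext (i.2.trans j.2.symm) h6))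
  have hπ : (0 : ℝ) < (2 * Real.pi) ^ 2 := by positivity
  rw [h1']
  calc _ ≤ ((2 * Real.pi) ^ 2)⁻¹ * ∫ ξ in torus, ∑ l, 2 * (16 ^ m * M) * ‖p l ξ‖ ^ 2 := by
        refine mul_le_mul_of_nonneg_left (integral_mono_of_nonneg (Eventually.of_forall fun ξ =>
          mul_nonneg (sq_nonneg _) (latDensity_nonneg hφ₁ hφ₂ ξ))
          (integrable_finsetSum _ fun l _ => (hpint l).const_mul _)
          ((ae_restrict_iff' measurableSet_torus).2 (Eventually.of_forall hbound)))
          (by positivity)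
    _ = 2 * (16 ^ m * M) * ∑ l, ∑ i : {i // (e i).1 = l}, v i ^ 2 := by
        rw [integral_finsetSum _ fun l _ => (hpint l).const_mul _]
        simp_rw [integral_const_mul, hpval, Finset.mul_sum]
        refine Finset.sum_congr rfl fun l _ => Finset.sum_congr rfl fun i _ => ?_
        field_simp
    _ = _ := by
        rw [Fintype.sum_fiberwise (fun i => (e i).1) (fun i => v i ^ 2), dotProduct]
        simp_rw [sq]

end Differences

/-! ### Weights on the rows and their energies -/

section Energy

variable {φ₁ φ₂ : ℝ} {m k : ℕ}

theorem toLat_injective : Function.Injective toLat := fun s t h => by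
  simpa [toLat, Prod.ext_iff] using h

theorem card_Lam (n : ℕ) : (Lam n).card = n ^ 2 := by
  simp [Lam, sq]

/-- The index set of the bilinear differences of both steps with base point in the window. -/
def rowIndex (n : ℕ) : Finset (Fin 2 × (ℕ × ℕ)) := Finset.univ ×ˢ Lam n

/-- The bilinear form with kernel the squared covariances of the differences. -/
def energy (φ₁ φ₂ : ℝ) (m n : ℕ) (u v : Fin 2 × (ℕ × ℕ) → ℝ) : ℝ :=
  ∑ i ∈ rowIndex n, ∑ j ∈ rowIndex n, u i * v j * diffCov φ₁ φ₂ m i j ^ 2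

/-- For a fixed row and step the lags are pairwise distinct, so each sum is part of the convergent
series of `hasSum_latCov_sq`. -/
theorem exists_sum_diffCov_sq_le (hφ₁ : 0 < φ₁) (hφ₂ : 0 < φ₂) (hk : φ₂ < k + 1)
    (hm : k + 1 ≤ m) :
    ∃ B, 0 ≤ B ∧ ∀ n i, ∑ j ∈ rowIndex n, diffCov φ₁ φ₂ m i j ^ 2 ≤ B := by
  have hs := fun l l' => hasSum_latCov_sq hφ₁ hφ₂ hk hm l l'
  have h0 : ∀ l l', 0 ≤ limitCov φ₁ φ₂ m l l' / 2 := fun l l' =>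
    (hs l l').nonneg fun _ => sq_nonneg _
  refine ⟨∑ l, ∑ l', limitCov φ₁ φ₂ m l l' / 2,
    Finset.sum_nonneg fun l _ => Finset.sum_nonneg fun l' _ => h0 l l', fun n i => ?_⟩
  refine le_trans ?_ (Finset.single_le_sum (f := fun l => ∑ l', limitCov φ₁ φ₂ m l l' / 2)
    (fun l _ => Finset.sum_nonneg fun l' _ => h0 l l') (Finset.mem_univ i.1))
  rw [rowIndex, Finset.sum_product]
  refine Finset.sum_le_sum fun l' _ => ?_
  have hinj : Function.Injective fun t => toLat i.2 - toLat t := fun s t h =>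
    toLat_injective (sub_right_injective h)
  have h1 : ∑ t ∈ Lam n, diffCov φ₁ φ₂ m i (l', t) ^ 2 =
      ∑ h ∈ (Lam n).map ⟨_, hinj⟩, latCov φ₁ φ₂ m i.1 l' h ^ 2 := by
    rw [Finset.sum_map]; rfl
  rw [h1]
  exact sum_le_hasSum _ (fun _ _ => sq_nonneg _) (hs i.1 l')

/-- Schur test: Cauchy–Schwarz with the nonnegative kernel `diffCov²` split evenly between `u` and
`v`, then the bound on row sums, which by symmetry also bounds column sums. -/
theorem energy_sq_le {B : ℝ} {n : ℕ} (hB : ∀ i, ∑ j ∈ rowIndex n, diffCov φ₁ φ₂ m i j ^ 2 ≤ B)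
    (u v : Fin 2 × (ℕ × ℕ) → ℝ) :
    energy φ₁ φ₂ m n u v ^ 2 ≤
      (B * ∑ i ∈ rowIndex n, u i ^ 2) * (B * ∑ i ∈ rowIndex n, v i ^ 2) := by
  have hB0 : 0 ≤ B := (Finset.sum_nonneg fun _ _ => sq_nonneg _).trans (hB (0, 0))
  have h1 : ∀ u : Fin 2 × (ℕ × ℕ) → ℝ, ∑ i ∈ rowIndex n, ∑ j ∈ rowIndex n,
      u i ^ 2 * diffCov φ₁ φ₂ m i j ^ 2 ≤ B * ∑ i ∈ rowIndex n, u i ^ 2 := by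
    intro u
    rw [Finset.mul_sum]
    refine Finset.sum_le_sum fun i _ => ?_
    rw [← Finset.mul_sum, mul_comm]
    exact mul_le_mul_of_nonneg_right (hB i) (sq_nonneg _)
  have h2 : ∑ i ∈ rowIndex n, ∑ j ∈ rowIndex n,
      v j ^ 2 * diffCov φ₁ φ₂ m i j ^ 2 ≤ B * ∑ i ∈ rowIndex n, v i ^ 2 := by
    rw [Finset.sum_comm]
    simp_rw [fun i j => diffCov_symm (φ₁ := φ₁) (φ₂ := φ₂) (m := m) i j]
    exact h1 v
  have h3 := Finset.sum_sq_le_sum_mul_sum_of_sq_le_mul (rowIndex n ×ˢ rowIndex n)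
    (r := fun p => u p.1 * v p.2 * diffCov φ₁ φ₂ m p.1 p.2 ^ 2)
    (f := fun p => u p.1 ^ 2 * diffCov φ₁ φ₂ m p.1 p.2 ^ 2)
    (g := fun p => v p.2 ^ 2 * diffCov φ₁ φ₂ m p.1 p.2 ^ 2)
    (fun _ _ => by positivity) (fun _ _ => by positivity) (fun _ _ => le_of_eq (by ring))
  rw [Finset.sum_product, Finset.sum_product, Finset.sum_product] at h3
  exact h3.trans (mul_le_mul (h1 u) h2
    (Finset.sum_nonneg fun _ _ => Finset.sum_nonneg fun _ _ => by positivity)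
    (mul_nonneg hB0 (Finset.sum_nonneg fun _ _ => sq_nonneg _)))

theorem energy_symm (n : ℕ) (u v : Fin 2 × (ℕ × ℕ) → ℝ) :
    energy φ₁ φ₂ m n u v = energy φ₁ φ₂ m n v u := by
  rw [energy, energy, Finset.sum_comm]
  refine Finset.sum_congr rfl fun i _ => Finset.sum_congr rfl fun j _ => ?_
  rw [diffCov_symm]; ring

theorem energy_sub_add (n : ℕ) (u v : Fin 2 × (ℕ × ℕ) → ℝ) :
    energy φ₁ φ₂ m n (u - v) (u + v) = energy φ₁ φ₂ m n u u - energy φ₁ φ₂ m n v v := by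
  have h : energy φ₁ φ₂ m n (u - v) (u + v) = energy φ₁ φ₂ m n u u + energy φ₁ φ₂ m n u v -
      energy φ₁ φ₂ m n v u - energy φ₁ φ₂ m n v v := by
    simp only [energy, ← Finset.sum_add_distrib, ← Finset.sum_sub_distrib, Pi.sub_apply,
      Pi.add_apply]
    exact Finset.sum_congr rfl fun i _ => Finset.sum_congr rfl fun j _ => by ring
  rw [h, energy_symm n u v]; ring

/-- The weights `n τ_l / |R_l|` of the squared differences at the positions in `R_l`. -/
def rowWeight (n : ℕ) (τ : Fin 2 → ℝ) (R : Fin 2 → Finset (ℕ × ℕ)) (i : Fin 2 × (ℕ × ℕ)) : ℝ :=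
  if i.2 ∈ R i.1 then n * (τ i.1 * ((R i.1).card : ℝ)⁻¹) else 0

theorem sum_rowWeight_mul {n : ℕ} (τ : Fin 2 → ℝ) {R : Fin 2 → Finset (ℕ × ℕ)}
    (hR : ∀ l, R l ⊆ Lam n) (F : Fin 2 × (ℕ × ℕ) → ℝ) :
    ∑ i ∈ rowIndex n, rowWeight n τ R i * F i =
      n * ∑ l, τ l * (((R l).card : ℝ)⁻¹ * ∑ t ∈ R l, F (l, t)) := by
  rw [rowIndex, Finset.sum_product, Finset.mul_sum]
  refine Finset.sum_congr rfl fun l _ => ?_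
  simp only [rowWeight, ite_mul, zero_mul, Finset.sum_ite_mem]
  rw [Finset.inter_eq_right.2 (hR l), ← Finset.mul_sum]
  ring

theorem sum_rowWeight_sq {n : ℕ} (τ : Fin 2 → ℝ) {R : Fin 2 → Finset (ℕ × ℕ)}
    (hR : ∀ l, R l ⊆ Lam n) :
    ∑ i ∈ rowIndex n, rowWeight n τ R i ^ 2 =
      ∑ l, τ l ^ 2 * ((n : ℝ) ^ 2 / (R l).card) := by
  simp_rw [sq (rowWeight n τ R _)]
  rw [sum_rowWeight_mul τ hR, Finset.mul_sum]
  refine Finset.sum_congr rfl fun l _ => ?_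
  have h1 : ∀ t ∈ R l, rowWeight n τ R (l, t) = n * (τ l * ((R l).card : ℝ)⁻¹) := fun t ht => by
    rw [rowWeight, if_pos ht]
  rw [Finset.sum_congr rfl h1, Finset.sum_const, nsmul_eq_mul]
  rcases eq_or_ne ((R l).card : ℝ) 0 with h | h
  · simp [h]
  · field_simp

/-- Since `R l ⊆ S l`, the cross term equals the squared norm of the `S`-weights, so the square of
the difference telescopes. Nonemptiness is needed there: for an empty `R l` the cross term would be
0. -/
theorem sum_sq_rowWeight_sub {n : ℕ} (τ : Fin 2 → ℝ) {R S : Fin 2 → Finset (ℕ × ℕ)}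
    (hS : ∀ l, S l ⊆ Lam n) (hRS : ∀ l, R l ⊆ S l) (hR : ∀ l, (R l).Nonempty) :
    ∑ i ∈ rowIndex n, (rowWeight n τ R i - rowWeight n τ S i) ^ 2 =
      ∑ l, τ l ^ 2 * ((n : ℝ) ^ 2 / (R l).card - (n : ℝ) ^ 2 / (S l).card) := by
  have hRn : ∀ l, R l ⊆ Lam n := fun l => (hRS l).trans (hS l)
  have h1 : ∑ i ∈ rowIndex n, rowWeight n τ R i * rowWeight n τ S i =
      ∑ l, τ l ^ 2 * ((n : ℝ) ^ 2 / (S l).card) := by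
    rw [sum_rowWeight_mul τ hRn, Finset.mul_sum]
    refine Finset.sum_congr rfl fun l _ => ?_
    have h2 : ∀ t ∈ R l, rowWeight n τ S (l, t) = n * (τ l * ((S l).card : ℝ)⁻¹) :=
      fun t ht => by rw [rowWeight, if_pos (hRS l ht)]
    rw [Finset.sum_congr rfl h2, Finset.sum_const, nsmul_eq_mul]
    have : ((R l).card : ℝ) ≠ 0 := by exact_mod_cast (hR l).card_pos.ne'
    field_simp
  have h2 : ∀ i, (rowWeight n τ R i - rowWeight n τ S i) ^ 2 =
      rowWeight n τ R i ^ 2 - 2 * (rowWeight n τ R i * rowWeight n τ S i) +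
        rowWeight n τ S i ^ 2 := fun i => by ring
  simp_rw [h2]
  rw [Finset.sum_add_distrib, Finset.sum_sub_distrib, ← Finset.mul_sum, h1,
    sum_rowWeight_sq τ hRn, sum_rowWeight_sq τ hS, Finset.mul_sum, ← Finset.sum_sub_distrib,
    ← Finset.sum_add_distrib]
  exact Finset.sum_congr rfl fun l _ => by ring

/-! ### Counting positions -/

theorem allRows_subset (m j n : ℕ) : allRows m j n ⊆ Lam n := by
  intro t
  simp only [allRows, Lam, Finset.mem_product, Finset.mem_range]
  omega

theorem keptRows_subset (m j n : ℕ) (D : Finset (ℕ × ℕ)) :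
    keptRows m j n D ⊆ allRows m j n := Finset.filter_subset _ _

theorem tendsto_natCast_sub_div (a : ℕ) :
    Tendsto (fun n : ℕ => ((n - a : ℕ) : ℝ) / n) atTop (𝓝 1) := by
  have h := (tendsto_const_div_atTop_nhds_zero_nat (a : ℝ)).const_sub 1
  rw [sub_zero] at h
  refine h.congr' ?_
  filter_upwards [eventually_ge_atTop a, eventually_gt_atTop 0] with n hn hn0
  have : (n : ℝ) ≠ 0 := by positivity
  rw [Nat.cast_sub hn]
  field_simp

theorem tendsto_card_Lam_sub_div (a : ℕ) :
    Tendsto (fun n : ℕ => ((Lam (n - a)).card : ℝ) / (n : ℝ) ^ 2) atTop (𝓝 1) := by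
  have h := (tendsto_natCast_sub_div a).pow 2
  rw [one_pow] at h
  refine h.congr fun n => ?_
  rw [card_Lam]; push_cast; rw [div_pow]

/-- A lost position is `d - j • a` for some deleted site `d` and stencil offset `a`, so each deleted
site accounts for at most `(m+1)²` of them. The truncated subtraction is exact because `d = t + j •
a`. -/
theorem card_allRows_le (m j n : ℕ) (D : Finset (ℕ × ℕ)) :
    (allRows m j n).card ≤ (keptRows m j n D).card + (m + 1) ^ 2 * D.card := by
  classical
  have h : allRows m j n ⊆ keptRows m j n D ∪
      (Lam (m + 1) ×ˢ D).image fun p => p.2 - j • p.1 := by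
    intro t ht
    rw [Finset.mem_union]
    by_cases h : ∀ a ∈ Lam (m + 1), t + j • a ∉ D
    · exact Or.inl (Finset.mem_filter.2 ⟨ht, h⟩)
    · push Not at h
      obtain ⟨a, ha, haD⟩ := h
      exact Or.inr (Finset.mem_image.2 ⟨(a, t + j • a), Finset.mk_mem_product ha haD,
        add_tsub_cancel_right t (j • a)⟩)
  refine (Finset.card_le_card h).trans ((Finset.card_union_le _ _).trans ?_)
  refine Nat.add_le_add_left (Finset.card_image_le.trans ?_) _
  rw [Finset.card_product, card_Lam]

theorem tendsto_card_allRows (m j : ℕ) :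
    Tendsto (fun n : ℕ => (n : ℝ) ^ 2 / (allRows m j n).card) atTop (𝓝 1) := by
  have h := (tendsto_card_Lam_sub_div (j * m)).inv₀ one_ne_zero
  rw [inv_one] at h
  exact h.congr fun n => inv_div _ _

variable {D : ℕ → Finset (ℕ × ℕ)}

theorem tendsto_card_div_sq
    (hcard : (fun n => ((D n).card : ℝ)) =o[atTop] fun n : ℕ => √((n : ℝ) ^ 2)) :
    Tendsto (fun n : ℕ => ((D n).card : ℝ) / (n : ℝ) ^ 2) atTop (𝓝 0) := by
  have h1 : Tendsto (fun n : ℕ => ((D n).card : ℝ) / n) atTop (𝓝 0) := by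
    simpa [Real.sqrt_sq] using hcard.tendsto_div_nhds_zero
  have h2 := h1.mul tendsto_inv_atTop_nhds_zero_nat
  rw [zero_mul] at h2
  refine h2.congr fun n => ?_
  rw [sq, div_mul_eq_div_mul_one_div, one_div]

theorem tendsto_card_keptRows
    (hcard : (fun n => ((D n).card : ℝ)) =o[atTop] fun n : ℕ => √((n : ℝ) ^ 2)) (m j : ℕ) :
    Tendsto (fun n : ℕ => (n : ℝ) ^ 2 / (keptRows m j n (D n)).card) atTop (𝓝 1) := by
  have h1 : Tendsto (fun n : ℕ => ((keptRows m j n (D n)).card : ℝ) / (n : ℝ) ^ 2) atTop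
      (𝓝 1) := by
    have h2 := (tendsto_card_Lam_sub_div (j * m)).sub
      ((tendsto_card_div_sq hcard).const_mul (((m + 1) ^ 2 : ℕ) : ℝ))
    rw [mul_zero, sub_zero] at h2
    refine tendsto_of_tendsto_of_tendsto_of_le_of_le h2 (tendsto_card_Lam_sub_div (j * m))
      (fun n => ?_) (fun n => ?_)
    · have h3 : ((allRows m j n).card : ℝ) ≤
          (keptRows m j n (D n)).card + ((m + 1) ^ 2 : ℕ) * (D n).card := by
        exact_mod_cast card_allRows_le m j n (D n)
      simp only [← mul_div_assoc, ← sub_div]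
      refine div_le_div_of_nonneg_right ?_ (sq_nonneg _)
      rw [sub_le_iff_le_add]
      exact h3
    · refine div_le_div_of_nonneg_right ?_ (sq_nonneg _)
      exact Nat.cast_le.2 (Finset.card_le_card (keptRows_subset m j n (D n)))
  have h := h1.inv₀ one_ne_zero
  rw [inv_one] at h
  exact h.congr fun n => inv_div _ _

/-- An empty set would make the ratio `n² / 0 = 0`, whereas the ratio tends to 1. -/
theorem eventually_nonempty_keptRows
    (hcard : (fun n => ((D n).card : ℝ)) =o[atTop] fun n : ℕ => √((n : ℝ) ^ 2)) (m j : ℕ) :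
    ∀ᶠ n in atTop, (keptRows m j n (D n)).Nonempty := by
  filter_upwards [(tendsto_card_keptRows hcard m j).eventually_ne one_ne_zero] with n hn
  rw [Finset.nonempty_iff_ne_empty]
  rintro h
  simp [h] at hn

/-! ### Limits of the energies -/

theorem card_filter_sub_le (A B : Finset (ℕ × ℕ)) (h : ℤ × ℤ) :
    ((A ×ˢ B).filter fun p => toLat p.1 - toLat p.2 = h).card ≤ B.card := by
  refine Finset.card_le_card_of_injOn Prod.snd (fun p hp => ?_) fun p hp q hq hpq => ?_
  · rw [Finset.mem_coe, Finset.mem_filter, Finset.mem_product] at hp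
    exact hp.1.2
  · rw [Finset.mem_coe, Finset.mem_filter] at hp hq
    refine Prod.ext (toLat_injective ?_) hpq
    rw [← sub_left_inj (a := toLat p.2), hp.2, hpq, hq.2]

/-- Injection `t ↦ (t + H + h, t + H)` with `H = |h₁| + |h₂|`: the shift by `H` keeps the first
entry nonnegative, and the margin `a + b + 2H` keeps both entries inside their windows. -/
theorem le_card_filter_sub (n a b : ℕ) (h : ℤ × ℤ) :
    (Lam (n - (a + b + 2 * (h.1.natAbs + h.2.natAbs)))).card ≤
      ((Lam (n - a) ×ˢ Lam (n - b)).filter fun p => toLat p.1 - toLat p.2 = h).card := by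
  set H := h.1.natAbs + h.2.natAbs with hH
  refine Finset.card_le_card_of_injOn
    (fun t => (((t.1 + H + h.1 : ℤ).toNat, (t.2 + H + h.2 : ℤ).toNat), (t.1 + H, t.2 + H)))
    (fun t ht => ?_) fun s _ t _ hst => ?_
  · simp only [Finset.mem_coe, Lam, Finset.mem_product, Finset.mem_range] at ht
    refine Finset.mem_coe.2 (Finset.mem_filter.2 ⟨Finset.mem_product.2
      ⟨Finset.mem_product.2 ⟨Finset.mem_range.2 ?_, Finset.mem_range.2 ?_⟩,
        Finset.mem_product.2 ⟨Finset.mem_range.2 ?_, Finset.mem_range.2 ?_⟩⟩, ?_⟩)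
    · dsimp only; omega
    · dsimp only; omega
    · dsimp only; omega
    · dsimp only; omega
    · ext <;> simp only [toLat, Prod.fst_sub, Prod.snd_sub] <;> omega
  · simp only [Prod.mk.injEq] at hst
    ext <;> omega

/-- The double sum is regrouped by lag. The number of pairs with a given lag, divided by `n²`, is at
most 1 and tends to 1, so dominated convergence with majorant `c` applies. -/
theorem tendsto_sum_lag_div {c : ℤ × ℤ → ℝ} {S : ℝ} (hc : HasSum c S) (hc0 : ∀ h, 0 ≤ c h)
    (a b : ℕ) :
    Tendsto (fun n : ℕ => ((n : ℝ) ^ 2)⁻¹ *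
      ∑ s ∈ Lam (n - a), ∑ t ∈ Lam (n - b), c (toLat s - toLat t)) atTop (𝓝 S) := by
  classical
  set N : ℕ → ℤ × ℤ → ℕ := fun n h =>
    ((Lam (n - a) ×ˢ Lam (n - b)).filter fun p => toLat p.1 - toLat p.2 = h).card with hN
  have h1 : ∀ n : ℕ, ((n : ℝ) ^ 2)⁻¹ *
      ∑ s ∈ Lam (n - a), ∑ t ∈ Lam (n - b), c (toLat s - toLat t) =
      ∑' h, (N n h : ℝ) / (n : ℝ) ^ 2 * c h := by
    intro n
    rw [← Finset.sum_product' (Lam (n - a)) (Lam (n - b)) fun s t => c (toLat s - toLat t),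
      Finset.sum_comp c (fun p : (ℕ × ℕ) × (ℕ × ℕ) => toLat p.1 - toLat p.2),
      tsum_eq_sum (s := (Lam (n - a) ×ˢ Lam (n - b)).image fun p => toLat p.1 - toLat p.2),
      Finset.mul_sum]
    · refine Finset.sum_congr rfl fun h _ => ?_
      rw [nsmul_eq_mul]; ring
    · intro h hh
      have : N n h = 0 := by
        rw [hN, Finset.card_eq_zero, Finset.filter_eq_empty_iff]
        exact fun p hp hph => hh (Finset.mem_image.2 ⟨p, hp, hph⟩)
      simp [this]
  simp_rw [h1]
  rw [← hc.tsum_eq]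
  have hle : ∀ n h, (N n h : ℝ) / (n : ℝ) ^ 2 ≤ 1 := by
    intro n h
    refine div_le_one_of_le₀ ?_ (sq_nonneg _)
    have h2 := card_filter_sub_le (Lam (n - a)) (Lam (n - b)) h
    rw [card_Lam] at h2
    have h3 : (n - b) ^ 2 ≤ n ^ 2 := Nat.pow_le_pow_left (Nat.sub_le _ _) 2
    exact_mod_cast h2.trans h3
  refine tendsto_tsum_of_dominated_convergence hc.summable (fun h => ?_)
    (Eventually.of_forall fun n h => ?_)
  · have h4 : Tendsto (fun n : ℕ => (N n h : ℝ) / (n : ℝ) ^ 2) atTop (𝓝 1) := by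
      refine tendsto_of_tendsto_of_tendsto_of_le_of_le (tendsto_card_Lam_sub_div
        (a + b + 2 * (h.1.natAbs + h.2.natAbs))) tendsto_const_nhds (fun n => ?_)
        (fun n => hle n h)
      refine div_le_div_of_nonneg_right ?_ (sq_nonneg _)
      exact Nat.cast_le.2 (le_card_filter_sub n a b h)
    simpa using h4.mul_const (c h)
  · rw [Real.norm_eq_abs, abs_of_nonneg (mul_nonneg (by positivity) (hc0 h))]
    exact mul_le_of_le_one_left (hc0 h) (hle n h)

/-- The positions of all differences of step `l + 1`. -/
def fullRows (m n : ℕ) (l : Fin 2) : Finset (ℕ × ℕ) := allRows m (l.val + 1) n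

/-- The positions of the differences of step `l + 1` that touch no deleted site. -/
def prunedRows (m n : ℕ) (D : Finset (ℕ × ℕ)) (l : Fin 2) : Finset (ℕ × ℕ) :=
  keptRows m (l.val + 1) n D

theorem fullRows_subset (m n : ℕ) (l : Fin 2) : fullRows m n l ⊆ Lam n := allRows_subset _ _ _

theorem prunedRows_subset (m n : ℕ) (D : Finset (ℕ × ℕ)) (l : Fin 2) :
    prunedRows m n D l ⊆ fullRows m n l := keptRows_subset _ _ _ _

theorem tendsto_energy_fullRows (hφ₁ : 0 < φ₁) (hφ₂ : 0 < φ₂) (hk : φ₂ < k + 1)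
    (hm : k + 1 ≤ m) (τ : Fin 2 → ℝ) :
    Tendsto (fun n => energy φ₁ φ₂ m n (rowWeight n τ (fullRows m n))
      (rowWeight n τ (fullRows m n))) atTop
      (𝓝 (∑ l, ∑ l', τ l * τ l' * (limitCov φ₁ φ₂ m l l' / 2))) := by
  -- The two weight factors `n / |R_l|` are traded for the ratios `n² / |R_l|`, which tend to 1, and
  -- a normalization `n⁻²` of the lag sum.
  have h1 : ∀ n : ℕ, energy φ₁ φ₂ m n (rowWeight n τ (fullRows m n))
      (rowWeight n τ (fullRows m n)) = ∑ l, ∑ l', τ l * τ l' *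
        ((n : ℝ) ^ 2 / (fullRows m n l).card * ((n : ℝ) ^ 2 / (fullRows m n l').card) *
          (((n : ℝ) ^ 2)⁻¹ * ∑ s ∈ fullRows m n l, ∑ t ∈ fullRows m n l',
            latCov φ₁ φ₂ m l l' (toLat s - toLat t) ^ 2)) := by
    intro n
    rcases Nat.eq_zero_or_pos n with rfl | hn
    · simp [energy, rowIndex, Lam]
    have hn' : (n : ℝ) ≠ 0 := by positivity
    simp_rw [energy, mul_assoc, ← Finset.mul_sum]
    rw [sum_rowWeight_mul τ (fullRows_subset m n)]
    simp_rw [sum_rowWeight_mul τ (fullRows_subset m n)]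
    rw [Finset.mul_sum]
    refine Finset.sum_congr rfl fun l _ => ?_
    rw [← Finset.mul_sum, Finset.sum_comm]
    simp_rw [← Finset.mul_sum]
    rw [mul_left_comm]
    congr 1
    rw [Finset.mul_sum, Finset.mul_sum, Finset.mul_sum]
    refine Finset.sum_congr rfl fun l' _ => ?_
    simp only [diffCov]
    field_simp
  simp_rw [h1]
  refine tendsto_finsetSum _ fun l _ => tendsto_finsetSum _ fun l' _ => ?_
  have h2 := ((tendsto_card_allRows m (l.val + 1)).mul (tendsto_card_allRows m (l'.val + 1))).mul
    (tendsto_sum_lag_div (hasSum_latCov_sq hφ₁ hφ₂ hk hm l l') (fun _ => sq_nonneg _)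
      ((l.val + 1) * m) ((l'.val + 1) * m))
  rw [one_mul, one_mul] at h2
  exact h2.const_mul _

theorem tendsto_sum_sq_rowWeight_sub
    (hcard : (fun n => ((D n).card : ℝ)) =o[atTop] fun n : ℕ => √((n : ℝ) ^ 2))
    (m : ℕ) (τ : Fin 2 → ℝ) :
    Tendsto (fun n => ∑ i ∈ rowIndex n, (rowWeight n τ (prunedRows m n (D n)) i -
      rowWeight n τ (fullRows m n) i) ^ 2) atTop (𝓝 0) := by
  have h1 : Tendsto (fun n : ℕ => ∑ l : Fin 2, τ l ^ 2 *
      ((n : ℝ) ^ 2 / (prunedRows m n (D n) l).card - (n : ℝ) ^ 2 / (fullRows m n l).card)) atTop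
      (𝓝 (∑ l : Fin 2, τ l ^ 2 * (1 - 1))) :=
    tendsto_finsetSum _ fun l _ => ((tendsto_card_keptRows hcard m _).sub
      (tendsto_card_allRows m _)).const_mul _
  simp only [sub_self, mul_zero, Finset.sum_const_zero] at h1
  refine h1.congr' ?_
  filter_upwards [eventually_all.2 fun l : Fin 2 =>
    eventually_nonempty_keptRows hcard m (l.val + 1)] with n hn
  exact (sum_sq_rowWeight_sub τ (fullRows_subset m n) (prunedRows_subset m n (D n)) hn).symm

theorem tendsto_sum_sq_rowWeight
    (hcard : (fun n => ((D n).card : ℝ)) =o[atTop] fun n : ℕ => √((n : ℝ) ^ 2))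
    (m : ℕ) (τ : Fin 2 → ℝ) :
    Tendsto (fun n => ∑ i ∈ rowIndex n, rowWeight n τ (prunedRows m n (D n)) i ^ 2) atTop
      (𝓝 (∑ l, τ l ^ 2)) ∧
    Tendsto (fun n => ∑ i ∈ rowIndex n, rowWeight n τ (fullRows m n) i ^ 2) atTop
      (𝓝 (∑ l, τ l ^ 2)) := by
  simp_rw [fun n => sum_rowWeight_sq τ (fullRows_subset m n),
    fun n => sum_rowWeight_sq τ fun l =>
      (prunedRows_subset m n (D n) l).trans (fullRows_subset m n l)]
  constructor
  · refine tendsto_finsetSum _ fun l _ => ?_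
    have h := (tendsto_card_keptRows hcard m (l.val + 1)).const_mul (τ l ^ 2)
    rw [mul_one] at h
    exact h
  · refine tendsto_finsetSum _ fun l _ => ?_
    have h := (tendsto_card_allRows m (l.val + 1)).const_mul (τ l ^ 2)
    rw [mul_one] at h
    exact h

theorem tendsto_energy_sub (hφ₁ : 0 < φ₁) (hφ₂ : 0 < φ₂) (hk : φ₂ < k + 1) (hm : k + 1 ≤ m)
    (hcard : (fun n => ((D n).card : ℝ)) =o[atTop] fun n : ℕ => √((n : ℝ) ^ 2))
    (τ : Fin 2 → ℝ) :
    Tendsto (fun n => energy φ₁ φ₂ m n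
      (rowWeight n τ (prunedRows m n (D n)) - rowWeight n τ (fullRows m n))
      (rowWeight n τ (prunedRows m n (D n)) - rowWeight n τ (fullRows m n))) atTop (𝓝 0) := by
  obtain ⟨B, -, hB⟩ := exists_sum_diffCov_sq_le hφ₁ hφ₂ hk hm
  have h1 := (tendsto_sum_sq_rowWeight_sub hcard m τ).const_mul B
  rw [mul_zero] at h1
  refine squeeze_zero_norm (fun n => ?_) h1
  rw [Real.norm_eq_abs]
  have h2 := energy_sq_le (hB n) (rowWeight n τ (prunedRows m n (D n)) -
    rowWeight n τ (fullRows m n)) (rowWeight n τ (prunedRows m n (D n)) -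
    rowWeight n τ (fullRows m n))
  rw [← sq] at h2
  exact abs_le_of_sq_le_sq h2 (mul_nonneg ((Finset.sum_nonneg fun _ _ => sq_nonneg _).trans
    (hB 0 (0, 0))) (Finset.sum_nonneg fun _ _ => sq_nonneg _))

/-- By polarization the two energies differ by `energy (u - v) (u + v)`. This is at most a constant
times `‖u - v‖ ‖u + v‖` in `ℓ²`, where the first norm tends to 0 and the second stays bounded. -/
theorem tendsto_energy_prunedRows (hφ₁ : 0 < φ₁) (hφ₂ : 0 < φ₂) (hk : φ₂ < k + 1)
    (hm : k + 1 ≤ m)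
    (hcard : (fun n => ((D n).card : ℝ)) =o[atTop] fun n : ℕ => √((n : ℝ) ^ 2))
    (τ : Fin 2 → ℝ) :
    Tendsto (fun n => energy φ₁ φ₂ m n (rowWeight n τ (prunedRows m n (D n)))
      (rowWeight n τ (prunedRows m n (D n)))) atTop
      (𝓝 (∑ l, ∑ l', τ l * τ l' * (limitCov φ₁ φ₂ m l l' / 2))) := by
  obtain ⟨B, hB0, hB⟩ := exists_sum_diffCov_sq_le hφ₁ hφ₂ hk hm
  obtain ⟨h1, h2⟩ := tendsto_sum_sq_rowWeight hcard m τ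
  have h3 := ((tendsto_sum_sq_rowWeight_sub hcard m τ).const_mul B).mul
    (((h1.add h2).const_mul 2).const_mul B)
  rw [mul_zero, zero_mul] at h3
  have h4 : Tendsto (fun n => energy φ₁ φ₂ m n
      (rowWeight n τ (prunedRows m n (D n)) - rowWeight n τ (fullRows m n))
      (rowWeight n τ (prunedRows m n (D n)) + rowWeight n τ (fullRows m n))) atTop (𝓝 0) := by
    have h5 := h3.sqrt
    rw [Real.sqrt_zero] at h5
    refine squeeze_zero_norm (fun n => ?_) h5
    refine Real.abs_le_sqrt ((energy_sq_le (hB n) _ _).trans ?_)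
    refine mul_le_mul_of_nonneg_left (mul_le_mul_of_nonneg_left ?_ hB0)
      (mul_nonneg hB0 (Finset.sum_nonneg fun _ _ => sq_nonneg _))
    rw [← Finset.sum_add_distrib, Finset.mul_sum]
    exact Finset.sum_le_sum fun i _ => add_sq_le
  have h6 := (tendsto_energy_fullRows hφ₁ hφ₂ hk hm τ).add h4
  rw [add_zero] at h6
  refine h6.congr fun n => ?_
  rw [energy_sub_add]; ring

end Energy

/-! ### The centered quadratic statistics -/

section Statistic

variable {φ₁ φ₂ : ℝ} {m k : ℕ} {Ω : Type*} {X : Plane → Ω → ℝ}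

/-- The centered weighted sum of squared normalized differences. -/
def statistic (φ₁ φ₂ : ℝ) (m : ℕ) (X : Plane → Ω → ℝ) (r : Regime) (n : ℕ)
    (u : Fin 2 × (ℕ × ℕ) → ℝ) (ω : Ω) : ℝ :=
  ∑ i ∈ rowIndex n, u i * (normDiff φ₂ m X r n i ω ^ 2 - diffCov φ₁ φ₂ m i i)

theorem statistic_eq_sum_coe (r : Regime) (n : ℕ) (u : Fin 2 × (ℕ × ℕ) → ℝ) (ω : Ω) :
    statistic φ₁ φ₂ m X r n u ω = ∑ i : rowIndex n, u i * (normDiff φ₂ m X r n i ω ^ 2 -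
      diffCovMatrix φ₁ φ₂ m (Subtype.val : rowIndex n → _) i i) :=
  (Finset.sum_coe_sort (rowIndex n) fun i =>
    u i * (normDiff φ₂ m X r n i ω ^ 2 - diffCov φ₁ φ₂ m i i)).symm

theorem energy_eq_sum_coe (n : ℕ) (u : Fin 2 × (ℕ × ℕ) → ℝ) :
    energy φ₁ φ₂ m n u u = ∑ i : rowIndex n, ∑ j : rowIndex n, u i * u j *
      diffCovMatrix φ₁ φ₂ m (Subtype.val : rowIndex n → _) i j ^ 2 := by
  rw [energy, ← Finset.sum_coe_sort (rowIndex n)]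
  refine Finset.sum_congr rfl fun i _ => ?_
  rw [← Finset.sum_coe_sort (rowIndex n)]
  rfl

theorem sum_rowWeight_mul_normDiff_sq {r : Regime} {n : ℕ} (τ : Fin 2 → ℝ)
    {R : Fin 2 → Finset (ℕ × ℕ)} (hR : ∀ l, R l ⊆ Lam n) (ω : Ω) :
    ∑ i ∈ rowIndex n, rowWeight n τ R i * normDiff φ₂ m X r n i ω ^ 2 =
      n * r.gain φ₂ n * ∑ l, τ l * (((R l).card : ℝ)⁻¹ *
        ∑ t ∈ R l, bilinearDiff m (l.val + 1) (sample X r n ω) t ^ 2) := by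
  have hg : 0 ≤ r.gain φ₂ n := by
    cases r
    · exact zero_le_one
    · exact Real.rpow_nonneg n.cast_nonneg _
  rw [sum_rowWeight_mul τ hR, mul_assoc, Finset.mul_sum (a := r.gain φ₂ n)]
  congr 1
  refine Finset.sum_congr rfl fun l _ => ?_
  simp only [normDiff, mul_pow, Real.sq_sqrt hg, ← Finset.mul_sum]
  ring

theorem statistic_sub (r : Regime) (n : ℕ) (u v : Fin 2 × (ℕ × ℕ) → ℝ) (ω : Ω) :
    statistic φ₁ φ₂ m X r n (u - v) ω =
      statistic φ₁ φ₂ m X r n u ω - statistic φ₁ φ₂ m X r n v ω := by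
  simp only [statistic, ← Finset.sum_sub_distrib, Pi.sub_apply, sub_mul]

variable [MeasurableSpace Ω] {P : Measure Ω}

theorem aemeasurable_statistic {K : Plane → ℝ} (hX : IsGaussianIRF k K X P) (r : Regime) (n : ℕ)
    (u : Fin 2 × (ℕ × ℕ) → ℝ) : AEMeasurable (statistic φ₁ φ₂ m X r n u) P := by
  unfold statistic
  exact Finset.aemeasurable_fun_sum _ fun i _ =>
    (((aemeasurable_normDiff hX r n i).pow_const 2).sub_const _).const_mul _

theorem memLp_normDiff {K : Plane → ℝ} (hm : k + 1 ≤ m) (hX : IsGaussianIRF k K X P)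
    (r : Regime) (n : ℕ) (i : Fin 2 × (ℕ × ℕ)) : MemLp (normDiff φ₂ m X r n i) 2 P := by
  have h := (hasGaussianLaw_sum_bilinearDiff hm hX r n (fun _ : Unit => i) fun _ => 1).1
  simp only [Finset.univ_unique, Finset.sum_singleton, one_mul] at h
  exact h.memLp_two.const_mul _

theorem integral_normDiff_sq (hφ₂ : 0 < φ₂) (hk : φ₂ < k + 1) (hm : k + 1 ≤ m)
    (hX : IsGaussianIRF k (powerLawGC φ₁ φ₂) X P) (r : Regime) {n : ℕ} (hn : 0 < n)
    (i : Fin 2 × (ℕ × ℕ)) :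
    ∫ ω, normDiff φ₂ m X r n i ω ^ 2 ∂P = latCov φ₁ φ₂ m i.1 i.1 0 := by
  obtain ⟨-, h2, h3⟩ := hasGaussianLaw_sum_normDiff hφ₂ hk hm hX r hn (fun _ : Unit => i)
    fun _ => 1
  rw [dotProduct_diffCovMatrix_mulVec] at h3
  simp only [Finset.univ_unique, Finset.sum_singleton, one_mul] at h2 h3
  rw [variance_of_integral_eq_zero (aemeasurable_normDiff hX r n i) h2] at h3
  rw [h3, diffCov, sub_self]

theorem memLp_statistic [IsProbabilityMeasure P] (hφ₂ : 0 < φ₂) (hk : φ₂ < k + 1) (hm : k + 1 ≤ m)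
    (hX : IsGaussianIRF k (powerLawGC φ₁ φ₂) X P) (r : Regime) {n : ℕ} (hn : 0 < n)
    (u : Fin 2 × (ℕ × ℕ) → ℝ) :
    MemLp (statistic φ₁ φ₂ m X r n u) 2 P ∧
      ∫ ω, statistic φ₁ φ₂ m X r n u ω ^ 2 ∂P = 2 * energy φ₁ φ₂ m n u u := by
  classical
  have hC := posSemidef_diffCovMatrix hφ₂ hk hm hX (Subtype.val : rowIndex n → _)
  have hZ := hasLaw_normDiff hφ₂ hk hm hX r hn (Subtype.val : rowIndex n → _)
  have h1 := memLp_centered_weighted_sq hC hZ fun i => u i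
  have h2 := integral_centered_weighted_sq_sq hC hZ fun i => u i
  simp_rw [← statistic_eq_sum_coe] at h1 h2
  rw [← energy_eq_sum_coe] at h2
  exact ⟨h1, h2⟩

theorem integral_sum_rowWeight_mul (hφ₂ : 0 < φ₂) (hk : φ₂ < k + 1) (hm : k + 1 ≤ m)
    (hX : IsGaussianIRF k (powerLawGC φ₁ φ₂) X P) (r : Regime) {n : ℕ} (hn : 0 < n)
    (u : Fin 2 × (ℕ × ℕ) → ℝ) :
    ∫ ω, ∑ i ∈ rowIndex n, u i * normDiff φ₂ m X r n i ω ^ 2 ∂P =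
      ∑ i ∈ rowIndex n, u i * diffCov φ₁ φ₂ m i i := by
  rw [integral_finsetSum _ fun i _ => (memLp_normDiff hm hX r n i).integrable_sq.const_mul _]
  refine Finset.sum_congr rfl fun i _ => ?_
  rw [integral_const_mul, integral_normDiff_sq hφ₂ hk hm hX r hn, diffCov, sub_self]

theorem statistic_eq_sub_integral (hφ₂ : 0 < φ₂) (hk : φ₂ < k + 1) (hm : k + 1 ≤ m)
    (hX : IsGaussianIRF k (powerLawGC φ₁ φ₂) X P) (r : Regime) {n : ℕ} (hn : 0 < n)
    (u : Fin 2 × (ℕ × ℕ) → ℝ) (ω : Ω) :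
    statistic φ₁ φ₂ m X r n u ω = ∑ i ∈ rowIndex n, u i * normDiff φ₂ m X r n i ω ^ 2 -
      ∫ ω', ∑ i ∈ rowIndex n, u i * normDiff φ₂ m X r n i ω' ^ 2 ∂P := by
  rw [integral_sum_rowWeight_mul hφ₂ hk hm hX r hn, ← Finset.sum_sub_distrib, statistic]
  exact Finset.sum_congr rfl fun i _ => mul_sub _ _ _

variable [IsProbabilityMeasure P] {D : ℕ → Finset (ℕ × ℕ)}

/-- Convergence in `L²`: the second moment of the statistic is twice the energy of the weight
difference. -/
theorem tendstoInMeasure_statistic_sub (hφ₁ : 0 < φ₁) (hφ₂ : 0 < φ₂) (hk : φ₂ < k + 1)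
    (hm : k + 1 ≤ m) (hX : IsGaussianIRF k (powerLawGC φ₁ φ₂) X P)
    (hcard : (fun n => ((D n).card : ℝ)) =o[atTop] fun n : ℕ => √((n : ℝ) ^ 2))
    (r : Regime) (τ : Fin 2 → ℝ) :
    TendstoInMeasure P (fun n => statistic φ₁ φ₂ m X r n
      (rowWeight n τ (prunedRows m n (D n)) - rowWeight n τ (fullRows m n))) atTop
      (fun _ => 0) := by
  refine tendstoInMeasure_of_tendsto_eLpNorm (p := 2) two_ne_zero
    (fun n => (aemeasurable_statistic hX r n _).aestronglyMeasurable)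
    aestronglyMeasurable_const ?_
  have h1 := ((tendsto_energy_sub hφ₁ hφ₂ hk hm hcard τ).const_mul 2).rpow_const
    (p := 1 / 2) (Or.inr (by norm_num))
  rw [mul_zero, Real.zero_rpow (by norm_num)] at h1
  have h2 := ENNReal.tendsto_ofReal h1
  rw [ENNReal.ofReal_zero] at h2
  refine h2.congr' ?_
  filter_upwards [eventually_gt_atTop 0] with n hn
  obtain ⟨h3, h4⟩ := memLp_statistic hφ₂ hk hm hX r hn
    (rowWeight n τ (prunedRows m n (D n)) - rowWeight n τ (fullRows m n))
  have h5 : (statistic φ₁ φ₂ m X r n (rowWeight n τ (prunedRows m n (D n)) -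
      rowWeight n τ (fullRows m n)) - fun _ => 0) = statistic φ₁ φ₂ m X r n
      (rowWeight n τ (prunedRows m n (D n)) - rowWeight n τ (fullRows m n)) := sub_zero _
  rw [h5, h3.eLpNorm_eq_integral_rpow_norm two_ne_zero ENNReal.ofNat_ne_top, ← h4]
  simp

/-- The weights are at most `∑ |τ_l| (n²/|R_l|) / n = O(1/n)`. With the uniform bound `L` on the
covariance matrices this makes the error in `norm_charFun_weighted_sq_sub_le` vanish, while the
energy in the exponent converges. -/
theorem tendsto_integral_exp_statistic (hφ₁ : 0 < φ₁) (hφ₂ : 0 < φ₂) (hk : φ₂ < k + 1)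
    (hm : k + 1 ≤ m) (hX : IsGaussianIRF k (powerLawGC φ₁ φ₂) X P)
    (hcard : (fun n => ((D n).card : ℝ)) =o[atTop] fun n : ℕ => √((n : ℝ) ^ 2))
    (r : Regime) (τ : Fin 2 → ℝ) :
    Tendsto (fun n => ∫ ω, Complex.exp ((statistic φ₁ φ₂ m X r n
      (rowWeight n τ (prunedRows m n (D n))) ω : ℝ) * Complex.I) ∂P) atTop
      (𝓝 (Real.exp (-∑ l, ∑ l', τ l * τ l' * (limitCov φ₁ φ₂ m l l' / 2)) : ℝ)) := by
  obtain ⟨L, hL0, hL⟩ := exists_diffCovMatrix_le hφ₁ hφ₂ hk hm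
  have hE := tendsto_energy_prunedRows hφ₁ hφ₂ hk hm hcard τ
  have hM : Tendsto (fun n : ℕ => ∑ l, |τ l| * ((n : ℝ) ^ 2 / (prunedRows m n (D n) l).card *
      (n : ℝ)⁻¹)) atTop (𝓝 0) := by
    have h := tendsto_finsetSum Finset.univ fun (l : Fin 2) _ =>
      ((tendsto_card_keptRows hcard m (l.val + 1)).mul
        tendsto_inv_atTop_nhds_zero_nat).const_mul |τ l|
    simp only [mul_zero, Finset.sum_const_zero] at h
    exact h
  have hbound := ((hM.mul_const L).const_mul (4 * chiThird + 1)).mul hE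
  rw [zero_mul, mul_zero, zero_mul] at hbound
  have h1 : Tendsto (fun n => (∫ ω, Complex.exp ((statistic φ₁ φ₂ m X r n
      (rowWeight n τ (prunedRows m n (D n))) ω : ℝ) * Complex.I) ∂P) -
      (Real.exp (-energy φ₁ φ₂ m n (rowWeight n τ (prunedRows m n (D n)))
        (rowWeight n τ (prunedRows m n (D n)))) : ℝ)) atTop (𝓝 0) := by
    refine squeeze_zero_norm' ?_ hbound
    filter_upwards [eventually_gt_atTop 0] with n hn
    classical
    have hC := posSemidef_diffCovMatrix hφ₂ hk hm hX (Subtype.val : rowIndex n → _)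
    have hZ := hasLaw_normDiff hφ₂ hk hm hX r hn (Subtype.val : rowIndex n → _)
    have h2 := norm_charFun_weighted_sq_sub_le hC hZ
      (fun i => rowWeight n τ (prunedRows m n (D n)) i)
      (hL (Subtype.val : rowIndex n → _) Subtype.val_injective)
      (M := ∑ l, |τ l| * ((n : ℝ) ^ 2 / (prunedRows m n (D n) l).card * (n : ℝ)⁻¹)) fun i => by
        have hn' : (n : ℝ) ≠ 0 := by positivity
        refine le_trans ?_ (Finset.single_le_sum (f := fun l => |τ l| * ((n : ℝ) ^ 2 /
          (prunedRows m n (D n) l).card * (n : ℝ)⁻¹)) (fun l _ => by positivity)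
          (Finset.mem_univ i.1.1))
        rw [rowWeight]
        split_ifs
        · rw [abs_mul, abs_mul, Nat.abs_cast, abs_inv, Nat.abs_cast]
          refine le_of_eq ?_
          field_simp
        · rw [abs_zero]; positivity
    simp_rw [← statistic_eq_sum_coe] at h2
    rw [← energy_eq_sum_coe] at h2
    exact h2
  have h2 := h1.add (Complex.continuous_ofReal.tendsto _ |>.comp
    (Real.continuous_exp.tendsto _ |>.comp hE.neg))
  rw [zero_add] at h2
  refine h2.congr fun n => ?_
  simp only [Function.comp_apply, sub_add_cancel]

end Statistic

/-! ### The limiting covariance, and the averages expressed through the statistics -/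

theorem posSemidef_limitCov {φ₁ φ₂ : ℝ} {m : ℕ} (hφ₁ : 0 < φ₁) (hφ₂ : 0 < φ₂) (hm : φ₂ < m)
    (hm1 : 1 ≤ m) : (limitCov φ₁ φ₂ m).PosSemidef := by
  obtain ⟨M, hM0, hM⟩ := exists_filteredDensity_le hφ₁ hφ₂ hm hm1
  have hint : ∀ l l', Integrable (fun ξ => stepSymbol m l ξ * stepSymbol m l' ξ *
      filteredDensity φ₁ φ₂ m ξ ^ 2) (volume.restrict torus) := by
    intro l l'
    simp_rw [← norm_crossDensity_sq hφ₁ hφ₂]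
    refine Integrable.of_bound (C := (16 ^ m * M) ^ 2)
      ((measurable_crossDensity hφ₁ hφ₂ m l l').norm.pow_const 2).aestronglyMeasurable ?_
    refine (ae_restrict_iff' measurableSet_torus).2 (Eventually.of_forall fun ξ hξ => ?_)
    rw [norm_pow, norm_norm]
    exact pow_le_pow_left₀ (norm_nonneg _) ((norm_crossDensity_le hφ₁ hφ₂ m l l' ξ).trans
      (mul_le_mul_of_nonneg_left (hM ξ hξ) (by positivity))) 2
  refine Matrix.PosSemidef.of_dotProduct_mulVec_nonneg ?_ fun x => ?_
  · ext l l'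
    simp only [limitCov, Matrix.conjTranspose_apply, Matrix.of_apply, star_trivial]
    simp_rw [mul_comm (stepSymbol m l' _)]
  -- `limitCov` is a Gram matrix: its quadratic form is the integral of the square of `(x₁ b₁ + x₂
  -- b₂) F`.
  · have h : star x ⬝ᵥ limitCov φ₁ φ₂ m *ᵥ x = 2 * ((2 * Real.pi) ^ 2)⁻¹ *
        ∫ ξ in torus, ((∑ l, x l * stepSymbol m l ξ) * filteredDensity φ₁ φ₂ m ξ) ^ 2 := by
      have h1 : ∀ ξ, ((∑ l, x l * stepSymbol m l ξ) * filteredDensity φ₁ φ₂ m ξ) ^ 2 =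
          ∑ l, ∑ l', x l * x l' * (stepSymbol m l ξ * stepSymbol m l' ξ *
            filteredDensity φ₁ φ₂ m ξ ^ 2) := by
        intro ξ
        simp only [Fin.sum_univ_two]
        ring
      simp_rw [h1]
      rw [integral_finsetSum _ fun l _ => integrable_finsetSum _ fun l' _ =>
        (hint l l').const_mul _]
      simp_rw [integral_finsetSum _ fun l' _ => (hint _ l').const_mul _, integral_const_mul,
        star_trivial, dotProduct, mulVec, dotProduct, limitCov, Matrix.of_apply, Finset.mul_sum]
      exact Finset.sum_congr rfl fun l _ => Finset.sum_congr rfl fun l' _ => by ring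
    rw [h]
    exact mul_nonneg (by positivity) (integral_nonneg fun ξ => sq_nonneg _)

section QuadraticForms

variable {φ₁ φ₂ : ℝ} {m k : ℕ} {Ω : Type*} [MeasurableSpace Ω] {P : Measure Ω}
  {X : Plane → Ω → ℝ} {D : ℕ → Finset (ℕ × ℕ)}

theorem quadForm_add_smul {n : ℕ} (A B : Matrix (Lam n) (Lam n) ℝ) (α β : ℝ)
    (x : ℕ × ℕ → ℝ) : quadForm (α • A + β • B) x = α * quadForm A x + β * quadForm B x := by
  simp only [quadForm, Matrix.add_mulVec, Matrix.smul_mulVec, dotProduct_add, dotProduct_smul,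
    smul_eq_mul]

theorem quadForm_prunedWeight (m n : ℕ) (D : Finset (ℕ × ℕ)) (α β : ℝ) (x : ℕ × ℕ → ℝ) :
    quadForm (prunedWeight m n D α β) x = ∑ l, ![α, β] l * (((prunedRows m n D l).card : ℝ)⁻¹ *
      ∑ t ∈ prunedRows m n D l, bilinearDiff m (l.val + 1) x t ^ 2) := by
  rw [prunedWeight, quadForm_add_smul, quadForm_weightMatrix _ _ _ _ (keptRows_subset _ _ _ _),
    quadForm_weightMatrix _ _ _ _ (keptRows_subset _ _ _ _), Fin.sum_univ_two]
  rfl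

theorem quadForm_fullWeight (m n : ℕ) (α β : ℝ) (x : ℕ × ℕ → ℝ) :
    quadForm (fullWeight m n α β) x = ∑ l, ![α, β] l * (((fullRows m n l).card : ℝ)⁻¹ *
      ∑ t ∈ fullRows m n l, bilinearDiff m (l.val + 1) x t ^ 2) := by
  rw [fullWeight, quadForm_add_smul, quadForm_weightMatrix _ _ _ _ subset_rfl,
    quadForm_weightMatrix _ _ _ _ subset_rfl, Fin.sum_univ_two]
  rfl

theorem integrable_meanSq {K : Plane → ℝ} (hm : k + 1 ≤ m) (hX : IsGaussianIRF k K X P)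
    (r : Regime) (n : ℕ) (l : Fin 2) (R : Finset (ℕ × ℕ)) :
    Integrable (fun ω => (R.card : ℝ)⁻¹ *
      ∑ t ∈ R, bilinearDiff m (l.val + 1) (sample X r n ω) t ^ 2) P := by
  refine (integrable_finsetSum _ fun t _ => ?_).const_mul _
  have h := (hasGaussianLaw_sum_bilinearDiff hm hX r n (fun _ : Unit => (l, t)) fun _ => 1).1
  simp only [Finset.univ_unique, Finset.sum_singleton, one_mul] at h
  exact h.memLp_two.integrable_sq

theorem statistic_rowWeight_eq (hφ₂ : 0 < φ₂) (hk : φ₂ < k + 1) (hm : k + 1 ≤ m)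
    (hX : IsGaussianIRF k (powerLawGC φ₁ φ₂) X P) (r : Regime) {n : ℕ} (hn : 0 < n)
    (τ : Fin 2 → ℝ) {R : Fin 2 → Finset (ℕ × ℕ)} (hR : ∀ l, R l ⊆ Lam n) (ω : Ω) :
    statistic φ₁ φ₂ m X r n (rowWeight n τ R) ω = √((n : ℝ) ^ 2) * r.gain φ₂ n *
      ((∑ l, τ l * (((R l).card : ℝ)⁻¹ *
        ∑ t ∈ R l, bilinearDiff m (l.val + 1) (sample X r n ω) t ^ 2)) -
      ∫ ω', ∑ l, τ l * (((R l).card : ℝ)⁻¹ *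
        ∑ t ∈ R l, bilinearDiff m (l.val + 1) (sample X r n ω') t ^ 2) ∂P) := by
  rw [statistic_eq_sub_integral hφ₂ hk hm hX r hn, Real.sqrt_sq n.cast_nonneg]
  simp_rw [sum_rowWeight_mul_normDiff_sq τ hR]
  rw [integral_const_mul, mul_sub]

/-- The mean of the averaged squared differences does not depend on the positions. -/
theorem gain_mul_integral_meanSq (hφ₂ : 0 < φ₂) (hk : φ₂ < k + 1) (hm : k + 1 ≤ m)
    (hX : IsGaussianIRF k (powerLawGC φ₁ φ₂) X P) (r : Regime) {n : ℕ} (hn : 0 < n)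
    (l : Fin 2) {R : Finset (ℕ × ℕ)} (hR : R.Nonempty) :
    r.gain φ₂ n * ∫ ω, (R.card : ℝ)⁻¹ *
      ∑ t ∈ R, bilinearDiff m (l.val + 1) (sample X r n ω) t ^ 2 ∂P =
      latCov φ₁ φ₂ m l l 0 := by
  have hg := (gain_mul_spacing_rpow (φ₂ := φ₂) r hn).2.1
  have h1 : ∀ ω, r.gain φ₂ n * ((R.card : ℝ)⁻¹ *
      ∑ t ∈ R, bilinearDiff m (l.val + 1) (sample X r n ω) t ^ 2) =
      (R.card : ℝ)⁻¹ * ∑ t ∈ R, normDiff φ₂ m X r n (l, t) ω ^ 2 := by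
    intro ω
    simp only [normDiff, mul_pow, Real.sq_sqrt hg.le, ← Finset.mul_sum]
    ring
  have hc : (R.card : ℝ) ≠ 0 := by exact_mod_cast hR.card_pos.ne'
  rw [← integral_const_mul]
  simp_rw [h1]
  rw [integral_const_mul, integral_finsetSum _ fun t _ =>
    (memLp_normDiff hm hX r n (l, t)).integrable_sq]
  simp_rw [integral_normDiff_sq hφ₂ hk hm hX r hn]
  rw [Finset.sum_const, nsmul_eq_mul, inv_mul_cancel_left₀ hc]

/-- Lévy's continuity theorem: for large `n` the characteristic function of the scaled vector at `τ`
is the expectation of `exp (i · statistic)` for the weights built from `τ`, whose limit is known. -/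
theorem tendstoInDistribution_prunedQ [IsProbabilityMeasure P]
    (hφ₁ : 0 < φ₁) (hφ₂ : 0 < φ₂) (hk : φ₂ < k + 1)
    (hm : k + 1 ≤ m) (hX : IsGaussianIRF k (powerLawGC φ₁ φ₂) X P)
    (hcard : (fun n => ((D n).card : ℝ)) =o[atTop] fun n : ℕ => √((n : ℝ) ^ 2))
    (r : Regime) (hpsd : (limitCov φ₁ φ₂ m).PosSemidef) :
    TendstoInDistribution
      (fun (n : ℕ) ω => (√((n : ℝ) ^ 2) * r.gain φ₂ n) •
        !₂[prunedQ m 1 n (D n) (sample X r n ω) - ∫ ω', Q m 1 n (sample X r n ω') ∂P,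
           prunedQ m 2 n (D n) (sample X r n ω) - ∫ ω', Q m 2 n (sample X r n ω') ∂P])
      atTop (id : EuclideanSpace ℝ (Fin 2) → EuclideanSpace ℝ (Fin 2)) (fun _ => P)
      (multivariateGaussian 0 (limitCov φ₁ φ₂ m)) := by
  have hmeas : ∀ n : ℕ, AEMeasurable (fun ω => (√((n : ℝ) ^ 2) * r.gain φ₂ n) •
        !₂[prunedQ m 1 n (D n) (sample X r n ω) - ∫ ω', Q m 1 n (sample X r n ω') ∂P,
           prunedQ m 2 n (D n) (sample X r n ω) - ∫ ω', Q m 2 n (sample X r n ω') ∂P]) P := by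
    intro n
    have h : AEMeasurable (fun ω => !₂[prunedQ m 1 n (D n) (sample X r n ω) -
        ∫ ω', Q m 1 n (sample X r n ω') ∂P, prunedQ m 2 n (D n) (sample X r n ω) -
        ∫ ω', Q m 2 n (sample X r n ω') ∂P]) P := by
      refine (WithLp.measurable_toLp 2 (Fin 2 → ℝ)).comp_aemeasurable
        (aemeasurable_pi_lambda _ fun l => ?_)
      fin_cases l
      · exact (integrable_meanSq hm hX r n 0 (keptRows m 1 n (D n))).aemeasurable.sub_const _
      · exact (integrable_meanSq hm hX r n 1 (keptRows m 2 n (D n))).aemeasurable.sub_const _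
    exact h.const_smul (√((n : ℝ) ^ 2) * r.gain φ₂ n)
  refine ⟨hmeas, by fun_prop, ?_⟩
  refine ProbabilityMeasure.tendsto_iff_tendsto_charFun.2 fun τ => ?_
  simp only [ProbabilityMeasure.coe_mk, Measure.map_id]
  rw [charFun_multivariateGaussian hpsd]
  have hlim : Complex.exp (((inner ℝ τ (0 : EuclideanSpace ℝ (Fin 2)) : ℝ) : ℂ) * Complex.I -
      ((τ.ofLp ⬝ᵥ limitCov φ₁ φ₂ m *ᵥ τ.ofLp : ℝ) : ℂ) / 2) =
      (Real.exp (-∑ l, ∑ l', τ l * τ l' * (limitCov φ₁ φ₂ m l l' / 2)) : ℝ) := by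
    rw [inner_zero_right, Complex.ofReal_zero, zero_mul, zero_sub, Complex.ofReal_exp]
    congr 1
    simp only [dotProduct, mulVec, Fin.sum_univ_two]
    push_cast
    ring
  rw [hlim]
  refine (tendsto_integral_exp_statistic hφ₁ hφ₂ hk hm hX hcard r τ).congr' ?_
  filter_upwards [eventually_gt_atTop 0,
    eventually_all.2 fun l : Fin 2 => eventually_nonempty_keptRows hcard m (l.val + 1)]
    with n hn hne
  rw [charFun_apply, integral_map (hmeas n) (by fun_prop)]
  refine integral_congr_ae (Eventually.of_forall fun ω => ?_)
  have hneQ : ∀ l : Fin 2, (allRows m (l.val + 1) n).Nonempty := fun l =>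
    (hne l).mono (keptRows_subset _ _ _ _)
  -- Every squared difference of a given step has the same mean, so averages over any nonempty sets
  -- of positions do too; hence the unpruned mean also centers the pruned average.
  have hmean : ∀ l : Fin 2, r.gain φ₂ n * ∫ ω', Q m (l.val + 1) n (sample X r n ω') ∂P =
      r.gain φ₂ n * ∫ ω', prunedQ m (l.val + 1) n (D n) (sample X r n ω') ∂P := fun l =>
    (gain_mul_integral_meanSq hφ₂ hk hm hX r hn l (hneQ l)).trans
      (gain_mul_integral_meanSq hφ₂ hk hm hX r hn l (hne l)).symm
  have hst := statistic_rowWeight_eq hφ₂ hk hm hX r hn τ.ofLp (fun l =>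
    (prunedRows_subset m n (D n) l).trans (fullRows_subset m n l)) ω
  rw [integral_finsetSum _ fun l _ => (integrable_meanSq hm hX r n l _).const_mul _] at hst
  rw [Fin.sum_univ_two, Fin.sum_univ_two, integral_const_mul (τ 0),
    integral_const_mul (τ 1)] at hst
  have h0 := hmean 0
  have h1 := hmean 1
  have hinner : statistic φ₁ φ₂ m X r n (rowWeight n τ.ofLp (prunedRows m n (D n))) ω =
      inner ℝ ((√((n : ℝ) ^ 2) * r.gain φ₂ n) •
        !₂[prunedQ m 1 n (D n) (sample X r n ω) - ∫ ω', Q m 1 n (sample X r n ω') ∂P,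
           prunedQ m 2 n (D n) (sample X r n ω) - ∫ ω', Q m 2 n (sample X r n ω') ∂P]) τ := by
    rw [hst, real_inner_smul_left, PiLp.inner_apply, Fin.sum_univ_two]
    change √((n : ℝ) ^ 2) * r.gain φ₂ n *
      (τ 0 * prunedQ m 1 n (D n) (sample X r n ω) + τ 1 * prunedQ m 2 n (D n) (sample X r n ω) -
      (τ 0 * ∫ ω', prunedQ m 1 n (D n) (sample X r n ω') ∂P +
        τ 1 * ∫ ω', prunedQ m 2 n (D n) (sample X r n ω') ∂P)) = √((n : ℝ) ^ 2) * r.gain φ₂ n *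
      (τ 0 * (prunedQ m 1 n (D n) (sample X r n ω) - ∫ ω', Q m 1 n (sample X r n ω') ∂P) +
      τ 1 * (prunedQ m 2 n (D n) (sample X r n ω) - ∫ ω', Q m 2 n (sample X r n ω') ∂P))
    change r.gain φ₂ n * ∫ ω', Q m 1 n (sample X r n ω') ∂P =
      r.gain φ₂ n * ∫ ω', prunedQ m 1 n (D n) (sample X r n ω') ∂P at h0
    change r.gain φ₂ n * ∫ ω', Q m 2 n (sample X r n ω') ∂P =
      r.gain φ₂ n * ∫ ω', prunedQ m 2 n (D n) (sample X r n ω') ∂P at h1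
    linear_combination √((n : ℝ) ^ 2) * τ 0 * h0 + √((n : ℝ) ^ 2) * τ 1 * h1
  beta_reduce
  rw [hinner]

end QuadraticForms

end PowerLawGaps

end

theorem mainTheorem8 {Ω : Type*} [MeasurableSpace Ω] (P : Measure Ω) [IsProbabilityMeasure P]
    (φ₁ φ₂ : ℝ) (hφ₁ : 0 < φ₁) (hφ₂ : 0 < φ₂)
    (k m : ℕ) (hk : φ₂ < k + 1) (hm : k + 1 ≤ m)
    (X : PowerLawGaps.Plane → Ω → ℝ)
    (hX : PowerLawGaps.IsGaussianIRF k (PowerLawGaps.powerLawGC φ₁ φ₂) X P)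
    (D : ℕ → Finset (ℕ × ℕ)) (hD : ∀ n, D n ⊆ PowerLawGaps.Lam n)
    (hcard : (fun n => ((D n).card : ℝ)) =o[atTop] fun n : ℕ => √((n : ℝ) ^ 2))
    (r : PowerLawGaps.Regime) :
    (∀ α β : ℝ,
      (∀ n, Integrable (fun ω => PowerLawGaps.quadForm
          (PowerLawGaps.prunedWeight m n (D n) α β) (PowerLawGaps.sample X r n ω)) P) ∧
      (∀ n, Integrable (fun ω => PowerLawGaps.quadForm
          (PowerLawGaps.fullWeight m n α β) (PowerLawGaps.sample X r n ω)) P) ∧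
      TendstoInMeasure P
        (fun (n : ℕ) ω =>
          √((n : ℝ) ^ 2) * r.gain φ₂ n *
            (PowerLawGaps.quadForm (PowerLawGaps.prunedWeight m n (D n) α β)
                (PowerLawGaps.sample X r n ω)
              - ∫ ω', PowerLawGaps.quadForm (PowerLawGaps.prunedWeight m n (D n) α β)
                  (PowerLawGaps.sample X r n ω') ∂P)
          - √((n : ℝ) ^ 2) * r.gain φ₂ n *
            (PowerLawGaps.quadForm (PowerLawGaps.fullWeight m n α β)
                (PowerLawGaps.sample X r n ω)
              - ∫ ω', PowerLawGaps.quadForm (PowerLawGaps.fullWeight m n α β)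
                  (PowerLawGaps.sample X r n ω') ∂P))
        atTop (fun _ => 0)) ∧
    (PowerLawGaps.limitCov φ₁ φ₂ m).PosSemidef ∧
    TendstoInDistribution
      (fun (n : ℕ) ω => (√((n : ℝ) ^ 2) * r.gain φ₂ n) •
        !₂[PowerLawGaps.prunedQ m 1 n (D n) (PowerLawGaps.sample X r n ω)
              - ∫ ω', PowerLawGaps.Q m 1 n (PowerLawGaps.sample X r n ω') ∂P,
           PowerLawGaps.prunedQ m 2 n (D n) (PowerLawGaps.sample X r n ω)
              - ∫ ω', PowerLawGaps.Q m 2 n (PowerLawGaps.sample X r n ω') ∂P])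
      atTop (id : EuclideanSpace ℝ (Fin 2) → EuclideanSpace ℝ (Fin 2)) (fun _ => P)
      (multivariateGaussian 0 (PowerLawGaps.limitCov φ₁ φ₂ m)) := by
  have hkm : (k : ℝ) + 1 ≤ m := by exact_mod_cast hm
  have hpsd := PowerLawGaps.posSemidef_limitCov hφ₁ hφ₂ (m := m) (by linarith) (by omega)
  refine ⟨fun α β => ⟨fun n => ?_, fun n => ?_, ?_⟩, hpsd,
    PowerLawGaps.tendstoInDistribution_prunedQ hφ₁ hφ₂ hk hm hX hcard r hpsd⟩
  · simp_rw [PowerLawGaps.quadForm_prunedWeight]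
    exact integrable_finsetSum _ fun l _ =>
      (PowerLawGaps.integrable_meanSq hm hX r n l _).const_mul _
  · simp_rw [PowerLawGaps.quadForm_fullWeight]
    exact integrable_finsetSum _ fun l _ =>
      (PowerLawGaps.integrable_meanSq hm hX r n l _).const_mul _
  -- For `n > 0` the difference of the two scaled, centered forms is the statistic of the weight
  -- difference with `τ = (α, β)`; the index `n = 0` is irrelevant to the limit.
  · refine (PowerLawGaps.tendstoInMeasure_statistic_sub hφ₁ hφ₂ hk hm hX hcard r ![α, β]).congr'
      ?_ (ae_eq_refl _)
    filter_upwards [eventually_gt_atTop 0] with n hn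
    refine Eventually.of_forall fun ω => ?_
    simp_rw [PowerLawGaps.quadForm_prunedWeight, PowerLawGaps.quadForm_fullWeight]
    rw [PowerLawGaps.statistic_sub,
      PowerLawGaps.statistic_rowWeight_eq hφ₂ hk hm hX r hn _ fun l =>
        (PowerLawGaps.prunedRows_subset m n (D n) l).trans (PowerLawGaps.fullRows_subset m n l),
      PowerLawGaps.statistic_rowWeight_eq hφ₂ hk hm hX r hn _ (PowerLawGaps.fullRows_subset m n)]
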